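/- Let $k$ be an associative ring with unit, not necessarily commutative ($k$-modules are left modules), and let $X$ be a connected, locally simply connected topological space; here a space is called simply connected if it is connected and each of its coverings is trivial, and $X$ is locally simply connected if its simply connected open subsets form a basis of its topology. Let $\phi\colon \widetilde X\to X$ be a universal covering (a covering with $\widetilde X$ simply connected) and $G=\operatorname{Aut}_X\widetilde X$. Let $\operatorname{Shv}_k(X)$ be the category of sheaves of $k$-modules on $X$, let $D^+(X)$ be its bounded below derived category, and let $\operatorname{Qcoh}_k(X)\subset\operatorname{Shv}_k(X)$ be the full subcategory of quasi-coherent sheaves, i.e. of the sheaves $F$ such that every point of $X$ has an open neighbourhood $U$ with an exact sequence $k_U^{\oplus I}\to k_U^{\oplus J}\to F|_U\to 0$ for some sets $I,J$; it is an abelian subcategory. Let $\operatorname{Mod}_k(G)$ be the category of $k$-linear representations of $G$. For $F\in D^+(X)$ and $i\in\mathbb Z$, the group $G$ acts on $H^i(\widetilde X,\phi^{-1}F)=H^i(\mathbb R\Gamma(\widetilde X,\phi^{-1}F))$, an element $g$ acting by the pullback along $g^{-1}\colon \widetilde X\to\widetilde X$; likewise $G$ acts on $\Gamma(\widetilde X,\phi^{-1}L)$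 for a sheaf $L$ on $X$. Then: (a) The functor $L\mapsto \Gamma(\widetilde X,\phi^{-1}L)$ is an equivalence $\operatorname{Qcoh}_k(X)\simeq\operatorname{Mod}_k(G)$. (b) The inclusion $\operatorname{Qcoh}_k(X)\hookrightarrow\operatorname{Shv}_k(X)$ has a right adjoint $\operatorname{Qc}$. (c) Let $\mathbb R\operatorname{Qc}\colon D^+(X)\to D^+(\operatorname{Qcoh}_k(X))$ be the right derived functor of $\operatorname{Qc}$ and $R^i\operatorname{Qc}(F)=H^i(\mathbb R\operatorname{Qc}(F))$. For every $i\in\mathbb Z$ there is an isomorphism of $G$-modules, natural in $F\in D^+(X)$, between $H^i(\widetilde X,\phi^{-1}F)$ and the $G$-module that corresponds to $R^i\operatorname{Qc}(F)$ under the equivalence of (a): $$\Gamma\bigl(\widetilde X,\phi^{-1}R^i\operatorname{Qc}(F)\bigr)\;\cong\; H^i(\widetilde X,\phi^{-1}F).$$ (d) For every covering map $\psi\colon Y'\to Y$ of topological spaces, the functor $\psi^{-1}\colon\operatorname{Shv}_k(Y)\to\operatorname{Shv}_k(Y')$ sends injective sheaves to injective sheaves. -/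

import Mathlib

open CategoryTheory Limits TopologicalSpace Opposite
universe u
noncomputable section
namespace LocSys

section Derived

variable {C D E : Type*} [Category* C] [Category* D] [Category* E]

section Additive

variable [Preadditive C] [Preadditive D] [Preadditive E]

/-- The natural transformation on bounded below complexes up to homotopy induced by a
natural transformation of additive functors, whose target is a composite. -/
def mapPlusTo {F : C ⥤ E} {A : C ⥤ D} {B : D ⥤ E} [F.Additive] [A.Additive] [B.Additive]
    (τ : F ⟶ A ⋙ B) :
    F.mapHomotopyCategoryPlus ⟶ A.mapHomotopyCategoryPlus ⋙ B.mapHomotopyCategoryPlus :=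
  { app K := ObjectProperty.homMk
      ((NatTrans.mapHomotopyCategory τ (ComplexShape.up ℤ)).app K.obj)
    naturality K L f := by
      obtain ⟨K, rfl⟩ := HomotopyCategory.Plus.quotient_obj_surjective K
      obtain ⟨L, rfl⟩ := HomotopyCategory.Plus.quotient_obj_surjective L
      obtain ⟨f, rfl⟩ := (HomotopyCategory.Plus.quotient C).map_surjective f
      ext
      exact (NatTrans.mapHomotopyCategory τ (ComplexShape.up ℤ)).naturality
        ((HomotopyCategory.Plus.quotient C).map f).hom }

/-- The natural transformation on bounded below complexes up to homotopy induced by a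
natural transformation of additive functors, whose source is a composite. -/
def mapPlusFrom {F : C ⥤ E} {A : C ⥤ D} {B : D ⥤ E} [F.Additive] [A.Additive] [B.Additive]
    (τ : A ⋙ B ⟶ F) :
    A.mapHomotopyCategoryPlus ⋙ B.mapHomotopyCategoryPlus ⟶ F.mapHomotopyCategoryPlus :=
  { app K := ObjectProperty.homMk
      ((NatTrans.mapHomotopyCategory τ (ComplexShape.up ℤ)).app K.obj)
    naturality K L f := by
      obtain ⟨K, rfl⟩ := HomotopyCategory.Plus.quotient_obj_surjective K
      obtain ⟨L, rfl⟩ := HomotopyCategory.Plus.quotient_obj_surjective L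
      obtain ⟨f, rfl⟩ := (HomotopyCategory.Plus.quotient C).map_surjective f
      ext
      exact (NatTrans.mapHomotopyCategory τ (ComplexShape.up ℤ)).naturality
        ((HomotopyCategory.Plus.quotient C).map f).hom }

/-- The natural transformation on bounded below complexes up to homotopy induced by a
natural transformation of additive functors, whose target is the identity functor. -/
def mapPlusId {A : C ⥤ C} [A.Additive] (τ : A ⟶ 𝟭 C) :
    A.mapHomotopyCategoryPlus ⟶ 𝟭 _ :=
  { app K := ObjectProperty.homMk
      ((NatTrans.mapHomotopyCategory τ (ComplexShape.up ℤ)).app K.obj)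
    naturality K L f := by
      obtain ⟨K, rfl⟩ := HomotopyCategory.Plus.quotient_obj_surjective K
      obtain ⟨L, rfl⟩ := HomotopyCategory.Plus.quotient_obj_surjective L
      obtain ⟨f, rfl⟩ := (HomotopyCategory.Plus.quotient C).map_surjective f
      ext
      exact (NatTrans.mapHomotopyCategory τ (ComplexShape.up ℤ)).naturality
        ((HomotopyCategory.Plus.quotient C).map f).hom }

end Additive

variable [Abelian C] [Abelian D] [Abelian E]
  [HasDerivedCategory D] [HasDerivedCategory E]

open DerivedCategory.Plus

lemma exact_inverts (F : C ⥤ D) [F.Additive] [PreservesFiniteLimits F]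
    [PreservesFiniteColimits F] :
    (HomotopyCategory.Plus.quasiIso C).IsInvertedBy (F.mapHomotopyCategoryPlus ⋙ Qh) := by
  intro K L f hf
  apply Localization.inverts Qh (HomotopyCategory.Plus.quasiIso D)
  obtain ⟨K, rfl⟩ := HomotopyCategory.Plus.quotient_obj_surjective K
  obtain ⟨L, rfl⟩ := HomotopyCategory.Plus.quotient_obj_surjective L
  obtain ⟨f, rfl⟩ := (HomotopyCategory.Plus.quotient C).map_surjective f
  have h1 : QuasiIso f.hom := by
    rw [← HomologicalComplex.mem_quasiIso_iff, ← HomotopyCategory.quotient_map_mem_quasiIso_iff]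
    exact hf
  have h2 : QuasiIso ((F.mapHomologicalComplex (ComplexShape.up ℤ)).map f.hom) := inferInstance
  rw [← HomologicalComplex.mem_quasiIso_iff, ← HomotopyCategory.quotient_map_mem_quasiIso_iff] at h2
  exact h2

section Exact

variable [HasDerivedCategory C]

/-- The functor `D⁺(C) ⥤ D⁺(D)` induced by an exact functor, termwise on complexes. -/
def exactDerived (F : C ⥤ D) [F.Additive] [PreservesFiniteLimits F] [PreservesFiniteColimits F] :
    DerivedCategory.Plus C ⥤ DerivedCategory.Plus D :=
  Localization.lift (F.mapHomotopyCategoryPlus ⋙ Qh) (exact_inverts F) Qh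

/-- `exactDerived F` is computed by applying `F` termwise to bounded below complexes. -/
def exactDerivedFac (F : C ⥤ D) [F.Additive] [PreservesFiniteLimits F]
    [PreservesFiniteColimits F] :
    Qh ⋙ exactDerived F ≅ F.mapHomotopyCategoryPlus ⋙ Qh :=
  Localization.fac _ (exact_inverts F) Qh

instance (F : C ⥤ D) [F.Additive] [PreservesFiniteLimits F] [PreservesFiniteColimits F]
    {M : Type*} [Category* M] (G : DerivedCategory.Plus D ⥤ M) :
    Localization.Lifting Qh (HomotopyCategory.Plus.quasiIso C)
      (F.mapHomotopyCategoryPlus ⋙ Qh ⋙ G) (exactDerived F ⋙ G) :=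
  ⟨Functor.isoWhiskerRight (exactDerivedFac F) G⟩

end Exact

section Desc

variable [HasDerivedCategory C] [EnoughInjectives C] (Γ : C ⥤ E) [Γ.Additive]
  {H : HomotopyCategory.Plus C ⥤ DerivedCategory.Plus E}

/-- The universal property of `RΓ`, on the level of complexes: a natural morphism
`Γ(K) ⟶ H(K)`, where `H` inverts quasi-isomorphisms, extends uniquely to `RΓ(K) ⟶ H(K)`. -/
def derivedDesc (hH : (HomotopyCategory.Plus.quasiIso C).IsInvertedBy H)
    (β : Γ.mapHomotopyCategoryPlus ⋙ Qh ⟶ H) :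
    Qh ⋙ Γ.rightDerivedFunctorPlus ⟶ H :=
  Functor.whiskerLeft Qh (Γ.rightDerivedFunctorPlus.rightDerivedDesc Γ.rightDerivedFunctorPlusUnit
    (HomotopyCategory.Plus.quasiIso C) (Localization.lift H hH Qh)
      (β ≫ (Localization.fac H hH Qh).inv)) ≫ (Localization.fac H hH Qh).hom

lemma derivedDesc_fac (hH : (HomotopyCategory.Plus.quasiIso C).IsInvertedBy H)
    (β : Γ.mapHomotopyCategoryPlus ⋙ Qh ⟶ H) :
    Γ.rightDerivedFunctorPlusUnit ≫ derivedDesc Γ hH β = β := by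
  simp [derivedDesc]

lemma derived_hom_ext (hH : (HomotopyCategory.Plus.quasiIso C).IsInvertedBy H)
    (γ γ' : Qh ⋙ Γ.rightDerivedFunctorPlus ⟶ H)
    (h : Γ.rightDerivedFunctorPlusUnit ≫ γ = Γ.rightDerivedFunctorPlusUnit ≫ γ') : γ = γ' := by
  let e := Localization.fac H hH Qh
  obtain ⟨δ, hδ⟩ := ((Localization.whiskeringLeftFunctor' Qh
    (HomotopyCategory.Plus.quasiIso C) _).map_surjective (γ ≫ e.inv))
  obtain ⟨δ', hδ'⟩ := ((Localization.whiskeringLeftFunctor' Qh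
    (HomotopyCategory.Plus.quasiIso C) _).map_surjective (γ' ≫ e.inv))
  have : δ = δ' := by
    refine Functor.rightDerived_ext _ Γ.rightDerivedFunctorPlusUnit
      (HomotopyCategory.Plus.quasiIso C) _ _ _ ?_
    refine (congrArg (Γ.rightDerivedFunctorPlusUnit ≫ ·) hδ).trans
      (Eq.trans ?_ (congrArg (Γ.rightDerivedFunctorPlusUnit ≫ ·) hδ').symm)
    exact (reassoc_of% h) e.inv
  rw [← cancel_mono e.inv]
  exact hδ.symm.trans ((by rw [this]) : _ = _) |>.trans hδ'

end Desc

section Operator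

variable [EnoughInjectives D] (Γ : D ⥤ E) [Γ.Additive]
  (T : C ⥤ D) [T.Additive]

/-- For an exact functor `A` with a natural map `u : Γ(P) ⟶ Γ(A(P))`, the induced map
`RΓ(P) ⟶ RΓ(A(P))` for bounded below complexes `P`. -/
def derivedPull (A : D ⥤ D) [A.Additive] [PreservesFiniteLimits A] [PreservesFiniteColimits A]
    (u : Γ ⟶ A ⋙ Γ) :
    Qh ⋙ Γ.rightDerivedFunctorPlus ⟶
      A.mapHomotopyCategoryPlus ⋙ Qh ⋙ Γ.rightDerivedFunctorPlus :=
  derivedDesc Γ (H := A.mapHomotopyCategoryPlus ⋙ Qh ⋙ Γ.rightDerivedFunctorPlus)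
    (fun _ _ f hf ↦ by
      have := exact_inverts A f hf
      exact inferInstanceAs (IsIso (Γ.rightDerivedFunctorPlus.map
        ((A.mapHomotopyCategoryPlus ⋙ Qh).map f))))
    (Functor.whiskerRight (mapPlusTo u) Qh ≫
      Functor.whiskerLeft A.mapHomotopyCategoryPlus Γ.rightDerivedFunctorPlusUnit)

/-- For `b : A(T(F)) ⟶ T(F)`, the composite `RΓ(T(K)) ⟶ RΓ(A(T(K))) ⟶ RΓ(T(K))`. -/
def derivedOp (A : D ⥤ D) [A.Additive] [PreservesFiniteLimits A] [PreservesFiniteColimits A]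
    (u : Γ ⟶ A ⋙ Γ) (b : T ⋙ A ⟶ T) :
    End (T.mapHomotopyCategoryPlus ⋙ Qh ⋙ Γ.rightDerivedFunctorPlus) :=
  Functor.whiskerLeft T.mapHomotopyCategoryPlus (derivedPull Γ A u) ≫
    Functor.whiskerRight (mapPlusFrom b) (Qh ⋙ Γ.rightDerivedFunctorPlus)

/-- The composite `Γ(T(F)) ⟶ Γ(A(T(F))) ⟶ Γ(T(F))`. -/
def sectionsOp {C D E : Type*} [Category* C] [Category* D] [Category* E]
    (Γ : D ⥤ E) (T : C ⥤ D) (A : D ⥤ D) (u : Γ ⟶ A ⋙ Γ) (b : T ⋙ A ⟶ T) : End (T ⋙ Γ) :=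
  Functor.whiskerLeft T u ≫ Functor.whiskerRight b Γ

section

variable {C D E : Type*} [Category* C] [Category* D] [Category* E] (Γ : D ⥤ E) (T : C ⥤ D)
  {A A' A'' : D ⥤ D} {u : Γ ⟶ A ⋙ Γ} {u' : Γ ⟶ A' ⋙ Γ} {u'' : Γ ⟶ A'' ⋙ Γ}
  {b : T ⋙ A ⟶ T} {b' : T ⋙ A' ⟶ T} {b'' : T ⋙ A'' ⟶ T}

lemma sectionsOp_comp (θ : A ⋙ A' ⟶ A'')
    (hu : ∀ P, u.app P ≫ u'.app (A.obj P) ≫ Γ.map (θ.app P) = u''.app P)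
    (hb : ∀ F, A'.map (b.app F) ≫ b'.app F = θ.app (T.obj F) ≫ b''.app F) :
    sectionsOp Γ T A u b ≫ sectionsOp Γ T A' u' b' = sectionsOp Γ T A'' u'' b'' := by
  refine NatTrans.ext (funext fun F ↦ ?_)
  have h2 := u'.naturality (b.app F)
  simp only [sectionsOp, NatTrans.comp_app, Functor.whiskerLeft_app, Functor.whiskerRight_app,
    Category.assoc, Functor.comp_map] at h2 ⊢
  rw [← hu, reassoc_of% h2]
  simp only [Category.assoc, ← Functor.map_comp, hb]

lemma sectionsOp_id (θ : A ⟶ 𝟭 D)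
    (hu : ∀ P, u.app P ≫ Γ.map (θ.app P) = 𝟙 _)
    (hb : ∀ F, b.app F = θ.app (T.obj F)) :
    sectionsOp Γ T A u b = 𝟙 _ := by
  refine NatTrans.ext (funext fun F ↦ ?_)
  simp only [sectionsOp, NatTrans.comp_app, Functor.whiskerLeft_app, Functor.whiskerRight_app, hb]
  exact hu _

end

section

variable {A A' A'' : D ⥤ D}
  [A.Additive] [PreservesFiniteLimits A] [PreservesFiniteColimits A]
  [A'.Additive] [PreservesFiniteLimits A'] [PreservesFiniteColimits A']
  [A''.Additive] [PreservesFiniteLimits A''] [PreservesFiniteColimits A'']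
  {u : Γ ⟶ A ⋙ Γ} {u' : Γ ⟶ A' ⋙ Γ} {u'' : Γ ⟶ A'' ⋙ Γ}
  {b : T ⋙ A ⟶ T} {b' : T ⋙ A' ⟶ T} {b'' : T ⋙ A'' ⟶ T}


lemma derivedPull_fac_app (P : HomotopyCategory.Plus D) :
    Γ.rightDerivedFunctorPlusUnit.app P ≫ (derivedPull Γ A u).app P =
      Qh.map ((mapPlusTo u).app P) ≫
        Γ.rightDerivedFunctorPlusUnit.app (A.mapHomotopyCategoryPlus.obj P) := by
  have := NatTrans.congr_app (derivedDesc_fac Γ (H := A.mapHomotopyCategoryPlus ⋙ Qh ⋙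
    Γ.rightDerivedFunctorPlus) (fun _ _ f hf ↦ by
      have := exact_inverts A f hf
      exact inferInstanceAs (IsIso (Γ.rightDerivedFunctorPlus.map
        ((A.mapHomotopyCategoryPlus ⋙ Qh).map f))))
    (Functor.whiskerRight (mapPlusTo u) Qh ≫
      Functor.whiskerLeft A.mapHomotopyCategoryPlus Γ.rightDerivedFunctorPlusUnit)) P
  refine this.trans ?_
  simp

/-- Composition law for `derivedPull`. -/
lemma derivedPull_comp (θ : A ⋙ A' ⟶ A'')
    (hu : ∀ P, u.app P ≫ u'.app (A.obj P) ≫ Γ.map (θ.app P) = u''.app P)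
    (P : HomotopyCategory.Plus D) :
    (derivedPull Γ A u).app P ≫ (derivedPull Γ A' u').app (A.mapHomotopyCategoryPlus.obj P) ≫
      Γ.rightDerivedFunctorPlus.map (Qh.map ((mapPlusFrom θ).app P)) = (derivedPull Γ A'' u'').app P := by
  let γ : Qh ⋙ Γ.rightDerivedFunctorPlus ⟶
      A''.mapHomotopyCategoryPlus ⋙ Qh ⋙ Γ.rightDerivedFunctorPlus :=
    derivedPull Γ A u ≫ Functor.whiskerLeft A.mapHomotopyCategoryPlus (derivedPull Γ A' u') ≫
      Functor.whiskerRight (mapPlusFrom θ) (Qh ⋙ Γ.rightDerivedFunctorPlus)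
  have : γ = derivedPull Γ A'' u'' := by
    refine derived_hom_ext Γ (fun _ _ f hf ↦ by
      have := exact_inverts A'' f hf
      exact inferInstanceAs (IsIso (Γ.rightDerivedFunctorPlus.map
        ((A''.mapHomotopyCategoryPlus ⋙ Qh).map f)))) _ _ ?_
    ext1
    ext1 P
    refine Eq.trans ?_ (derivedPull_fac_app Γ P).symm
    have h1 := derivedPull_fac_app Γ (u := u) P
    have h2 := derivedPull_fac_app Γ (u := u') (A.mapHomotopyCategoryPlus.obj P)
    have h3 := Γ.rightDerivedFunctorPlusUnit.naturality ((mapPlusFrom θ).app P)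
    have h4 : (mapPlusTo u).app P ≫ (mapPlusTo u').app (A.mapHomotopyCategoryPlus.obj P) ≫
        Γ.mapHomotopyCategoryPlus.map ((mapPlusFrom θ).app P) = (mapPlusTo u'').app P := by
      obtain ⟨P, rfl⟩ := HomotopyCategory.Plus.quotient_obj_surjective P
      ext
      have e : (NatTrans.mapHomologicalComplex u (ComplexShape.up ℤ)).app P.obj ≫
          (NatTrans.mapHomologicalComplex u' (ComplexShape.up ℤ)).app
            ((A.mapHomologicalComplex _).obj P.obj) ≫ (Γ.mapHomologicalComplex _).map
            ((NatTrans.mapHomologicalComplex θ (ComplexShape.up ℤ)).app P.obj) =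
          (NatTrans.mapHomologicalComplex u'' (ComplexShape.up ℤ)).app P.obj := by
        ext n
        exact hu _
      have e' := congrArg (HomotopyCategory.quotient _ (ComplexShape.up ℤ)).map e
      exact e'
    calc Γ.rightDerivedFunctorPlusUnit.app P ≫ γ.app P
        = (Γ.rightDerivedFunctorPlusUnit.app P ≫ (derivedPull Γ A u).app P) ≫
          (derivedPull Γ A' u').app (A.mapHomotopyCategoryPlus.obj P) ≫
          Γ.rightDerivedFunctorPlus.map (Qh.map ((mapPlusFrom θ).app P)) := by
          simp [γ]
      _ = Qh.map ((mapPlusTo u).app P) ≫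
        (Γ.rightDerivedFunctorPlusUnit.app (A.mapHomotopyCategoryPlus.obj P)  ≫
          (derivedPull Γ A' u').app (A.mapHomotopyCategoryPlus.obj P)) ≫
          Γ.rightDerivedFunctorPlus.map (Qh.map ((mapPlusFrom θ).app P)) := by
          rw [h1]; simp only [Category.assoc]
      _ = Qh.map ((mapPlusTo u).app P) ≫ Qh.map ((mapPlusTo u').app (A.mapHomotopyCategoryPlus.obj P)) ≫
          (Γ.rightDerivedFunctorPlusUnit.app _  ≫
          Γ.rightDerivedFunctorPlus.map (Qh.map ((mapPlusFrom θ).app P))) := by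
          rw [h2]; simp only [Category.assoc]
      _ = Qh.map ((mapPlusTo u).app P) ≫ Qh.map ((mapPlusTo u').app (A.mapHomotopyCategoryPlus.obj P)) ≫
           Qh.map (Γ.mapHomotopyCategoryPlus.map ((mapPlusFrom θ).app P)) ≫
             Γ.rightDerivedFunctorPlusUnit.app _ := by
          congr 2; exact h3.symm
      _ = _ := by
        rw [← h4]; simp only [Functor.map_comp, Category.assoc]
  have h := NatTrans.congr_app this P
  refine Eq.trans ?_ h
  simp [γ]

lemma derivedOp_comp (θ : A ⋙ A' ⟶ A'')
    (hu : ∀ P, u.app P ≫ u'.app (A.obj P) ≫ Γ.map (θ.app P) = u''.app P)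
    (hb : ∀ F, A'.map (b.app F) ≫ b'.app F = θ.app (T.obj F) ≫ b''.app F) :
    derivedOp Γ T A u b ≫ derivedOp Γ T A' u' b' = derivedOp Γ T A'' u'' b'' := by
  ext1
  ext1 K
  have h1 := derivedPull_comp Γ θ hu (T.mapHomotopyCategoryPlus.obj K)
  have h2 := (derivedPull Γ A' u').naturality ((mapPlusFrom b).app K)
  have h3 : A'.mapHomotopyCategoryPlus.map ((mapPlusFrom b).app K) ≫ (mapPlusFrom b').app K =
      (mapPlusFrom θ).app (T.mapHomotopyCategoryPlus.obj K) ≫ (mapPlusFrom b'').app K := by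
    obtain ⟨K, rfl⟩ := HomotopyCategory.Plus.quotient_obj_surjective K
    ext
    have e : (A'.mapHomologicalComplex _).map
          ((NatTrans.mapHomologicalComplex b (ComplexShape.up ℤ)).app K.obj) ≫
        (NatTrans.mapHomologicalComplex b' (ComplexShape.up ℤ)).app K.obj =
        (NatTrans.mapHomologicalComplex θ (ComplexShape.up ℤ)).app
          ((T.mapHomologicalComplex _).obj K.obj) ≫
        (NatTrans.mapHomologicalComplex b'' (ComplexShape.up ℤ)).app K.obj := by
      ext n
      exact hb _
    exact congrArg (HomotopyCategory.quotient _ (ComplexShape.up ℤ)).map e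
  simp only [derivedOp, NatTrans.comp_app, Functor.whiskerLeft_app, Functor.whiskerRight_app,
    Category.assoc, Functor.comp_map] at h2 ⊢
  rw [← h1, reassoc_of% h2]
  simp only [Category.assoc, ← Functor.map_comp, h3]

lemma derivedOp_id (θ : A ⟶ 𝟭 D)
    (hu : ∀ P, u.app P ≫ Γ.map (θ.app P) = 𝟙 _)
    (hb : ∀ F, b.app F = θ.app (T.obj F)) :
    derivedOp Γ T A u b = 𝟙 _ := by
  let γ : Qh ⋙ Γ.rightDerivedFunctorPlus ⟶ Qh ⋙ Γ.rightDerivedFunctorPlus :=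
    derivedPull Γ A u ≫ Functor.whiskerRight (mapPlusId θ) (Qh ⋙ Γ.rightDerivedFunctorPlus)
  have hγ : γ = 𝟙 _ := by
    refine derived_hom_ext Γ (fun _ _ f hf ↦ by
      have := Localization.inverts Qh (HomotopyCategory.Plus.quasiIso D) f hf
      exact inferInstanceAs (IsIso (Γ.rightDerivedFunctorPlus.map (Qh.map f)))) _ _ ?_
    ext1
    ext1 P
    have h1 := derivedPull_fac_app Γ (u := u) P
    have h3 := Γ.rightDerivedFunctorPlusUnit.naturality ((mapPlusId θ).app P)
    have h4 : (mapPlusTo u).app P ≫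
        Γ.mapHomotopyCategoryPlus.map ((mapPlusId θ).app P) = 𝟙 _ := by
      obtain ⟨P, rfl⟩ := HomotopyCategory.Plus.quotient_obj_surjective P
      ext
      have e : (NatTrans.mapHomologicalComplex u (ComplexShape.up ℤ)).app P.obj ≫
          (Γ.mapHomologicalComplex _).map
            ((NatTrans.mapHomologicalComplex θ (ComplexShape.up ℤ)).app P.obj) = 𝟙 _ := by
        ext n
        exact hu _
      exact congrArg (HomotopyCategory.quotient _ (ComplexShape.up ℤ)).map e
    simp only [Functor.comp_map, Functor.id_obj] at h3
    simp only [γ, NatTrans.comp_app, Functor.whiskerRight_app, reassoc_of% h1,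
      Functor.comp_map, Category.comp_id]
    refine (congrArg (Qh.map ((mapPlusTo u).app P) ≫ ·) h3.symm).trans ?_
    refine (Category.assoc _ _ _).symm.trans ?_
    refine (congrArg (· ≫ _) ((Qh.map_comp _ _).symm.trans (congrArg Qh.map h4))).trans ?_
    refine (congrArg (· ≫ _) (Qh.map_id _)).trans (Category.id_comp _)
  refine NatTrans.ext (funext fun K ↦ ?_)
  have h := NatTrans.congr_app hγ (T.mapHomotopyCategoryPlus.obj K)
  have h3 : (mapPlusFrom b).app K = (mapPlusId θ).app (T.mapHomotopyCategoryPlus.obj K) := by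
    obtain ⟨K, rfl⟩ := HomotopyCategory.Plus.quotient_obj_surjective K
    ext
    have e : (NatTrans.mapHomologicalComplex b (ComplexShape.up ℤ)).app K.obj =
        (NatTrans.mapHomologicalComplex θ (ComplexShape.up ℤ)).app
          ((T.mapHomologicalComplex _).obj K.obj) := by
      ext n
      exact hb _
    exact congrArg (HomotopyCategory.quotient _ (ComplexShape.up ℤ)).map e
  simp only [derivedOp, NatTrans.comp_app, Functor.whiskerLeft_app, Functor.whiskerRight_app, h3]
  exact h

end

end Operator
end Derived

section Sheaves

/-- The category of sheaves of `k`-modules on `X`. -/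
abbrev Shv (k : Type u) [Ring k] (X : TopCat.{u}) := TopCat.Sheaf (ModuleCat.{u} k) X

variable (k : Type u) [Ring k] {X Y Z W : TopCat.{u}}

/-- The inverse image `f⁻¹ : Shv_k(Y) ⥤ Shv_k(X)`. -/
abbrev inverseImage (f : X ⟶ Y) : Shv k Y ⥤ Shv k X :=
  TopCat.Sheaf.pullback (ModuleCat.{u} k) f

/-- The adjunction `f⁻¹ ⊣ f_*`. -/
abbrev inverseImageAdj (f : X ⟶ Y) :
    inverseImage k f ⊣ TopCat.Sheaf.pushforward (ModuleCat.{u} k) f :=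
  TopCat.Sheaf.pullbackPushforwardAdjunction (ModuleCat.{u} k) f

instance (f : X ⟶ Y) : PreservesFiniteLimits (inverseImage k f) := by
  have : ReflectsLimits (forget (ModuleCat.{u} k)) := reflectsLimits_of_reflectsIsomorphisms
  have : PreservesFiniteLimits ((Opens.map f).op.lan : (_ ⥤ _ ⥤ ModuleCat.{u} k)) :=
    lan_preservesFiniteLimits_of_flat _ _
  exact Functor.sheafPullbackConstruction.preservesFiniteLimits (Opens.map f) (ModuleCat.{u} k)
    (Opens.grothendieckTopology Y) (Opens.grothendieckTopology X)

instance (f : X ⟶ Y) : PreservesFiniteColimits (inverseImage k f) := inferInstance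

instance (f : X ⟶ Y) : (inverseImage k f).Additive :=
  Functor.additive_of_preserves_binary_products _

/-- Global sections `Γ(X, -)`. -/
def globalSections (X : TopCat.{u}) : Shv k X ⥤ ModuleCat.{u} k :=
  (sheafSections (Opens.grothendieckTopology X) (ModuleCat.{u} k)).obj (op ⊤)

instance (X : TopCat.{u}) : (globalSections k X).Additive where
  map_add := rfl

/-- Pullback of sections `Γ(Y, F) ⟶ Γ(X, f⁻¹F)`, given by the unit `F ⟶ f_* f⁻¹ F`. -/
def sectionsPull (f : X ⟶ Y) : globalSections k Y ⟶ inverseImage k f ⋙ globalSections k X :=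
  Functor.whiskerRight (inverseImageAdj k f).unit (globalSections k Y)

/-- The canonical isomorphism `f⁻¹ g⁻¹ ≅ h⁻¹` when `h = g ∘ f`. -/
def inverseImageComp {f : X ⟶ Y} {g : Y ⟶ Z} {h : X ⟶ Z} (w : f ≫ g = h) :
    inverseImage k g ⋙ inverseImage k f ≅ inverseImage k h :=
  ((inverseImageAdj k g).comp (inverseImageAdj k f)).leftAdjointUniq
    (w ▸ inverseImageAdj k h)

/-- The canonical isomorphism `id⁻¹ ≅ id`. -/
def inverseImageId (X : TopCat.{u}) : inverseImage k (𝟙 X) ≅ 𝟭 (Shv k X) :=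
  (inverseImageAdj k (𝟙 X)).leftAdjointUniq Adjunction.id

lemma sectionsPull_comp {f : X ⟶ Y} {g : Y ⟶ Z} {h : X ⟶ Z} (w : f ≫ g = h) (P : Shv k Z) :
    (sectionsPull k g).app P ≫ (sectionsPull k f).app ((inverseImage k g).obj P) ≫
      (globalSections k X).map ((inverseImageComp k w).hom.app P) = (sectionsPull k h).app P := by
  subst w
  have h := Adjunction.unit_leftAdjointUniq_hom_app
    ((inverseImageAdj k g).comp (inverseImageAdj k f)) (inverseImageAdj k (f ≫ g)) P
  have h' := congrArg (globalSections k Z).map h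
  rw [Adjunction.comp_unit_app, Category.assoc, Functor.map_comp, Functor.map_comp] at h'
  exact h'

lemma sectionsPull_id (P : Shv k X) :
    (sectionsPull k (𝟙 X)).app P ≫
      (globalSections k X).map ((inverseImageId k X).hom.app P) = 𝟙 _ := by
  have h := Adjunction.unit_leftAdjointUniq_hom_app (inverseImageAdj k (𝟙 X)) Adjunction.id P
  have h' := congrArg (globalSections k X).map h
  rw [Functor.map_comp] at h'
  exact h'

lemma leftAdjointUniq_assoc {𝓧 𝓨 𝓩 𝓦 : Type*} [Category* 𝓧] [Category* 𝓨] [Category* 𝓩]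
    [Category* 𝓦] {Lf : 𝓨 ⥤ 𝓧} {Rf : 𝓧 ⥤ 𝓨} {Lg : 𝓩 ⥤ 𝓨} {Rg : 𝓨 ⥤ 𝓩} {Lh : 𝓦 ⥤ 𝓩} {Rh : 𝓩 ⥤ 𝓦}
    (af : Lf ⊣ Rf) (ag : Lg ⊣ Rg) (ah : Lh ⊣ Rh) {Lp : 𝓩 ⥤ 𝓧} {Lq : 𝓦 ⥤ 𝓨} {Lr : 𝓦 ⥤ 𝓧}
    (ap : Lp ⊣ Rf ⋙ Rg) (aq : Lq ⊣ Rg ⋙ Rh) (ar : Lr ⊣ Rf ⋙ Rg ⋙ Rh) (F : 𝓦) :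
    Lf.map (((ah.comp ag).leftAdjointUniq aq).hom.app F) ≫
      ((aq.comp af).leftAdjointUniq ar).hom.app F =
    ((ag.comp af).leftAdjointUniq ap).hom.app (Lh.obj F) ≫
      ((ah.comp ap).leftAdjointUniq ar).hom.app F := by
  have h1 := Adjunction.unit_leftAdjointUniq_hom_app (ag.comp af) ap (Lh.obj F)
  have h2 := Adjunction.unit_leftAdjointUniq_hom_app (ah.comp ag) aq F
  have h3 := Adjunction.unit_leftAdjointUniq_hom_app (ah.comp ap) ar F
  have h4 := Adjunction.unit_leftAdjointUniq_hom_app (aq.comp af) ar F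
  apply (((ah.comp ag).comp af).homEquiv _ _).injective
  rw [Adjunction.homEquiv_unit, Adjunction.homEquiv_unit]
  simp only [Adjunction.comp_unit_app, Functor.comp_obj, Functor.comp_map, Category.assoc,
    Functor.map_comp] at h1 h2 h3 h4 ⊢
  have n := af.unit.naturality (((ah.comp ag).leftAdjointUniq aq).hom.app F)
  have h1' := congrArg Rh.map h1
  have n' := congrArg (fun x ↦ Rh.map (Rg.map x)) n
  simp only [Functor.map_comp, Functor.id_map, Functor.comp_map, Functor.id_obj,
    Functor.comp_obj] at h1' n'
  rw [← reassoc_of% n', reassoc_of% h2, h4, reassoc_of% h1', h3]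

lemma inverseImageComp_assoc {f : X ⟶ Y} {g : Y ⟶ Z} {h : Z ⟶ W} {p : X ⟶ Z} {q : Y ⟶ W}
    {r : X ⟶ W} (w₁ : f ≫ g = p) (w₂ : g ≫ h = q) (w₃ : p ≫ h = r) (w₄ : f ≫ q = r)
    (F : Shv k W) :
    (inverseImage k f).map ((inverseImageComp k w₂).hom.app F) ≫
      (inverseImageComp k w₄).hom.app F =
    (inverseImageComp k w₁).hom.app ((inverseImage k h).obj F) ≫
      (inverseImageComp k w₃).hom.app F := by
  subst w₁ w₂ w₃
  exact leftAdjointUniq_assoc (inverseImageAdj k f) (inverseImageAdj k g) (inverseImageAdj k h)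
    (inverseImageAdj k (f ≫ g)) (inverseImageAdj k (g ≫ h)) (inverseImageAdj k (f ≫ g ≫ h)) F

lemma inverseImageComp_id (f : X ⟶ Y) (F : Shv k Y) :
    (inverseImageComp k (Category.id_comp f)).hom.app F =
      (inverseImageId k X).hom.app ((inverseImage k f).obj F) := by
  have h1 := Adjunction.unit_leftAdjointUniq_hom_app (inverseImageAdj k (𝟙 X)) Adjunction.id
    ((inverseImage k f).obj F)
  have h2 := Adjunction.unit_leftAdjointUniq_hom_app
    ((inverseImageAdj k f).comp (inverseImageAdj k (𝟙 X))) (inverseImageAdj k (𝟙 X ≫ f)) F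
  apply (((inverseImageAdj k f).comp (inverseImageAdj k (𝟙 X))).homEquiv _ _).injective
  rw [Adjunction.homEquiv_unit, Adjunction.homEquiv_unit]
  refine h2.trans ?_
  have h1' := congrArg (TopCat.Sheaf.pushforward (ModuleCat.{u} k) f).map h1
  rw [Functor.map_comp] at h1'
  rw [Adjunction.comp_unit_app, Category.assoc]
  exact ((congrArg ((inverseImageAdj k f).unit.app F ≫ ·) h1').trans
    ((congrArg _ (CategoryTheory.Functor.map_id _ _)).trans (Category.comp_id _))).symm

end Sheaves

section Deck

variable (k : Type u) [Ring k] {X X' : TopCat.{u}} (φ : X' ⟶ X)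

/-- `Aut_X(X')`, the group of homeomorphisms of `X'` commuting with `φ : X' ⟶ X`. -/
def deckGroup : Subgroup (X' ≃ₜ X') where
  carrier := {g | ∀ x, φ (g x) = φ x}
  one_mem' _ := rfl
  mul_mem' {g h} hg hh x := (hg (h x)).trans (hh x)
  inv_mem' {g} hg x := by
    have := hg (g⁻¹ x)
    rw [← this]
    exact congrArg φ (g.apply_symm_apply x)

variable {φ} in
/-- The continuous map underlying a deck transformation. -/
abbrev deckMap (g : deckGroup φ) : X' ⟶ X' := TopCat.ofHom ⟨g.1, g.1.continuous⟩

variable {φ} in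
lemma deckMap_comp (g : deckGroup φ) : deckMap g ≫ φ = φ := by
  ext x
  exact g.2 x

variable {φ} in
/-- The canonical isomorphism `g⁻¹ φ⁻¹ ≅ φ⁻¹` for a deck transformation `g`. -/
abbrev deckIso (g : deckGroup φ) : inverseImage k φ ⋙ inverseImage k (deckMap g) ≅ inverseImage k φ :=
  inverseImageComp k (deckMap_comp g)

lemma inverseImageComp_deck (g h : deckGroup φ) (F : Shv k X) :
    (inverseImage k (deckMap h)).map ((deckIso k g).hom.app F) ≫ (deckIso k h).hom.app F =
      (inverseImageComp k (rfl : deckMap h ≫ deckMap g = deckMap (g * h))).hom.app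
        ((inverseImage k φ).obj F) ≫ (deckIso k (g * h)).hom.app F :=
  inverseImageComp_assoc k _ _ _ _ F

/-- The pullback of sections `s ↦ g^* s = s ∘ g` on `Γ(X', φ⁻¹F)` for a deck transformation `g`:
the composite `Γ(X', φ⁻¹F) ⟶ Γ(X', g⁻¹φ⁻¹F) ≅ Γ(X', φ⁻¹F)`. -/
def deckSections (g : deckGroup φ) : End (inverseImage k φ ⋙ globalSections k X') :=
  sectionsOp (globalSections k X') (inverseImage k φ) (inverseImage k (deckMap g))
    (sectionsPull k (deckMap g)) (deckIso k g).hom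

/-- The left action of `Aut_X(X')` on `Γ(X', φ⁻¹F)`, natural in `F`; `g` acts by `s ↦ s ∘ g⁻¹`. -/
def deckSectionsHom : deckGroup φ →* End (inverseImage k φ ⋙ globalSections k X') where
  toFun g := deckSections k φ g⁻¹
  map_one' := by
    rw [inv_one]
    exact sectionsOp_id _ _ (inverseImageId k X').hom (sectionsPull_id k)
      (inverseImageComp_id k φ)
  map_mul' g h := by
    rw [mul_inv_rev]
    exact (sectionsOp_comp _ _ (inverseImageComp k rfl).hom (sectionsPull_comp k rfl)
      (inverseImageComp_deck k φ h⁻¹ g⁻¹)).symm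

open DerivedCategory.Plus

/-- Hypercohomology: the functor `RΓ(X, -)` on the bounded below derived category. -/
abbrev derivedSections (X : TopCat.{u}) [HasDerivedCategory (Shv k X)]
    [HasDerivedCategory (ModuleCat.{u} k)] :
    DerivedCategory.Plus (Shv k X) ⥤ DerivedCategory.Plus (ModuleCat.{u} k) :=
  (globalSections k X).rightDerivedFunctorPlus

variable [HasDerivedCategory (Shv k X')] [HasDerivedCategory (ModuleCat.{u} k)]

/-- The pullback `g^*` on `RΓ(X', φ⁻¹K)` for a deck transformation `g` and a bounded below complex
`K` of sheaves on `X`: the composite `RΓ(X', φ⁻¹K) ⟶ RΓ(X', g⁻¹φ⁻¹K) ≅ RΓ(X', φ⁻¹K)`, where the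
first map is induced by the pullback of sections. -/
def deckDerived (g : deckGroup φ) :
    End ((inverseImage k φ).mapHomotopyCategoryPlus ⋙ Qh ⋙ derivedSections k X') :=
  derivedOp (globalSections k X') (inverseImage k φ) (inverseImage k (deckMap g))
    (sectionsPull k (deckMap g)) (deckIso k g).hom

/-- The left action of `Aut_X(X')` on `RΓ(X', φ⁻¹K)`; `g` acts by pullback along `g⁻¹`. -/
def deckDerivedHom :
    deckGroup φ →* End ((inverseImage k φ).mapHomotopyCategoryPlus ⋙ Qh ⋙ derivedSections k X') where
  toFun g := deckDerived k φ g⁻¹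
  map_one' := by
    rw [inv_one]
    exact derivedOp_id _ _ (inverseImageId k X').hom (sectionsPull_id k)
      (inverseImageComp_id k φ)
  map_mul' g h := by
    rw [mul_inv_rev]
    exact (derivedOp_comp _ _ (inverseImageComp k rfl).hom (sectionsPull_comp k rfl)
      (inverseImageComp_deck k φ h⁻¹ g⁻¹)).symm

variable [HasDerivedCategory (Shv k X)]

/-- The cohomology functor `K ↦ Hⁱ(X', φ⁻¹K)`, `D⁺(X) ⥤ Mod(k)`. -/
abbrev pullbackCohomology (i : ℤ) : DerivedCategory.Plus (Shv k X) ⥤ ModuleCat.{u} k :=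
  (exactDerived (inverseImage k φ) ⋙ derivedSections k X') ⋙ homologyFunctor (ModuleCat.{u} k) i

/-- The left action of `Aut_X(X')` on `Hⁱ(X', φ⁻¹K)` for `K` in `D⁺(X)`. -/
def deckCohomologyHom (i : ℤ) : deckGroup φ →* End (pullbackCohomology k φ i) where
  toFun g := Functor.whiskerRight (Localization.liftNatTrans Qh
    (HomotopyCategory.Plus.quasiIso (Shv k X)) _ _ _ _ (deckDerivedHom k φ g))
      (homologyFunctor (ModuleCat.{u} k) i)
  map_one' := by
    rw [map_one]
    exact (congrArg (Functor.whiskerRight · _)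
      (Localization.liftNatTrans_id Qh _ _ _)).trans (Functor.whiskerRight_id' _)
  map_mul' g h := by
    rw [map_mul]
    exact (congrArg (Functor.whiskerRight · _)
      (Localization.comp_liftNatTrans Qh (HomotopyCategory.Plus.quasiIso (Shv k X))
        _ _ _ _ _ _ (deckDerivedHom k φ h) (deckDerivedHom k φ g)).symm).trans
      (Functor.whiskerRight_comp _ _ _)

/-- A functor to `k`-modules with an action of `G` by natural endomorphisms, as a functor to
`k`-linear representations of `G`. -/
def toRep {C : Type*} [Category* C] {G : Type u} [Group G] (Φ : C ⥤ ModuleCat.{u} k)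
    (ρ : G →* End Φ) : C ⥤ Rep.{u} k G where
  obj F := Rep.of (
    { toFun g := ((ρ g).app F).hom
      map_one' := by rw [map_one]; rfl
      map_mul' g h := by rw [map_mul]; rfl } : Representation k G (Φ.obj F))
  map {F F'} f := Rep.ofHom
    { toLinearMap := (Φ.map f).hom
      isIntertwining' g := by
        ext x
        exact (ConcreteCategory.congr_hom ((ρ g).naturality f) x).symm }
  map_id F := by
    ext x
    exact ConcreteCategory.congr_hom (Φ.map_id F) x
  map_comp f f' := by
    ext x
    exact ConcreteCategory.congr_hom (Φ.map_comp f f') x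

end Deck

section Constant

variable (k : Type u) [Ring k]

/-- The constant sheaf functor `M ↦ M_X`. -/
abbrev constSheaf (X : TopCat.{u}) : ModuleCat.{u} k ⥤ Shv k X :=
  constantSheaf (Opens.grothendieckTopology X) (ModuleCat.{u} k)

variable {X Y : TopCat.{u}}

/-- The adjunction `(-)_X ⊣ Γ(X, -)`. -/
def constSheafAdj (X : TopCat.{u}) : constSheaf k X ⊣ globalSections k X :=
  constantSheafAdj _ _ (isTerminalTop (α := Opens X))

instance (X : TopCat.{u}) : (constSheaf k X).IsLeftAdjoint := (constSheafAdj k X).isLeftAdjoint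

set_option synthInstance.maxHeartbeats 200000 in
instance (X : TopCat.{u}) : PreservesFiniteLimits (constSheaf k X) := by
  have : PreservesFiniteLimits (presheafToSheaf (Opens.grothendieckTopology X) (ModuleCat.{u} k)) :=
    inferInstance
  have h2 : PreservesFiniteLimits (Functor.const (Opens X)ᵒᵖ : ModuleCat.{u} k ⥤ _) :=
    ⟨fun _ _ _ => inferInstance⟩
  exact @comp_preservesFiniteLimits _ _ _ _ _ _ _ _ h2 this

variable {k} in
/-- The map from a module to the sections of its constant sheaf. -/
abbrev constEta (M : ModuleCat.{u} k) (X : TopCat.{u}) :=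
  toSheafify (Opens.grothendieckTopology X) ((Functor.const (Opens X)ᵒᵖ).obj M)

variable {k} in
lemma constEta_inj (M : ModuleCat.{u} k) {V : Opens X} {x : X} (hx : x ∈ V) (s t : M)
    (h : (constEta M X).app (op V) s = (constEta M X).app (op V) t) : s = t := by
  obtain ⟨W, f, hf, hxW⟩ := Presheaf.equalizerSieve_mem (Opens.grothendieckTopology X)
    (constEta M X) (X := op V) s t h x hx
  exact hf

variable {k} in
lemma constEta_map (M : ModuleCat.{u} k) {V W : Opens X} (f : V ⟶ W) (s : M) :
    (sheafify (Opens.grothendieckTopology X) ((Functor.const (Opens X)ᵒᵖ).obj M)).map f.op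
      ((constEta M X).app (op W) s) = (constEta M X).app (op V) s :=
  (ConcreteCategory.congr_hom ((constEta M X).naturality f.op) s).symm

lemma const_unit_bijective [ConnectedSpace X] (M : ModuleCat.{u} k) :
    Function.Bijective ((constSheafAdj k X).unit.app M) := by
  have hu : (constSheafAdj k X).unit.app M = (constEta M X).app (op ⊤) := by
    refine (Adjunction.comp_unit_app _ _ _).trans ?_
    refine Category.id_comp _
  rw [hu]
  refine ⟨fun s t h ↦ constEta_inj M (Opens.mem_top (Classical.arbitrary X)) s t h, fun (s : ToType
    ((sheafify (Opens.grothendieckTopology X) ((Functor.const (Opens X)ᵒᵖ).obj M)).obj (op ⊤))) ↦ ?_⟩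
  have hs := Presheaf.imageSieve_mem (Opens.grothendieckTopology X) (constEta M X) (U := op ⊤) s
  choose V f hf hxV using fun x : X ↦ hs x (Opens.mem_top x)
  choose c hc using hf
  let c' : X → M := c
  replace hc (x : X) : (constEta M X).app (op (V x)) (c' x) = _ := hc x
  have hloc : IsLocallyConstant c' := by
    rw [IsLocallyConstant.iff_exists_open]
    refine fun x ↦ ⟨V x, (V x).isOpen, hxV x, fun y hy ↦ ?_⟩
    refine Eq.symm <| constEta_inj M (V := V x ⊓ V y) (x := y) ⟨hy, hxV y⟩ _ _ ?_
    rw [← constEta_map M (Opens.infLELeft _ _), ← constEta_map M (Opens.infLERight _ _), hc, hc,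
      ← ConcreteCategory.comp_apply, ← ConcreteCategory.comp_apply, ← Functor.map_comp,
      ← Functor.map_comp]
    rfl
  refine ⟨c' (Classical.arbitrary X), ?_⟩
  refine TopCat.Sheaf.eq_of_locally_eq' ((constSheaf k X).obj M) V ⊤ f (fun x _ ↦ ?_) _ _ fun x ↦ ?_
  · simpa using ⟨x, hxV x⟩
  · refine (constEta_map M (f x) _).trans ?_
    rw [hloc.apply_eq_of_preconnectedSpace _ x]
    exact hc x

instance [ConnectedSpace X] : IsIso (constSheafAdj k X).unit := by
  have (M : ModuleCat.{u} k) : IsIso ((constSheafAdj k X).unit.app M) :=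
    (ConcreteCategory.isIso_iff_bijective _).mpr (const_unit_bijective k M)
  exact NatIso.isIso_of_isIso_app _

instance [ConnectedSpace X] : (constSheaf k X).Full := (constSheafAdj k X).fullyFaithfulLOfIsIsoUnit.full
instance [ConnectedSpace X] : (constSheaf k X).Faithful := (constSheafAdj k X).fullyFaithfulLOfIsIsoUnit.faithful

/-- The inverse image of a constant sheaf is constant. -/
def inverseImageConst (f : X ⟶ Y) : constSheaf k Y ⋙ inverseImage k f ≅ constSheaf k X :=
  ((constSheafAdj k Y).comp (inverseImageAdj k f)).leftAdjointUniq (constSheafAdj k X)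

end Constant

section Quasicoherent

variable (k : Type u) [Ring k] (X : TopCat.{u})

/-- The restriction `F ↦ F|_U` to an open subset. -/
abbrev restrict {X : TopCat.{u}} (U : Opens X) :
    Shv k X ⥤ Shv k ((Opens.toTopCat X).obj U) :=
  inverseImage k U.inclusion'

/-- A sheaf of `k`-modules `F` is quasi-coherent if every point has an open neighbourhood `U` with
an exact sequence `k_U^{⊕ I} ⟶ k_U^{⊕ J} ⟶ F|_U ⟶ 0`. -/
def isQuasicoherent : ObjectProperty (Shv k X) := fun F ↦
  ∀ x : X, ∃ U : Opens X, x ∈ U ∧ ∃ (I J : Type u)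
    (a : (∐ fun _ : I ↦ (constSheaf k ((Opens.toTopCat X).obj U)).obj (ModuleCat.of k k)) ⟶
      ∐ fun _ : J ↦ (constSheaf k ((Opens.toTopCat X).obj U)).obj (ModuleCat.of k k))
    (b : (∐ fun _ : J ↦ (constSheaf k ((Opens.toTopCat X).obj U)).obj (ModuleCat.of k k)) ⟶
      (restrict k U).obj F) (w : a ≫ b = 0), (ShortComplex.mk a b w).Exact ∧ Epi b

variable {X}

/-- The sheaves whose restriction to the open subset `W` is constant. -/
abbrev isConstOn (W : Opens X) : ObjectProperty (Shv k X) :=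
  (constSheaf k ((Opens.toTopCat X).obj W)).essImage.inverseImage (restrict k W)

instance (W : Opens X) (J : Type) [SmallCategory J] [FinCategory J]
    [ConnectedSpace ((Opens.toTopCat X).obj W)] :
    (isConstOn k W).IsClosedUnderLimitsOfShape J := inferInstance

instance (W : Opens X) (J : Type) [SmallCategory J] [FinCategory J]
    [ConnectedSpace ((Opens.toTopCat X).obj W)] :
    (isConstOn k W).IsClosedUnderColimitsOfShape J := inferInstance

lemma coprod_const_mem (X : TopCat.{u}) (I : Type u) (M : ModuleCat.{u} k) :
    (constSheaf k X).essImage (∐ fun _ : I ↦ (constSheaf k X).obj M) :=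
  ⟨∐ fun _ : I ↦ M, ⟨PreservesCoproduct.iso (constSheaf k X) _⟩⟩

lemma isConst_cokernel (X : TopCat.{u}) [ConnectedSpace X] {A B C : Shv k X} {a : A ⟶ B} {b : B ⟶ C}
    {w : a ≫ b = 0} (h : (ShortComplex.mk a b w).Exact) (hb : Epi b)
    (hA : (constSheaf k X).essImage A) (hB : (constSheaf k X).essImage B) :
    (constSheaf k X).essImage C := by
  have hc := h.gIsCokernel
  refine ObjectProperty.prop_of_isColimit (J := WalkingParallelPair) _ hc ?_
  rintro (_ | _)
  · exact hA
  · exact hB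

lemma isConst_pull {X Y : TopCat.{u}} (f : X ⟶ Y) {F : Shv k Y}
    (h : (constSheaf k Y).essImage F) : (constSheaf k X).essImage ((inverseImage k f).obj F) := by
  obtain ⟨M, ⟨e⟩⟩ := h
  exact ⟨M, ⟨((inverseImageConst k f).app M).symm ≪≫ (inverseImage k f).mapIso e⟩⟩

lemma exists_epi_coprod (N : ModuleCat.{u} k) :
    ∃ (J : Type u) (p : (∐ fun _ : J ↦ ModuleCat.of k k) ⟶ N), Epi p := by
  let q (n : N) : ModuleCat.of k k ⟶ N := ModuleCat.ofHom (LinearMap.toSpanSingleton k N n)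
  refine ⟨N, Sigma.desc q, (ModuleCat.epi_iff_surjective _).mpr fun n ↦
    ⟨Sigma.ι (fun _ : N ↦ ModuleCat.of k k) n (1 : k), ?_⟩⟩
  refine (ConcreteCategory.congr_hom (Sigma.ι_desc q n) (1 : k)).trans ?_
  exact one_smul k n

lemma exists_presentation (M : ModuleCat.{u} k) :
    ∃ (I J : Type u) (a : (∐ fun _ : I ↦ ModuleCat.of k k) ⟶ ∐ fun _ : J ↦ ModuleCat.of k k)
      (b : (∐ fun _ : J ↦ ModuleCat.of k k) ⟶ M) (w : a ≫ b = 0),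
      (ShortComplex.mk a b w).Exact ∧ Epi b := by
  obtain ⟨J, b, hb⟩ := exists_epi_coprod k M
  obtain ⟨I, a, ha⟩ := exists_epi_coprod k (kernel b)
  refine ⟨I, J, a ≫ kernel.ι b, b, by simp, ?_, hb⟩
  let S := ShortComplex.mk (kernel.ι b) b (by simp)
  let g : ShortComplex.mk (a ≫ kernel.ι b) b (by simp) ⟶ S :=
    { τ₁ := a, τ₂ := 𝟙 _, τ₃ := 𝟙 _ }
  have : Epi g.τ₁ := ha
  have : IsIso g.τ₂ := inferInstanceAs (IsIso (𝟙 _))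
  have : Mono g.τ₃ := inferInstanceAs (Mono (𝟙 _))
  exact (ShortComplex.exact_iff_of_epi_of_isIso_of_mono g).mpr
    (S.exact_of_f_is_kernel (kernelIsKernel b))

lemma isQuasicoherent_of_isConstOn {F : Shv k X}
    (h : ∀ x, ∃ W : Opens X, x ∈ W ∧ isConstOn k W F) : isQuasicoherent k X F := by
  intro x
  obtain ⟨W, hW, M, ⟨e⟩⟩ := h x
  obtain ⟨I, J, a, b, w, hex, hb⟩ := exists_presentation k M
  let C := constSheaf k ((Opens.toTopCat X).obj W)
  let i₁ := PreservesCoproduct.iso C (fun _ : I ↦ ModuleCat.of k k)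
  let i₂ := PreservesCoproduct.iso C (fun _ : J ↦ ModuleCat.of k k)
  have w' : (i₁.inv ≫ C.map a ≫ i₂.hom) ≫ i₂.inv ≫ C.map b ≫ e.hom = 0 := by
    have : C.map a ≫ C.map b = 0 := by rw [← C.map_comp, w, C.map_zero]
    simp [reassoc_of% this]
  refine ⟨W, hW, I, J, i₁.inv ≫ C.map a ≫ i₂.hom, i₂.inv ≫ C.map b ≫ e.hom, w',
    ShortComplex.exact_of_iso (ShortComplex.isoMk i₁ i₂ e
      (Iso.hom_inv_id_assoc i₁ _) (Iso.hom_inv_id_assoc i₂ _)) (hex.map C), inferInstance⟩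

lemma exists_isConstOn {F : Shv k X} (h : isQuasicoherent k X F) (x : X) :
    ∃ U : Opens X, x ∈ U ∧ ∀ W : Opens X, W ≤ U → IsConnected (W : Set X) → isConstOn k W F := by
  obtain ⟨U, hU, I, J, a, b, w, hex, hb⟩ := h x
  refine ⟨U, hU, fun W hW hc ↦ ?_⟩
  have : ConnectedSpace ((Opens.toTopCat X).obj W) := isConnected_iff_connectedSpace.mp hc
  let f : (Opens.toTopCat X).obj W ⟶ (Opens.toTopCat X).obj U :=
    (Opens.toTopCat X).map (homOfLE hW)
  have hf : f ≫ U.inclusion' = W.inclusion' := rfl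
  let S := (ShortComplex.mk a b w).map (inverseImage k f)
  have hS : S.Exact := hex.map (inverseImage k f)
  have : Epi S.g := inferInstanceAs (Epi ((inverseImage k f).map b))
  have key := isConst_cokernel k _ (a := S.f) (b := S.g) hS this
    (isConst_pull k f (coprod_const_mem k _ I _)) (isConst_pull k f (coprod_const_mem k _ J _))
  exact ObjectProperty.prop_of_iso (constSheaf k _).essImage ((inverseImageComp k hf).app F) key

lemma isQuasicoherent_iff [LocallyConnectedSpace X] (F : Shv k X) : isQuasicoherent k X F ↔
    ∀ x, ∃ U : Opens X, x ∈ U ∧ ∀ W : Opens X, W ≤ U → IsConnected (W : Set X) →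
      isConstOn k W F := by
  refine ⟨exists_isConstOn k, fun h ↦ isQuasicoherent_of_isConstOn k fun x ↦ ?_⟩
  obtain ⟨U, hU, h⟩ := h x
  exact ⟨⟨connectedComponentIn U x, U.isOpen.connectedComponentIn⟩, mem_connectedComponentIn hU,
    h _ (connectedComponentIn_subset _ _) (isConnected_connectedComponentIn_iff.mpr hU)⟩

lemma exists_common [LocallyConnectedSpace X] {ι : Type} [Finite ι] {F : ι → Shv k X}
    (h : ∀ j, isQuasicoherent k X (F j)) (x : X) :
    ∃ U : Opens X, x ∈ U ∧ ∀ W : Opens X, W ≤ U → IsConnected (W : Set X) →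
      ∀ j, isConstOn k W (F j) := by
  choose U hU hF using fun j ↦ (isQuasicoherent_iff k _).mp (h j) x
  refine ⟨⟨⋂ j, U j, isOpen_iInter_of_finite fun j ↦ (U j).isOpen⟩,
    Set.mem_iInter.mpr hU, fun W hW hc j ↦ hF j W (hW.trans (Set.iInter_subset _ j)) hc⟩

lemma qcoh_limits [LocallyConnectedSpace X] (J : Type) [SmallCategory J] [FinCategory J] :
    (isQuasicoherent k X).IsClosedUnderLimitsOfShape J where
  limitsOfShape_le := by
    rintro F ⟨p⟩
    rw [isQuasicoherent_iff]
    intro x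
    obtain ⟨U, hU, h⟩ := exists_common k p.prop_diag_obj x
    refine ⟨U, hU, fun W hW hc ↦ ?_⟩
    have : ConnectedSpace ((Opens.toTopCat X).obj W) := isConnected_iff_connectedSpace.mp hc
    exact (isConstOn k W).prop_of_isLimit p.isLimit (h W hW hc)

lemma qcoh_colimits [LocallyConnectedSpace X] (J : Type) [SmallCategory J] [FinCategory J] :
    (isQuasicoherent k X).IsClosedUnderColimitsOfShape J where
  colimitsOfShape_le := by
    rintro F ⟨p⟩
    rw [isQuasicoherent_iff]
    intro x
    obtain ⟨U, hU, h⟩ := exists_common k p.prop_diag_obj x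
    refine ⟨U, hU, fun W hW hc ↦ ?_⟩
    have : ConnectedSpace ((Opens.toTopCat X).obj W) := isConnected_iff_connectedSpace.mp hc
    exact (isConstOn k W).prop_of_isColimit p.isColimit (h W hW hc)

variable [LocallyConnectedSpace X]

instance : (isQuasicoherent k X).IsClosedUnderFiniteProducts where
  isClosedUnderLimitsOfShape J _ :=
    have := Fintype.ofFinite J
    have := Classical.decEq J
    qcoh_limits k _

instance : (isQuasicoherent k X).ContainsZero where
  exists_zero := ⟨⊤_ _, IsZero.of_iso (isZero_zero _) (terminalIsTerminal.uniqueUpToIso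
    (isZero_zero _).isTerminal), ObjectProperty.prop_terminal _⟩

instance : (isQuasicoherent k X).IsClosedUnderKernels where
  kernels_le := by
    rintro _ ⟨f, c, hc, hf⟩
    have := qcoh_limits k (X := X) WalkingParallelPair
    refine (isQuasicoherent k X).prop_of_isLimit hc ?_
    rintro (_ | _)
    · exact hf.1
    · exact hf.2

instance : (isQuasicoherent k X).IsClosedUnderCokernels where
  cokernels_le := by
    rintro _ ⟨f, c, hc, hf⟩
    have := qcoh_colimits k (X := X) WalkingParallelPair
    refine (isQuasicoherent k X).prop_of_isColimit hc ?_
    rintro (_ | _)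
    · exact hf.1
    · exact hf.2

/-- The category of quasi-coherent sheaves of `k`-modules on `X`. -/
abbrev Qcoh (X : TopCat.{u}) := (isQuasicoherent k X).FullSubcategory

end Quasicoherent

section Topological

open scoped Topology

/-- A covering `p : E → Y` is trivial if it is isomorphic over `Y` to `Y × I → Y` for a discrete
space `I`. -/
def IsTrivialCovering {E Y : Type u} [TopologicalSpace E] [TopologicalSpace Y] (p : E → Y) : Prop :=
  ∃ (I : Type u) (_ : TopologicalSpace I) (_ : DiscreteTopology I) (e : E ≃ₜ Y × I),
    ∀ z, (e z).1 = p z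

/-- A space is simply connected if it is connected and all its coverings are trivial. -/
structure IsSimplyConnected (Y : Type u) [TopologicalSpace Y] : Prop where
  connected : ConnectedSpace Y
  trivial_covering (E : Type u) [TopologicalSpace E] (p : E → Y) (hp : IsCoveringMap p) :
    IsTrivialCovering p

/-- A space is locally simply connected if its simply connected open subsets form a basis of the
topology. -/
class LocallySimplyConnected (X : Type u) [TopologicalSpace X] : Prop where
  exists_isSimplyConnected (x : X) (V : Set X) (hV : V ∈ 𝓝 x) :
    ∃ U : Set X, IsOpen U ∧ x ∈ U ∧ U ⊆ V ∧ IsSimplyConnected U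

instance (X : Type u) [TopologicalSpace X] [LocallySimplyConnected X] : LocallyConnectedSpace X :=
  locallyConnectedSpace_iff_subsets_isOpen_isConnected.mpr fun x V hV ↦ by
    obtain ⟨U, hU, hx, hUV, h⟩ := LocallySimplyConnected.exists_isSimplyConnected x V hV
    exact ⟨U, hUV, hU, hx, isConnected_iff_connectedSpace.mpr h.connected⟩

end Topological

section Main

variable (k : Type u) [Ring k] {X X' : TopCat.{u}} (φ : X' ⟶ X)

/-- A universal covering is a covering whose total space is simply connected. -/
structure IsUniversalCovering : Prop where
  isCoveringMap : IsCoveringMap φ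
  isSimplyConnected : IsSimplyConnected X'

/-- The functor `F ↦ Γ(X', φ⁻¹F)` from sheaves on `X` to `G`-modules, where `G = Aut_X(X')`. -/
def sectionsRep : Shv k X ⥤ Rep.{u} k (deckGroup φ) :=
  toRep k _ (deckSectionsHom k φ)

/-- The functor `L ↦ Γ(X', φ⁻¹L)` from quasi-coherent sheaves on `X` to `G`-modules. -/
def qcohRep : Qcoh k X ⥤ Rep.{u} k (deckGroup φ) :=
  (isQuasicoherent k X).ι ⋙ sectionsRep k φ

/-- The functor `F ↦ Hⁱ(X', φ⁻¹F)` from `D⁺(X)` to `G`-modules. -/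
def cohomologyRep [HasDerivedCategory (Shv k X)] [HasDerivedCategory (Shv k X')]
    [HasDerivedCategory (ModuleCat.{u} k)] (i : ℤ) :
    DerivedCategory.Plus (Shv k X) ⥤ Rep.{u} k (deckGroup φ) :=
  toRep k _ (deckCohomologyHom k φ i)

variable {k}

/-- The functor `Rⁱ Qc = Hⁱ ∘ R Qc`, `D⁺(X) ⥤ Qcoh_k(X)`, for a right adjoint `Qc` of the inclusion
of quasi-coherent sheaves. -/
def higherQc [LocallyConnectedSpace X] [HasDerivedCategory (Shv k X)]
    [HasDerivedCategory (Qcoh k X)] {Qc : Shv k X ⥤ Qcoh k X} (adj : (isQuasicoherent k X).ι ⊣ Qc)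
    (i : ℤ) : DerivedCategory.Plus (Shv k X) ⥤ Qcoh k X :=
  have : Qc.Additive := adj.right_adjoint_additive
  Qc.rightDerivedFunctorPlus ⋙ DerivedCategory.Plus.homologyFunctor (Qcoh k X) i

end Main

end LocSys

end

/-!
Since `X'` is simply connected, the pullback `φ⁻¹L` of a locally constant sheaf `L` is constant, and
`L` is recovered from the `G`-module `Γ(X', φ⁻¹L)`: a section of `L` over `V` is a `G`-equivariant
locally constant function `φ⁻¹(V) → Γ(X', φ⁻¹L)`. Conversely, these functions define a locally
constant sheaf for every `G`-module, and on a locally connected space the quasi-coherent sheaves are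
the locally constant ones. For an arbitrary sheaf `F`, a morphism `L ⟶ F` is still the same as a
`G`-equivariant map `Γ(X', φ⁻¹L) ⟶ Γ(X', φ⁻¹F)`. Hence the locally constant sheaf `Qc(F)` that
corresponds to `Γ(X', φ⁻¹F)` is the coreflection of `F`, and `Γ(X', φ⁻¹Qc(F)) ≅ Γ(X', φ⁻¹F)`
equivariantly.

The pullback along a local homeomorphism has an exact left adjoint, extension by zero, so it
preserves injective sheaves. Therefore `Γ(X', φ⁻¹I)` computes `RΓ(X', φ⁻¹F)` for a complex of
injectives `I ≅ F`; it is also `Γ(X', φ⁻¹Qc(I))`, and its cohomology is `Γ(X', φ⁻¹RⁱQc(F))` since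
`Γ(X', φ⁻¹-)` is exact on quasi-coherent sheaves.
-/

noncomputable section

namespace LocSys

section Coverings

variable {E Y A : Type*} [TopologicalSpace E] [TopologicalSpace Y] [TopologicalSpace A]
  {p : E → Y}

lemma isCoveringMap_pullback_fst (hp : IsCoveringMap p) {f : A → Y} (hf : Continuous f) :
    IsCoveringMap (fun z : {z : A × E // f z.1 = p z.2} ↦ z.1.1) := by
  intro a
  obtain ⟨hI, U, haU, hU, -, H, hH⟩ := hp (f a)
  refine IsEvenlyCovered.to_isEvenlyCovered_preimage (I := p ⁻¹' {f a})
    ⟨hI, f ⁻¹' U, haU, hU.preimage hf, (hU.preimage hf).preimage (by fun_prop), ?_⟩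
  have mem (z : (fun z : {z : A × E // f z.1 = p z.2} ↦ z.1.1) ⁻¹' (f ⁻¹' U)) :
      p z.1.1.2 ∈ U := z.1.2 ▸ z.2
  have p_symm (x : U × p ⁻¹' {f a}) : p (H.symm x) = x.1 := by
    rw [← hH, H.apply_symm_apply]
  have H_apply (z : (fun z : {z : A × E // f z.1 = p z.2} ↦ z.1.1) ⁻¹' (f ⁻¹' U)) :
      ((⟨f z.1.1.1, z.2⟩ : U), (H ⟨z.1.1.2, mem z⟩).2) = H ⟨z.1.1.2, mem z⟩ :=
    Prod.ext (Subtype.ext (z.1.2.trans (hH ⟨z.1.1.2, mem z⟩).symm)) rfl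
  exact ⟨{
    toFun z := (⟨z.1.1.1, z.2⟩, (H ⟨z.1.1.2, mem z⟩).2)
    invFun x := ⟨⟨(x.1.1, H.symm (⟨f x.1.1, x.1.2⟩, x.2)), (p_symm (⟨f x.1.1, x.1.2⟩, x.2)).symm⟩,
      x.1.2⟩
    left_inv z := Subtype.ext (Subtype.ext (Prod.ext rfl (by
      simp only [H_apply, H.symm_apply_apply])))
    right_inv x := by simp
    continuous_toFun := by fun_prop
    continuous_invFun := Continuous.subtype_mk (Continuous.subtype_mk (Continuous.prodMk
      (by fun_prop) (continuous_subtype_val.comp (H.symm.continuous.comp (by fun_prop)))) _) _ },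
    fun _ ↦ rfl⟩

lemma isCoveringMap_surjective [PreconnectedSpace Y] [Nonempty E] (hp : IsCoveringMap p) :
    Function.Surjective p := by
  suffices isOpen_compl : IsOpen (Set.range p)ᶜ from Set.range_eq_univ.mp
    (IsClopen.eq_univ ⟨⟨isOpen_compl⟩, hp.isOpenMap.isOpen_range⟩ (Set.range_nonempty p))
  refine isOpen_iff_forall_mem_open.mpr fun y hy ↦ ?_
  obtain ⟨-, U, hyU, hU, -, H, hH⟩ := hp y
  refine ⟨U, ?_, hU, hyU⟩
  rintro _ hz ⟨e, rfl⟩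
  refine hy ⟨H.symm (⟨y, hyU⟩, (H ⟨e, hz⟩).2), ?_⟩
  rw [← hH, H.apply_symm_apply]

lemma locallyConnectedSpace_of_isLocalHomeomorph [LocallyConnectedSpace Y]
    (hp : IsLocalHomeomorph p) : LocallyConnectedSpace E := by
  refine locallyConnectedSpace_iff_connected_subsets.mpr fun e O hO ↦ ?_
  obtain ⟨t, het, -⟩ := hp e
  have := t.open_target.locallyConnectedSpace
  have := t.toHomeomorphSourceTarget.isOpenEmbedding.locallyConnectedSpace
  obtain ⟨V, hV, hVc, hVO⟩ := locallyConnectedSpace_iff_connected_subsets.mp this ⟨e, het⟩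
    (Subtype.val ⁻¹' O) (continuous_subtype_val.continuousAt hO)
  exact ⟨Subtype.val '' V, t.open_source.isOpenMap_subtype_val.image_mem_nhds hV,
    hVc.image _ continuous_subtype_val.continuousOn, Set.image_subset_iff.mpr hVO⟩

omit [TopologicalSpace Y] in
lemma exists_isOpen_isConnected_injOn [LocallyConnectedSpace E] (hp : IsLocallyInjective p)
    {e : E} {O : Set E} (hO : IsOpen O) (he : e ∈ O) :
    ∃ V ⊆ O, IsOpen V ∧ e ∈ V ∧ IsConnected V ∧ V.InjOn p := by
  obtain ⟨W, hW, heW, hinj⟩ := hp e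
  have hsub := connectedComponentIn_subset (W ∩ O) e
  exact ⟨connectedComponentIn (W ∩ O) e, hsub.trans Set.inter_subset_right,
    (hW.inter hO).connectedComponentIn, mem_connectedComponentIn ⟨heW, he⟩,
    isConnected_connectedComponentIn_iff.mpr ⟨heW, he⟩,
    hinj.mono (hsub.trans Set.inter_subset_left)⟩

end Coverings

section SimplyConnected

variable {E Y : Type u} [TopologicalSpace E] [TopologicalSpace Y] {p : E → Y}

lemma IsSimplyConnected.exists_section (hY : IsSimplyConnected Y) (hp : IsCoveringMap p) (e : E) :
    ∃ σ : Y → E, Continuous σ ∧ (∀ y, p (σ y) = y) ∧ σ (p e) = e := by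
  obtain ⟨I, _, _, H, hH⟩ := hY.trivial_covering E p hp
  refine ⟨fun y ↦ H.symm (y, (H e).2), by fun_prop, fun y ↦ ?_, ?_⟩
  · rw [← hH, H.apply_symm_apply]
  · exact (congrArg (fun y ↦ H.symm (y, (H e).2)) (hH e).symm).trans (H.symm_apply_apply e)

-- A lift of `p` through itself is a section of the covering `E ×_Y E → E`.
lemma IsSimplyConnected.exists_lift (hE : IsSimplyConnected E) (hp : IsCoveringMap p)
    {e₁ e₂ : E} (h : p e₁ = p e₂) :
    ∃ g : E → E, Continuous g ∧ (∀ e, p (g e) = p e) ∧ g e₁ = e₂ := by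
  obtain ⟨σ, hσ, hσ_fst, hσ_e₁⟩ :=
    hE.exists_section (isCoveringMap_pullback_fst hp hp.continuous) ⟨(e₁, e₂), h⟩
  exact ⟨fun e ↦ (σ e).1.2, by fun_prop, fun e ↦ by rw [← (σ e).2, hσ_fst],
    congrArg (fun z ↦ z.1.2) hσ_e₁⟩

end SimplyConnected

section Deck

variable {X X' : TopCat.{u}} {φ : X' ⟶ X}

lemma exists_deck (hφ : IsUniversalCovering φ) {y₁ y₂ : X'} (h : φ y₁ = φ y₂) :
    ∃ g : deckGroup φ, g.1 y₁ = y₂ := by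
  have := hφ.isSimplyConnected.connected
  obtain ⟨g, hg, hgφ, hg₁⟩ := hφ.isSimplyConnected.exists_lift hφ.isCoveringMap h
  obtain ⟨g', hg', hgφ', hg₁'⟩ := hφ.isSimplyConnected.exists_lift hφ.isCoveringMap h.symm
  have left_inv : g' ∘ g = id := hφ.isCoveringMap.eq_of_comp_eq (hg'.comp hg) continuous_id
    (funext fun e ↦ (hgφ' _).trans (hgφ e)) y₁ (by simp [hg₁, hg₁'])
  have right_inv : g ∘ g' = id := hφ.isCoveringMap.eq_of_comp_eq (hg.comp hg') continuous_id
    (funext fun e ↦ (hgφ _).trans (hgφ' e)) y₂ (by simp [hg₁, hg₁'])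
  exact ⟨⟨⟨⟨g, g', congrFun left_inv, congrFun right_inv⟩, hg, hg'⟩, hgφ⟩, hg₁⟩

lemma deck_ext [PreconnectedSpace X'] (hφ : IsCoveringMap φ) {g h : deckGroup φ} {y : X'}
    (e : g.1 y = h.1 y) : g = h :=
  Subtype.ext (Homeomorph.ext fun z ↦ congrFun (hφ.eq_of_comp_eq g.1.continuous h.1.continuous
    (funext fun e ↦ (g.2 e).trans (h.2 e).symm) y e) z)

/-- A sheet of `φ` is a connected open subset on which `φ` is injective. -/
structure IsSheet (φ : X' ⟶ X) (V : Opens X') : Prop where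
  isConnected : IsConnected (V : Set X')
  injOn : Set.InjOn φ V

lemma exists_isSheet [LocallyConnectedSpace X] (hφ : IsLocalHomeomorph φ) {y : X'} {O : Opens X'}
    (hy : y ∈ O) : ∃ V : Opens X', y ∈ V ∧ V ≤ O ∧ IsSheet φ V := by
  have := locallyConnectedSpace_of_isLocalHomeomorph hφ
  obtain ⟨V, hVO, hV, hyV, hVc, hinj⟩ :=
    exists_isOpen_isConnected_injOn hφ.isLocallyInjective O.isOpen hy
  exact ⟨⟨V, hV⟩, hyV, hVO, hVc, hinj⟩

lemma isBasis_isSheet [LocallyConnectedSpace X] (hφ : IsLocalHomeomorph φ) :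
    Opens.IsBasis (Set.range (Subtype.val : {V : Opens X' // IsSheet φ V} → Opens X')) := by
  rw [Opens.isBasis_iff_nbhd]
  intro O y hy
  obtain ⟨V, hyV, hVO, hV⟩ := exists_isSheet hφ hy
  exact ⟨V, ⟨⟨V, hV⟩, rfl⟩, hyV, hVO⟩

lemma exists_deck_mapsTo (hφ : IsUniversalCovering φ) {V₁ V₂ : Opens X'}
    (hV₁ : IsConnected (V₁ : Set X')) (h : φ '' V₁ ⊆ φ '' V₂) (hinj : Set.InjOn φ V₂) :
    ∃ g : deckGroup φ, ∀ y ∈ V₁, g.1 y ∈ V₂ := by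
  obtain ⟨y₁, hy₁⟩ := hV₁.nonempty
  have : Nonempty X' := ⟨y₁⟩
  have hl := hφ.isCoveringMap.isLocalHomeomorph
  let t := OpenPartialHomeomorph.ofContinuousOpen (hinj.toPartialEquiv φ V₂)
    hl.continuous.continuousOn hl.isOpenMap V₂.isOpen
  have mapsTo : Set.MapsTo φ V₁ t.target := fun y hy ↦ h ⟨y, hy, rfl⟩
  have φ_lift (y : X') (hy : y ∈ V₁) : φ (t.symm (φ y)) = φ y := t.right_inv (mapsTo hy)
  obtain ⟨g, hg⟩ := exists_deck hφ (φ_lift y₁ hy₁).symm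
  have g_eq_lift : Set.EqOn g.1 (t.symm ∘ φ) V₁ :=
    hφ.isCoveringMap.eqOn_of_comp_eqOn hV₁.isPreconnected g.1.continuous.continuousOn
      (t.continuousOn_symm.comp hl.continuous.continuousOn mapsTo)
      (fun y hy ↦ (g.2 y).trans (φ_lift y hy).symm) hy₁ hg
  exact ⟨g, fun y hy ↦ (g_eq_lift hy).symm ▸ t.map_target (mapsTo hy)⟩

end Deck

section Sections

variable {k : Type u} [Ring k] {X Y Z : TopCat.{u}}

/-- The module of sections of a sheaf over an open subset, as a type of its own: it spares the
coercions from the underlying presheaf. -/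
def sec (F : Shv k X) (U : Opens X) : ModuleCat.{u} k := F.1.obj (op U)

/-- The restriction of sections. -/
def res (F : Shv k X) {U V : Opens X} (h : V ≤ U) : sec F U →ₗ[k] sec F V :=
  (F.1.map (homOfLE h).op).hom

/-- The action of a morphism of sheaves on sections. -/
def onSec {F F' : Shv k X} (a : F ⟶ F') (U : Opens X) : sec F U →ₗ[k] sec F' U :=
  (a.hom.app (op U)).hom

lemma res_res (F : Shv k X) {U V W : Opens X} (h : V ≤ U) (h' : W ≤ V) (s : sec F U) :
    res F h' (res F h s) = res F (h'.trans h) s :=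
  (ConcreteCategory.congr_hom (F.1.map_comp (homOfLE h).op (homOfLE h').op) s).symm

lemma res_self (F : Shv k X) {U : Opens X} (h : U ≤ U) (s : sec F U) : res F h s = s :=
  ConcreteCategory.congr_hom (F.1.map_id (op U)) s

lemma onSec_res {F F' : Shv k X} (a : F ⟶ F') {U V : Opens X} (h : V ≤ U) (s : sec F U) :
    onSec a V (res F h s) = res F' h (onSec a U s) :=
  ConcreteCategory.congr_hom (a.hom.naturality (homOfLE h).op) s

lemma onSec_comp {F F' F'' : Shv k X} (a : F ⟶ F') (b : F' ⟶ F'') (U : Opens X) (s : sec F U) :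
    onSec (a ≫ b) U s = onSec b U (onSec a U s) := rfl

lemma onSec_id (F : Shv k X) (U : Opens X) (s : sec F U) : onSec (𝟙 F) U s = s := rfl

lemma onSec_bijective {F F' : Shv k X} (a : F ⟶ F') [IsIso a] (U : Opens X) :
    Function.Bijective (onSec a U) := by
  refine Function.bijective_iff_has_inverse.mpr ⟨onSec (inv a) U, fun s ↦ ?_, fun s ↦ ?_⟩
  · rw [← onSec_comp, IsIso.hom_inv_id, onSec_id]
  · rw [← onSec_comp, IsIso.inv_hom_id, onSec_id]

lemma sec_ext (F : Shv k X) {ι : Type*} {U : Opens X} (W : ι → Opens X) (hW : ∀ i, W i ≤ U)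
    (hc : ∀ x ∈ U, ∃ i, x ∈ W i) {s t : sec F U} (h : ∀ i, res F (hW i) s = res F (hW i) t) :
    s = t :=
  TopCat.Sheaf.eq_of_locally_eq' F W U (fun i ↦ homOfLE (hW i))
    (fun x hx ↦ Opens.mem_iSup.mpr (hc x hx)) s t h

lemma exists_glue (F : Shv k X) {ι : Type*} {U : Opens X} (W : ι → Opens X) (hW : ∀ i, W i ≤ U)
    (hc : ∀ x ∈ U, ∃ i, x ∈ W i) (sf : ∀ i, sec F (W i))
    (h : ∀ i j, res F (inf_le_left : W i ⊓ W j ≤ W i) (sf i) = res F inf_le_right (sf j)) :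
    ∃ s : sec F U, ∀ i, res F (hW i) s = sf i :=
  (TopCat.Sheaf.existsUnique_gluing' F W U (fun i ↦ homOfLE (hW i))
    (fun x hx ↦ Opens.mem_iSup.mpr (hc x hx)) sf h).exists

lemma shv_hom_ext {F F' : Shv k X} {a b : F ⟶ F'} (h : ∀ U s, onSec a U s = onSec b U s) :
    a = b :=
  ObjectProperty.hom_ext _ (NatTrans.ext (funext fun U ↦ by
    ext s
    exact h U.unop s))

section Basis

variable {F F' : Shv k X} {ι : Type*} {B : ι → Opens X}

lemma exists_le_of_isBasis (hB : Opens.IsBasis (Set.range B)) {U : Opens X} {x : X} (hx : x ∈ U) :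
    ∃ i, x ∈ B i ∧ B i ≤ U := by
  obtain ⟨_, ⟨i, rfl⟩, h⟩ := Opens.isBasis_iff_nbhd.mp hB hx
  exact ⟨i, h⟩

lemma sec_ext_basis (F : Shv k X) (hB : Opens.IsBasis (Set.range B)) {U : Opens X} {s t : sec F U}
    (h : ∀ i (hi : B i ≤ U), res F hi s = res F hi t) : s = t :=
  sec_ext F (fun i : {i // B i ≤ U} ↦ B i) (fun i ↦ i.2) (fun x hx ↦ by
    obtain ⟨i, hi, h⟩ := exists_le_of_isBasis hB hx
    exact ⟨⟨i, h⟩, hi⟩) fun i ↦ h i i.2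

lemma hom_ext_basis (hB : Opens.IsBasis (Set.range B)) {a b : F ⟶ F'}
    (h : ∀ i s, onSec a (B i) s = onSec b (B i) s) : a = b :=
  shv_hom_ext fun U s ↦ sec_ext_basis F' hB fun i hi ↦ by
    rw [← onSec_res, ← onSec_res, h]

lemma isIso_of_bijective_basis (hB : Opens.IsBasis (Set.range B)) (a : F ⟶ F')
    (h : ∀ i, Function.Bijective (onSec a (B i))) : IsIso a :=
  TopCat.Sheaf.isIso_iff_isIso_basis hB fun i ↦ (ConcreteCategory.isIso_iff_bijective _).mpr (h i)

/-- The morphism of sheaves given by a compatible family of maps on a basis. -/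
def homOfBasis (hB : Opens.IsBasis (Set.range B)) (a : ∀ i, sec F (B i) →ₗ[k] sec F' (B i))
    (ha : ∀ i j (h : B j ≤ B i) s, a j (res F h s) = res F' h (a i s)) : F ⟶ F' :=
  ⟨TopCat.Sheaf.restrictHomEquivHom F.1 F' hB
    { app i := ModuleCat.ofHom (a i.unop)
      naturality i j f := by
        ext s
        exact ha _ _ _ s }⟩

lemma homOfBasis_onSec (hB : Opens.IsBasis (Set.range B))
    (a : ∀ i, sec F (B i) →ₗ[k] sec F' (B i))
    (ha : ∀ i j (h : B j ≤ B i) s, a j (res F h s) = res F' h (a i s)) (i : ι) (s : sec F (B i)) :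
    onSec (homOfBasis hB a ha) (B i) s = a i s :=
  ConcreteCategory.congr_hom (TopCat.Sheaf.extend_hom_app F.1 F' hB _ i) s

end Basis

end Sections

section PullbackOfSections

variable {k : Type u} [Ring k] {X Y Z : TopCat.{u}}

/-- The pullback of sections `F(U) ⟶ (f⁻¹F)(V)` for open subsets with `f(V) ⊆ U`. -/
def pull (f : X ⟶ Y) (F : Shv k Y) {U : Opens Y} {V : Opens X} (h : V ≤ (Opens.map f).obj U) :
    sec F U →ₗ[k] sec ((inverseImage k f).obj F) V :=
  res _ h ∘ₗ onSec (F' := (TopCat.Sheaf.pushforward (ModuleCat.{u} k) f).obj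
    ((inverseImage k f).obj F)) ((inverseImageAdj k f).unit.app F) U

lemma res_pull (f : X ⟶ Y) (F : Shv k Y) {U : Opens Y} {V V' : Opens X}
    (h : V ≤ (Opens.map f).obj U) (i : V' ≤ V) (s : sec F U) :
    res _ i (pull f F h s) = pull f F (i.trans h) s :=
  res_res _ _ _ _

lemma pull_res (f : X ⟶ Y) (F : Shv k Y) {U U' : Opens Y} {V : Opens X}
    (h : V ≤ (Opens.map f).obj U') (i : U' ≤ U) (s : sec F U) :
    pull f F h (res F i s) = pull f F (h.trans ((Opens.map f).map (homOfLE i)).le) s := by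
  refine (congrArg (res _ h) (onSec_res ((inverseImageAdj k f).unit.app F) i s)).trans ?_
  exact res_res ((inverseImage k f).obj F) _ _ _

lemma onSec_pull (f : X ⟶ Y) {F F' : Shv k Y} (a : F ⟶ F') {U : Opens Y} {V : Opens X}
    (h : V ≤ (Opens.map f).obj U) (s : sec F U) :
    onSec ((inverseImage k f).map a) V (pull f F h s) = pull f F' h (onSec a U s) := by
  refine (onSec_res ((inverseImage k f).map a) h _).trans (congrArg (res _ h) ?_)
  exact (ConcreteCategory.congr_hom (congrArg (fun b ↦ b.hom.app (op U))
    ((inverseImageAdj k f).unit.naturality a)) s).symm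

lemma pull_top (f : X ⟶ Y) (F : Shv k Y) (s : sec F ⊤) :
    pull f F (U := ⊤) (V := ⊤) le_top s = ((sectionsPull k f).app F).hom s :=
  res_self _ _ _

lemma inverseImageComp_pull {f : X ⟶ Y} {g : Y ⟶ Z} {h : X ⟶ Z} (w : f ≫ g = h) (F : Shv k Z)
    {U : Opens Z} {V : Opens Y} {W : Opens X} (hV : V ≤ (Opens.map g).obj U)
    (hW : W ≤ (Opens.map f).obj V) (hW' : W ≤ (Opens.map h).obj U) (s : sec F U) :
    onSec ((inverseImageComp k w).hom.app F) W
      (pull f ((inverseImage k g).obj F) hW (pull g F hV s)) = pull h F hW' s := by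
  subst w
  have unit_comp := Adjunction.unit_leftAdjointUniq_hom_app
    ((inverseImageAdj k g).comp (inverseImageAdj k f)) (inverseImageAdj k (f ≫ g)) F
  refine Eq.trans ?_ (congrArg (fun b ↦ res _ hW' (onSec b U s)) unit_comp)
  rw [Adjunction.comp_unit_app]
  have pull_enlarge : pull f ((inverseImage k g).obj F) hW (pull g F hV s) =
      pull f ((inverseImage k g).obj F) hW' (pull g F le_rfl s) := by
    rw [← res_pull g F le_rfl hV, pull_res]
  have pull_eq_unit : pull g F (le_refl ((Opens.map g).obj U)) s =
      onSec ((inverseImageAdj k g).unit.app F) U s := res_self ((inverseImage k g).obj F) _ _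
  rw [pull_enlarge]
  refine (onSec_res ((inverseImageComp k (rfl : f ≫ g = f ≫ g)).hom.app F) hW' _).trans
    (congrArg (res _ hW') ?_)
  rw [pull_eq_unit]
  rfl

end PullbackOfSections

section OpenMaps

variable (k : Type u) [Ring k] {X Y : TopCat.{u}} {f : X ⟶ Y} (hf : IsOpenMap f)

/-- The sheafification of `V ↦ F(f(V))` is left adjoint to the direct image by an open map. -/
def openMapAdj : sheafToPresheaf (Opens.grothendieckTopology Y) (ModuleCat.{u} k) ⋙
    (Functor.whiskeringLeft _ _ _).obj hf.functor.op ⋙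
      presheafToSheaf (Opens.grothendieckTopology X) (ModuleCat.{u} k) ⊣
    TopCat.Sheaf.pushforward (ModuleCat.{u} k) f :=
  ((hf.adjunction.op.whiskerLeft (ModuleCat.{u} k)).comp
    (sheafificationAdjunction (Opens.grothendieckTopology X)
      (ModuleCat.{u} k))).restrictFullyFaithful
    (fullyFaithfulSheafToPresheaf (Opens.grothendieckTopology Y) (ModuleCat.{u} k))
    (Functor.FullyFaithful.id _) (Iso.refl _) (Iso.refl _)

variable {k}

lemma openMapAdj_unit_app (F : Shv k Y) (U : Opens Y) :
    ((openMapAdj k hf).unit.app F).hom.app (op U) =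
      F.1.map (hf.adjunction.counit.app U).op ≫
        (toSheafify (Opens.grothendieckTopology X) (hf.functor.op ⋙ F.1)).app
          (op ((Opens.map f).obj U)) := by
  have unit_restrict := Adjunction.map_restrictFullyFaithful_unit_app
    (iC := sheafToPresheaf (Opens.grothendieckTopology Y) (ModuleCat.{u} k)) (iD := 𝟭 _)
    (hiC := fullyFaithfulSheafToPresheaf (Opens.grothendieckTopology Y) (ModuleCat.{u} k))
    (hiD := Functor.FullyFaithful.id _)
    (L := sheafToPresheaf (Opens.grothendieckTopology Y) (ModuleCat.{u} k) ⋙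
      (Functor.whiskeringLeft _ _ _).obj hf.functor.op ⋙
      presheafToSheaf (Opens.grothendieckTopology X) (ModuleCat.{u} k))
    (R := TopCat.Sheaf.pushforward (ModuleCat.{u} k) f)
    (adj := (hf.adjunction.op.whiskerLeft (ModuleCat.{u} k)).comp
      (sheafificationAdjunction (Opens.grothendieckTopology X) (ModuleCat.{u} k)))
    (comm1 := Iso.refl _) (comm2 := Iso.refl _) F
  refine (congrArg (fun b ↦ NatTrans.app b (op U)) unit_restrict).trans ?_
  rw [Adjunction.comp_unit_app]
  rfl

/-- The sheafification of `V ↦ F(f(V))`. -/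
def openMapSheaf (F : Shv k Y) : Shv k X :=
  (presheafToSheaf (Opens.grothendieckTopology X) (ModuleCat.{u} k)).obj (hf.functor.op ⋙ F.1)

/-- The map from `F(f(V))` to the sections over `V` of the sheafification of `V ↦ F(f(V))`. -/
def openMapEta (F : Shv k Y) (V : Opens X) :
    sec F (hf.functor.obj V) →ₗ[k] sec (openMapSheaf hf F) V :=
  ((toSheafify (Opens.grothendieckTopology X) (hf.functor.op ⋙ F.1)).app (op V)).hom

lemma openMapEta_res (F : Shv k Y) {V W : Opens X} (h : W ≤ V) (s : sec F (hf.functor.obj V)) :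
    openMapEta hf F W (res F (hf.functor.map (homOfLE h)).le s) =
      res (openMapSheaf hf F) h (openMapEta hf F V s) :=
  ConcreteCategory.congr_hom ((toSheafify (Opens.grothendieckTopology X)
    (hf.functor.op ⋙ F.1)).naturality (homOfLE h).op) s

lemma openMapEta_injective (F : Shv k Y) (V : Opens X) :
    Function.Injective (openMapEta hf F V) := by
  intro s t h
  have hs := Presheaf.equalizerSieve_mem (Opens.grothendieckTopology X)
    (toSheafify (Opens.grothendieckTopology X) (hf.functor.op ⋙ F.1)) (X := op V) s t h
  choose W i hi hx using fun x : V ↦ hs x.1 x.2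
  refine sec_ext F (fun x ↦ hf.functor.obj (W x)) (fun x ↦ (hf.functor.map (i x)).le) ?_ hi
  rintro _ ⟨x, hxV, rfl⟩
  exact ⟨⟨x, hxV⟩, x, hx ⟨x, hxV⟩, rfl⟩

lemma openMapEta_bijective (F : Shv k Y) {V : Opens X} (hV : Set.InjOn f V) :
    Function.Bijective (openMapEta hf F V) := by
  refine ⟨openMapEta_injective hf F V, fun s ↦ ?_⟩
  have hs := Presheaf.imageSieve_mem (Opens.grothendieckTopology X)
    (toSheafify (Opens.grothendieckTopology X) (hf.functor.op ⋙ F.1)) (U := op V) s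
  choose W i hi hx using fun x : V ↦ hs x.1 x.2
  obtain ⟨c, hc⟩ : ∃ c : ∀ x, sec F (hf.functor.obj (W x)),
      ∀ x, openMapEta hf F (W x) (c x) = res (openMapSheaf hf F) (i x).le s :=
    ⟨fun x ↦ (hi x).choose, fun x ↦ (hi x).choose_spec⟩
  have inf_image_le (x y : V) :
      hf.functor.obj (W x) ⊓ hf.functor.obj (W y) ≤ hf.functor.obj (W x ⊓ W y) := by
    rintro _ ⟨⟨a, ha, rfl⟩, b, hb, hab⟩
    obtain rfl := hV ((i y).le hb) ((i x).le ha) hab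
    exact ⟨b, ⟨ha, hb⟩, rfl⟩
  have compatible (x y : V) : res F (hf.functor.map (homOfLE inf_le_left)).le (c x) =
      res F (hf.functor.map (homOfLE (inf_le_right : W x ⊓ W y ≤ W y))).le (c y) := by
    apply openMapEta_injective hf F
    rw [openMapEta_res _ _ inf_le_left, openMapEta_res _ _ inf_le_right, hc, hc, res_res, res_res]
  obtain ⟨t, ht⟩ := exists_glue F (U := hf.functor.obj V) (fun x ↦ hf.functor.obj (W x))
    (fun x ↦ (hf.functor.map (i x)).le)
    (by rintro _ ⟨x, hxV, rfl⟩; exact ⟨⟨x, hxV⟩, x, hx ⟨x, hxV⟩, rfl⟩) c (fun x y ↦ by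
      simpa only [res_res] using congrArg (res F (inf_image_le x y)) (compatible x y))
  refine ⟨t, sec_ext (openMapSheaf hf F) W (fun x ↦ (i x).le)
    (fun x hxV ↦ ⟨⟨x, hxV⟩, hx _⟩) fun x ↦ ?_⟩
  rw [← openMapEta_res, ht, hc]

lemma pull_bijective (hf : IsOpenMap f) (F : Shv k Y) {V : Opens X} (hV : Set.InjOn f V)
    {U : Opens Y} (hU : f '' V = U) (h : V ≤ (Opens.map f).obj U) :
    Function.Bijective (pull f F h) := by
  obtain rfl : U = hf.functor.obj V := Opens.ext hU.symm
  let e : (inverseImage k f).obj F ≅ openMapSheaf hf F :=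
    ((inverseImageAdj k f).leftAdjointUniq (openMapAdj k hf)).app F
  have unit_e := Adjunction.unit_leftAdjointUniq_hom_app (inverseImageAdj k f) (openMapAdj k hf) F
  have onSec_e_pull (s) : onSec e.hom V (pull f F h s) = openMapEta hf F V s := by
    refine (onSec_res e.hom h _).trans ?_
    refine (congrArg (fun b : F ⟶ (TopCat.Sheaf.pushforward (ModuleCat.{u} k) f).obj
      (openMapSheaf hf F) ↦ res (openMapSheaf hf F) h (onSec b _ s)) unit_e).trans ?_
    refine (congrArg (fun b ↦ res (openMapSheaf hf F) h (b.hom s))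
      (openMapAdj_unit_app hf F _)).trans ?_
    refine (openMapEta_res hf F h _).symm.trans (congrArg _ ?_)
    exact (res_res F _ _ s).trans (res_self F _ s)
  refine (Function.Bijective.of_comp_iff' (onSec_bijective e.hom V) _).mp ?_
  rw [show onSec e.hom V ∘ pull f F h = openMapEta hf F V from funext onSec_e_pull]
  exact openMapEta_bijective hf F hV

end OpenMaps

section ExtensionByZero

open DirectSum

variable {k : Type u} [Ring k] {X Y : TopCat.{u}}

lemma onSec_injective_of_mono {F F' : Shv k X} (a : F ⟶ F') [Mono a] (U : Opens X) :
    Function.Injective (onSec a U) := by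
  have h : (sheafToPresheaf (Opens.grothendieckTopology X)
    (ModuleCat.{u} k)).PreservesMonomorphisms := inferInstance
  have : Mono a.hom := @h.preserves _ _ a ‹_›
  exact (ModuleCat.mono_iff_injective _).mp ((NatTrans.mono_iff_mono_app _).mp this (op U))

/-- The open subsets of `X` which are mapped bijectively to `U` by `f`. -/
@[ext]
structure Lift (f : X ⟶ Y) (U : Opens Y) where
  /-- The underlying open subset of `X`. -/
  opens : Opens X
  injOn : Set.InjOn f opens
  image_eq : f '' opens = U

variable {f : X ⟶ Y}

lemma Lift.exists_eq {U : Opens Y} (V : Lift f U) {y : Y} (hy : y ∈ U) :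
    ∃ x ∈ V.opens, f x = y := by
  rwa [← SetLike.mem_coe, ← V.image_eq] at hy

lemma Lift.le_map {U : Opens Y} (V : Lift f U) : V.opens ≤ (Opens.map f).obj U := by
  intro x hx
  change f x ∈ (U : Set Y)
  exact V.image_eq ▸ ⟨x, hx, rfl⟩

/-- The part of a lift which lies over a smaller open subset. -/
def Lift.restrict {U U' : Opens Y} (h : U' ≤ U) (V : Lift f U) : Lift f U' :=
  ⟨V.opens ⊓ (Opens.map f).obj U', V.injOn.mono fun _ hx ↦ hx.1, by
    ext y
    refine ⟨fun ⟨x, hx, hxy⟩ ↦ hxy ▸ hx.2, fun hy ↦ ?_⟩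
    obtain ⟨x, hx, rfl⟩ := V.exists_eq (h hy)
    exact ⟨x, ⟨hx, hy⟩, rfl⟩⟩

lemma Lift.restrict_le {U U' : Opens Y} (h : U' ≤ U) (V : Lift f U) :
    (V.restrict h).opens ≤ V.opens :=
  inf_le_left

lemma Lift.eq_restrict {U U' : Opens Y} (h : U' ≤ U) (V : Lift f U) (V' : Lift f U')
    (hV : V'.opens ≤ V.opens) : V' = V.restrict h := by
  refine Lift.ext (le_antisymm (fun x hx ↦ ⟨hV hx, V'.le_map hx⟩) fun x hx ↦ ?_)
  obtain ⟨x', hx', e⟩ := V'.exists_eq hx.2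
  rwa [← V.injOn (hV hx') hx.1 e]

variable (f) in
/-- The sections over `U` of the extension by zero of `P` along `f`, before sheafification: the
direct sum of the `P(V)`, where `V` runs through the lifts of `U`. -/
abbrev ExtSec (P : Shv k X) (U : Opens Y) : Type u := ⨁ V : Lift f U, sec P V.opens

open Classical in
/-- The inclusion of the summand `P(V)` of `ExtSec f P U`. -/
def extι (P : Shv k X) {U : Opens Y} (V : Lift f U) : sec P V.opens →ₗ[k] ExtSec f P U :=
  lof k (Lift f U) (fun V ↦ sec P V.opens) V

section

variable {P : Shv k X} {U : Opens Y} {N : Type*} [AddCommGroup N] [Module k N]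

lemma extSec_hom_ext {a b : ExtSec f P U →ₗ[k] N} (h : ∀ V s, a (extι P V s) = b (extι P V s)) :
    a = b := by
  classical
  exact DirectSum.linearMap_ext k fun V ↦ LinearMap.ext fun s ↦ h V s

open Classical in
/-- The map out of `ExtSec f P U` given by maps out of the summands. -/
def extSecDesc (a : ∀ V : Lift f U, sec P V.opens →ₗ[k] N) : ExtSec f P U →ₗ[k] N :=
  toModule k _ N a

lemma extSecDesc_ι (a : ∀ V : Lift f U, sec P V.opens →ₗ[k] N) (V : Lift f U) (s : sec P V.opens) :
    extSecDesc a (extι P V s) = a V s := by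
  classical
  exact toModule_lof (M := fun V : Lift f U ↦ sec P V.opens) (φ := a) k V s

end

/-- The restriction maps of the extension by zero. -/
def extRes (P : Shv k X) {U U' : Opens Y} (h : U' ≤ U) : ExtSec f P U →ₗ[k] ExtSec f P U' :=
  extSecDesc fun V ↦ extι P (V.restrict h) ∘ₗ res P (V.restrict_le h)

lemma extRes_ι (P : Shv k X) {U U' : Opens Y} (h : U' ≤ U) (V : Lift f U) (V' : Lift f U')
    (h' : V'.opens ≤ V.opens) (s : sec P V.opens) :
    extRes P h (extι P V s) = extι P V' (res P h' s) := by
  obtain rfl := V.eq_restrict h V' h'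
  exact extSecDesc_ι _ V s

lemma extRes_self (P : Shv k X) {U : Opens Y} (h : U ≤ U) :
    extRes P h = (LinearMap.id : ExtSec f P U →ₗ[k] _) :=
  extSec_hom_ext fun V s ↦ by rw [extRes_ι P h V V le_rfl s, res_self, LinearMap.id_apply]

lemma extRes_comp (P : Shv k X) {U U' U'' : Opens Y} (h : U' ≤ U) (h' : U'' ≤ U') :
    extRes P (h'.trans h) = (extRes P h' ∘ₗ extRes P h : ExtSec f P U →ₗ[k] _) := by
  refine extSec_hom_ext fun V s ↦ ?_
  have h'' := (V.restrict h).restrict_le h'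
  rw [LinearMap.comp_apply, extRes_ι P h V (V.restrict h) (V.restrict_le h), extRes_ι P h' _ _ h'',
    extRes_ι P (h'.trans h) V _ (h''.trans (V.restrict_le h)), res_res]

variable (f)

/-- The extension by zero of `P` along `f` as a presheaf. -/
def extPresheaf (P : Shv k X) : (Opens Y)ᵒᵖ ⥤ ModuleCat.{u} k where
  obj U := ModuleCat.of k (ExtSec f P U.unop)
  map i := ModuleCat.ofHom (extRes P i.unop.le)
  map_id _ := ModuleCat.hom_ext (extRes_self P _)
  map_comp i j := ModuleCat.hom_ext (extRes_comp P i.unop.le j.unop.le)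

variable {f}

lemma extPresheaf_hom_ext {P : Shv k X} {Q : (Opens Y)ᵒᵖ ⥤ ModuleCat.{u} k}
    {b b' : extPresheaf f P ⟶ Q}
    (h : ∀ (U : Opens Y) (V : Lift f U) s, (b.app (op U)).hom (extι P V s) =
      (b'.app (op U)).hom (extι P V s)) : b = b' :=
  NatTrans.ext (funext fun U ↦ ModuleCat.hom_ext (extSec_hom_ext (h U.unop)))

section

variable {P : Shv k X} {Q : (Opens Y)ᵒᵖ ⥤ ModuleCat.{u} k}
  (a : ∀ (U : Opens Y) (V : Lift f U), sec P V.opens →ₗ[k] Q.obj (op U))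
  (ha : ∀ (U U' : Opens Y) (i : U' ⟶ U) (V : Lift f U) (V' : Lift f U') (h : V'.opens ≤ V.opens) s,
    a U' V' (res P h s) = (Q.map i.op).hom (a U V s))

/-- The morphism of presheaves given by compatible maps `P(V) ⟶ Q(f(V))`. -/
def extDesc : extPresheaf f P ⟶ Q where
  app U := ModuleCat.ofHom (extSecDesc (a U.unop))
  naturality U U' i := by
    refine ModuleCat.hom_ext (extSec_hom_ext fun V s ↦ ?_)
    refine (congrArg (extSecDesc (a U'.unop)) (extRes_ι P i.unop.le V _
      (V.restrict_le i.unop.le) s)).trans ?_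
    refine (extSecDesc_ι _ _ _).trans ((ha _ _ i.unop V _ _ s).trans ?_)
    exact congrArg (Q.map i).hom (extSecDesc_ι _ V s).symm

lemma extDesc_ι {U : Opens Y} (V : Lift f U) (s : sec P V.opens) :
    ((extDesc a ha).app (op U)).hom (extι P V s) = a U V s :=
  extSecDesc_ι _ V s

end

lemma app_extι_res {P : Shv k X} {Q : (Opens Y)ᵒᵖ ⥤ ModuleCat.{u} k} (b : extPresheaf f P ⟶ Q)
    {U U' : Opens Y} (i : U' ⟶ U) (V : Lift f U) (V' : Lift f U') (h : V'.opens ≤ V.opens)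
    (s : sec P V.opens) : (b.app (op U')).hom (extι P V' (res P h s)) =
      (Q.map i.op).hom ((b.app (op U)).hom (extι P V s)) :=
  (congrArg (b.app (op U')).hom (extRes_ι P i.le V V' h s)).symm.trans
    (ConcreteCategory.congr_hom (b.naturality i.op) (extι P V s))

/-- The functoriality of the extension by zero. -/
def extMap {P P' : Shv k X} (a : P ⟶ P') : extPresheaf f P ⟶ extPresheaf f P' :=
  extDesc (fun _ V ↦ extι P' V ∘ₗ onSec a V.opens) fun _ _ i V V' h s ↦
    (congrArg (extι P' V') (onSec_res a h s)).trans (extRes_ι P' i.le V V' h _).symm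

lemma extMap_ι {P P' : Shv k X} (a : P ⟶ P') {U : Opens Y} (V : Lift f U) (s : sec P V.opens) :
    ((extMap a).app (op U)).hom (extι P V s) = extι P' V (onSec a V.opens s) :=
  extDesc_ι _ _ V s

variable (k f) in
/-- Extension by zero along `f` as a functor to presheaves. -/
def extFunctor : Shv k X ⥤ (Opens Y)ᵒᵖ ⥤ ModuleCat.{u} k where
  obj P := extPresheaf f P
  map a := extMap a
  map_id _ := extPresheaf_hom_ext fun _ V s ↦ extMap_ι _ V s
  map_comp a b := extPresheaf_hom_ext fun U V s ↦ (extMap_ι _ V s).trans <|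
    (extMap_ι b V _).symm.trans (congrArg ((extMap b).app (op U)).hom (extMap_ι a V s).symm)

instance : (extFunctor k f).PreservesMonomorphisms where
  preserves {P P'} a _ := by
    classical
    refine (NatTrans.mono_iff_mono_app _).mpr fun U ↦ (ModuleCat.mono_iff_injective _).mpr ?_
    have extMap_eq : ((extMap a).app U).hom =
        DFinsupp.mapRange.linearMap fun V : Lift f U.unop ↦ onSec a V.opens :=
      extSec_hom_ext fun V s ↦ (extMap_ι a V s).trans
        (DFinsupp.mapRange_single (f := fun V : Lift f U.unop ↦ onSec a V.opens)
          (hf := fun V ↦ map_zero (onSec a V.opens))).symm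
    have mapRange_injective := (DFinsupp.mapRange_injective
      (fun V : Lift f U.unop ↦ onSec a V.opens) fun V ↦ map_zero (onSec a V.opens)).mpr
        fun V ↦ onSec_injective_of_mono a V.opens
    intro s t h
    exact mapRange_injective ((DFunLike.congr_fun extMap_eq s).symm.trans
      (h.trans (DFunLike.congr_fun extMap_eq t)))

lemma isBasis_injOn (hf : IsLocallyInjective f) : Opens.IsBasis
    (Set.range (Subtype.val : {V : Opens X // Set.InjOn f V} → Opens X)) := by
  rw [Opens.isBasis_iff_nbhd]
  intro U x hx
  obtain ⟨V, hV, hxV, hinj⟩ := hf x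
  exact ⟨⟨V, hV⟩ ⊓ U, ⟨⟨_, hinj.mono Set.inter_subset_left⟩, rfl⟩, ⟨hxV, hx⟩, inf_le_right⟩

section

variable (hf : IsOpenMap f)

/-- An open subset on which the open map `f` is injective, as a lift of its image. -/
abbrev liftOfInjOn (V : {V : Opens X // Set.InjOn f V}) : Lift f (hf.functor.obj V.1) :=
  ⟨V.1, V.2, rfl⟩

/-- The isomorphism `I(U) ≅ (f⁻¹I)(V)` for a lift `V` of `U` along an open map `f`. -/
def pullEquiv (I : Shv k Y) {U : Opens Y} (V : Lift f U) :
    sec I U ≃ₗ[k] sec ((inverseImage k f).obj I) V.opens :=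
  LinearEquiv.ofBijective (pull f I V.le_map) (pull_bijective hf I V.injOn V.image_eq _)

lemma pullEquiv_res (I : Shv k Y) {U U' : Opens Y} (i : U' ≤ U) (V : Lift f U) (V' : Lift f U')
    (h : V'.opens ≤ V.opens) (s : sec I U) :
    pullEquiv hf I V' (res I i s) = res _ h (pullEquiv hf I V s) :=
  (pull_res f I V'.le_map i s).trans (res_pull f I V.le_map h s).symm

/-- The morphism from the extension by zero of `A` which corresponds to `A ⟶ f⁻¹I`. -/
def extOfHom {A : Shv k X} {I : Shv k Y} (a : A ⟶ (inverseImage k f).obj I) :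
    extPresheaf f A ⟶ I.1 :=
  extDesc (fun _ V ↦ (pullEquiv hf I V).symm.toLinearMap ∘ₗ onSec a V.opens)
    fun _ _ i V V' h s ↦ (LinearEquiv.symm_apply_eq _).mpr <| (onSec_res a h s).trans <|
      Eq.trans (congrArg (res _ h) ((pullEquiv hf I V).apply_symm_apply _).symm)
        (pullEquiv_res hf I i.le V V' h _).symm

lemma extOfHom_ι {A : Shv k X} {I : Shv k Y} (a : A ⟶ (inverseImage k f).obj I) {U : Opens Y}
    (V : Lift f U) (s : sec A V.opens) :
    ((extOfHom hf a).app (op U)).hom (extι A V s) = (pullEquiv hf I V).symm (onSec a V.opens s) :=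
  extDesc_ι _ _ V s

lemma extOfHom_comp {A A' : Shv k X} {I : Shv k Y} (a : A ⟶ A')
    (b : A' ⟶ (inverseImage k f).obj I) : extOfHom hf (a ≫ b) = extMap a ≫ extOfHom hf b :=
  extPresheaf_hom_ext fun U V s ↦ (extOfHom_ι _ _ V s).trans <|
    (extOfHom_ι _ b V (onSec a V.opens s)).symm.trans <|
      congrArg ((extOfHom _ b).app (op U)).hom (extMap_ι a V s).symm

end

section

variable (hf : IsLocalHomeomorph f)

/-- The morphism `A ⟶ f⁻¹I` which corresponds to a morphism from the extension by zero of `A`. -/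
def extToHom {A : Shv k X} {I : Shv k Y} (b : extPresheaf f A ⟶ I.1) :
    A ⟶ (inverseImage k f).obj I :=
  homOfBasis (isBasis_injOn hf.isLocallyInjective)
    (fun V ↦ (pullEquiv hf.isOpenMap I (liftOfInjOn hf.isOpenMap V)).toLinearMap ∘ₗ
      (b.app (op (hf.isOpenMap.functor.obj V.1))).hom ∘ₗ extι A (liftOfInjOn hf.isOpenMap V))
    fun V V' h s ↦ by
      have image_le := (hf.isOpenMap.functor.map (homOfLE h)).le
      refine Eq.trans (congrArg (pullEquiv hf.isOpenMap I (liftOfInjOn hf.isOpenMap V'))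
        (app_extι_res b (homOfLE image_le) (liftOfInjOn hf.isOpenMap V)
          (liftOfInjOn hf.isOpenMap V') h s)) ?_
      exact pullEquiv_res hf.isOpenMap I image_le (liftOfInjOn hf.isOpenMap V)
        (liftOfInjOn hf.isOpenMap V') h _

lemma onSec_extToHom {A : Shv k X} {I : Shv k Y} (b : extPresheaf f A ⟶ I.1)
    (V : {V : Opens X // Set.InjOn f V}) (s : sec A V.1) :
    onSec (extToHom hf b) V.1 s = pullEquiv hf.isOpenMap I (liftOfInjOn hf.isOpenMap V)
      ((b.app _).hom (extι A (liftOfInjOn hf.isOpenMap V) s)) :=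
  homOfBasis_onSec (isBasis_injOn hf.isLocallyInjective) _ _ V s

/-- Morphisms from the extension by zero of `A` to a sheaf `I` are the same as morphisms from `A`
to `f⁻¹I`. -/
def extHomEquiv (A : Shv k X) (I : Shv k Y) :
    (extPresheaf f A ⟶ I.1) ≃ (A ⟶ (inverseImage k f).obj I) where
  toFun b := extToHom hf b
  invFun a := extOfHom hf.isOpenMap a
  left_inv b := extPresheaf_hom_ext fun U V s ↦ by
    obtain ⟨V, hV, hU⟩ := V
    obtain rfl : hf.isOpenMap.functor.obj V = U := Opens.ext hU
    exact (extOfHom_ι _ _ _ s).trans ((LinearEquiv.symm_apply_eq _).mpr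
      (onSec_extToHom hf b ⟨V, hV⟩ s))
  right_inv a := hom_ext_basis (isBasis_injOn hf.isLocallyInjective) fun V s ↦
    (onSec_extToHom hf _ V s).trans <| (LinearEquiv.eq_symm_apply _).mp <|
      extOfHom_ι _ a (liftOfInjOn hf.isOpenMap V) s

lemma extToHom_comp {A : Shv k X} {I I' : Shv k Y} (b : extPresheaf f A ⟶ I.1) (c : I ⟶ I') :
    extToHom hf (b ≫ c.hom) = extToHom hf b ≫ (inverseImage k f).map c :=
  hom_ext_basis (isBasis_injOn hf.isLocallyInjective) fun V s ↦ by
    rw [onSec_comp, onSec_extToHom, onSec_extToHom]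
    exact (onSec_pull f c _ _).symm

variable (k) in
/-- Extension by zero along a local homeomorphism is left adjoint to the inverse image. -/
def extAdj : extFunctor k f ⋙ presheafToSheaf (Opens.grothendieckTopology Y) (ModuleCat.{u} k) ⊣
    inverseImage k f :=
  Adjunction.mkOfHomEquiv
    { homEquiv A I := ((sheafificationAdjunction (Opens.grothendieckTopology Y)
        (ModuleCat.{u} k)).homEquiv (extPresheaf f A) I).trans (extHomEquiv hf A I)
      homEquiv_naturality_left_symm a b :=
        (congrArg (((sheafificationAdjunction _ _).homEquiv _ _).symm)
          (extOfHom_comp hf.isOpenMap a b)).trans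
            ((sheafificationAdjunction _ _).homEquiv_naturality_left_symm _ _)
      homEquiv_naturality_right b c :=
        (congrArg (extToHom hf)
          ((sheafificationAdjunction _ _).homEquiv_naturality_right b c)).trans
            (extToHom_comp hf _ c) }

include hf in
lemma injective_inverseImage (I : Shv k Y) [h : Injective I] :
    Injective ((inverseImage k f).obj I) :=
  have : (presheafToSheaf (Opens.grothendieckTopology Y)
    (ModuleCat.{u} k)).PreservesMonomorphisms := inferInstance
  have : (extFunctor k f ⋙ presheafToSheaf (Opens.grothendieckTopology Y)
    (ModuleCat.{u} k)).PreservesMonomorphisms := inferInstance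
  @Injective.injective_of_adjoint _ _ _ _ _ _ this (extAdj k hf) I h

end

end ExtensionByZero

section ConstantSheaves

variable {k : Type u} [Ring k] {X Y : TopCat.{u}}

/-- The constant section of the constant sheaf `M_X` over `V` given by an element of `M`. -/
def cst (X : TopCat.{u}) (M : ModuleCat.{u} k) (V : Opens X) :
    M →ₗ[k] sec ((constSheaf k X).obj M) V :=
  ((constEta M X).app (op V)).hom

lemma res_cst (M : ModuleCat.{u} k) {V W : Opens X} (h : V ≤ W) (m : M) :
    res _ h (cst X M W m) = cst X M V m :=
  constEta_map M (homOfLE h) m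

lemma cst_bijective (M : ModuleCat.{u} k) {U : Opens X} (hU : IsConnected (U : Set X)) :
    Function.Bijective (cst X M U) := by
  obtain ⟨x₀, hx₀⟩ := hU.nonempty
  refine ⟨fun s t h ↦ constEta_inj M hx₀ s t h, fun s ↦ ?_⟩
  have locally_cst := Presheaf.imageSieve_mem (Opens.grothendieckTopology X) (constEta M X)
    (U := op U) s
  choose V f hf hxV using fun x : U ↦ locally_cst x.1 x.2
  choose value hvalue using hf
  let c : U → M := value
  have cst_c (x : U) : cst X M (V x) (c x) = res ((constSheaf k X).obj M) (f x).le s := hvalue x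
  have c_locallyConstant : IsLocallyConstant c := by
    refine IsLocallyConstant.iff_exists_open _ |>.mpr fun x ↦
      ⟨Subtype.val ⁻¹' V x, (V x).isOpen.preimage continuous_subtype_val, hxV x, fun y hy ↦
        (constEta_inj M (V := V x ⊓ V y) (x := y) ⟨hy, hxV y⟩ _ _ ?_).symm⟩
    change cst X M _ _ = cst X M _ _
    rw [← res_cst M inf_le_left, ← res_cst M inf_le_right, cst_c, cst_c, res_res, res_res]
  have : PreconnectedSpace U := Subtype.preconnectedSpace hU.isPreconnected
  refine ⟨c ⟨x₀, hx₀⟩, sec_ext _ V (fun x ↦ (f x).le) (fun x hx ↦ ⟨⟨x, hx⟩, hxV _⟩) fun x ↦ ?_⟩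
  rw [res_cst, ← cst_c, c_locallyConstant.apply_eq_of_preconnectedSpace _ x]

lemma res_bijective_of_essImage {F : Shv k X} (hF : (constSheaf k X).essImage F) {U V : Opens X}
    (hU : IsConnected (U : Set X)) (hV : IsConnected (V : Set X)) (h : V ≤ U) :
    Function.Bijective (res F h) := by
  obtain ⟨M, ⟨e⟩⟩ := hF
  have cst_bij {O : Opens X} (hO : IsConnected (O : Set X)) :
      Function.Bijective (onSec e.hom O ∘ cst X M O) :=
    (onSec_bijective e.hom O).comp (cst_bijective M hO)
  refine (Function.Bijective.of_comp_iff _ (cst_bij hU)).mp ?_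
  convert cst_bij hV using 1
  ext m
  simp only [Function.comp_apply]
  rw [← onSec_res, res_cst]

/-- The canonical morphism to `F` from the constant sheaf of its global sections. -/
def constCounit (F : Shv k X) : (constSheaf k X).obj (sec F ⊤) ⟶ F :=
  (constSheafAdj k X).counit.app F

lemma onSec_constCounit_cst (F : Shv k X) (V : Opens X) (s : sec F ⊤) :
    onSec (constCounit F) V (cst X (sec F ⊤) V s) = res F le_top s := by
  have unit_eq (M : ModuleCat.{u} k) :
      (constSheafAdj k X).unit.app M = (constEta M X).app (op ⊤) :=
    (Adjunction.comp_unit_app _ _ _).trans (Category.id_comp _)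
  have onSec_top : onSec (constCounit F) ⊤ (cst X (sec F ⊤) ⊤ s) = s := by
    refine Eq.trans ?_
      (ConcreteCategory.congr_hom ((constSheafAdj k X).right_triangle_components F) s)
    rw [unit_eq]
    rfl
  rw [← res_cst _ le_top, onSec_res, onSec_top]

lemma essImage_of_basis {F : Shv k X} {ι : Type*} {B : ι → Opens X}
    (hB : Opens.IsBasis (Set.range B)) (hc : ∀ i, IsConnected (B i : Set X))
    (h : ∀ i, Function.Bijective (res F (le_top : B i ≤ ⊤))) :
    (constSheaf k X).essImage F := by
  have : IsIso (constCounit F) := isIso_of_bijective_basis hB _ fun i ↦ by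
    refine (Function.Bijective.of_comp_iff _ (cst_bijective (sec F ⊤) (hc i))).mp ?_
    convert h i using 1
    exact funext fun s ↦ onSec_constCounit_cst F _ s
  exact ⟨_, ⟨asIso (constCounit F)⟩⟩

lemma isBasis_isConnected (X : TopCat.{u}) [LocallyConnectedSpace X] : Opens.IsBasis
    (Set.range (Subtype.val : {V : Opens X // IsConnected (V : Set X)} → Opens X)) := by
  rw [Opens.isBasis_iff_nbhd]
  intro U x hx
  exact ⟨⟨connectedComponentIn U x, U.isOpen.connectedComponentIn⟩,
    ⟨⟨_, isConnected_connectedComponentIn_iff.mpr hx⟩, rfl⟩, mem_connectedComponentIn hx,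
    connectedComponentIn_subset _ _⟩

lemma res_inverseImage_bijective_iff {f : X ⟶ Y} (hf : IsOpenMap f) (F : Shv k Y)
    {V₁ V₂ : Opens X} {U₁ U₂ : Opens Y} (hV : V₁ ≤ V₂) (hU : U₁ ≤ U₂) (hinj : Set.InjOn f V₂)
    (h₁ : f '' V₁ = U₁) (h₂ : f '' V₂ = U₂) :
    Function.Bijective (res ((inverseImage k f).obj F) hV) ↔ Function.Bijective (res F hU) := by
  have hVU₁ : V₁ ≤ (Opens.map f).obj U₁ := fun x hx ↦ h₁.le ⟨x, hx, rfl⟩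
  have hVU₂ : V₂ ≤ (Opens.map f).obj U₂ := fun x hx ↦ h₂.le ⟨x, hx, rfl⟩
  have pull₁_bij := pull_bijective hf F (hinj.mono hV) h₁ hVU₁
  have pull₂_bij := pull_bijective hf F hinj h₂ hVU₂
  rw [← Function.Bijective.of_comp_iff _ pull₂_bij, ← Function.Bijective.of_comp_iff' pull₁_bij]
  have square : res _ hV ∘ pull f F hVU₂ = pull f F hVU₁ ∘ res F hU :=
    funext fun s ↦ (res_pull f F hVU₂ hV s).trans (pull_res f F hVU₁ hU s).symm
  rw [square]

lemma isConstOn_of_res_bijective [LocallyConnectedSpace X] {F : Shv k X} {W : Opens X}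
    (h : ∀ V : Opens X, IsConnected (V : Set X) → (hV : V ≤ W) → Function.Bijective (res F hV)) :
    isConstOn k W F := by
  have hW : IsOpenMap W.inclusion' := W.isOpenEmbedding.isOpenMap
  have : LocallyConnectedSpace ((Opens.toTopCat X).obj W) := W.isOpen.locallyConnectedSpace
  refine essImage_of_basis (isBasis_isConnected _) (fun V ↦ V.2) fun ⟨V, hV⟩ ↦ ?_
  have image_top : W.inclusion' '' (⊤ : Opens ((Opens.toTopCat X).obj W)) = W :=
    Set.image_univ.trans Subtype.range_coe
  have image_le : hW.functor.obj V ≤ W := by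
    rintro _ ⟨x, -, rfl⟩
    exact x.2
  exact (res_inverseImage_bijective_iff hW F le_top image_le Subtype.val_injective.injOn rfl
    image_top).mpr (h _ (hV.image _ W.inclusion'.hom.continuous.continuousOn) image_le)

lemma res_bijective_of_isConstOn {F : Shv k X} {W : Opens X} (hF : isConstOn k W F)
    {U V : Opens X} (hU : IsConnected (U : Set X)) (hV : IsConnected (V : Set X)) (h : V ≤ U)
    (hW : U ≤ W) : Function.Bijective (res F h) := by
  let f := W.inclusion'
  have image_preimage {O : Opens X} (hO : O ≤ W) : f '' ((Opens.map f).obj O) = O :=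
    Set.image_preimage_eq_of_subset fun x hx ↦ ⟨⟨x, hO hx⟩, rfl⟩
  have preimage_connected {O : Opens X} (hO : O ≤ W) (hc : IsConnected (O : Set X)) :
      IsConnected ((Opens.map f).obj O : Set ((Opens.toTopCat X).obj W)) := by
    obtain ⟨x, hx⟩ := hc.nonempty
    refine ⟨⟨⟨x, hO hx⟩, hx⟩, W.isOpenEmbedding.isInducing.isPreconnected_image.mp ?_⟩
    exact (image_preimage hO).symm ▸ hc.isPreconnected
  exact (res_inverseImage_bijective_iff W.isOpenEmbedding.isOpenMap F
    ((Opens.map f).map (homOfLE h)).le h Subtype.val_injective.injOn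
    (image_preimage (h.trans hW)) (image_preimage hW)).mp
      (res_bijective_of_essImage hF (preimage_connected hW hU)
        (preimage_connected (h.trans hW) hV) _)

end ConstantSheaves

section LocallyConstantSheaves

open Topology TopCat.Presheaf

variable {k : Type u} [Ring k] {Y : TopCat.{u}}

/-- The germ of a section at a point. -/
def germAt (S : Shv k Y) {U : Opens Y} {y : Y} (hy : y ∈ U) (s : sec S U) :
    ToType (TopCat.Presheaf.stalk S.1 y) :=
  TopCat.Presheaf.germ S.1 U y hy s

lemma germAt_res (S : Shv k Y) {U V : Opens Y} {y : Y} (hy : y ∈ V) (h : V ≤ U) (s : sec S U) :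
    germAt S hy (res S h s) = germAt S (h hy) s :=
  TopCat.Presheaf.germ_res_apply S.1 (homOfLE h) y hy s

lemma exists_res_eq_of_germAt_eq (S : Shv k Y) {U V : Opens Y} {y : Y} (hU : y ∈ U) (hV : y ∈ V)
    {s : sec S U} {t : sec S V} (h : germAt S hU s = germAt S hV t) :
    ∃ (W : Opens Y) (_ : y ∈ W) (h₁ : W ≤ U) (h₂ : W ≤ V), res S h₁ s = res S h₂ t := by
  obtain ⟨W, hy, i, j, e⟩ := TopCat.Presheaf.germ_eq S.1 y hU hV s t h
  exact ⟨W, hy, i.le, j.le, e⟩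

lemma exists_germAt_eq (S : Shv k Y) {y : Y} (g : ToType (TopCat.Presheaf.stalk S.1 y)) :
    ∃ (W : Opens Y) (hy : y ∈ W) (s : sec S W), germAt S hy s = g := by
  obtain ⟨W, hy, s, e⟩ := TopCat.Presheaf.exists_germ_eq S.1 g
  exact ⟨W, hy, s, e⟩

lemma sec_ext_germAt (S : Shv k Y) {U : Opens Y} {s t : sec S U}
    (h : ∀ y (hy : y ∈ U), germAt S hy s = germAt S hy t) : s = t := by
  choose W hW hWs hWt e using fun y : U ↦ exists_res_eq_of_germAt_eq S y.2 y.2 (h y.1 y.2)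
  exact sec_ext S W hWs (fun y hy ↦ ⟨⟨y, hy⟩, hW _⟩) e

lemma germAt_bijective [LocallyConnectedSpace Y] (S : Shv k Y) {U : Opens Y}
    (h : ∀ V : Opens Y, IsConnected (V : Set Y) → ∀ hV : V ≤ U, Function.Bijective (res S hV))
    {y : Y} (hy : y ∈ U) : Function.Bijective (germAt S hy) := by
  constructor
  · intro s t e
    obtain ⟨W, hyW, hWU, _, e⟩ := exists_res_eq_of_germAt_eq S hy hy e
    obtain ⟨⟨V, hV⟩, -, hVW⟩ := exists_le_of_isBasis (isBasis_isConnected Y) hyW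
    refine (h V hV (hVW.trans hWU)).1 ?_
    have := congrArg (res S hVW) e
    rwa [res_res, res_res] at this
  · intro g
    obtain ⟨W, hyW, s, rfl⟩ := exists_germAt_eq S g
    obtain ⟨⟨V, hV⟩, hyV, hVW⟩ := exists_le_of_isBasis (isBasis_isConnected Y)
      (show y ∈ W ⊓ U from ⟨hyW, hy⟩)
    obtain ⟨t, ht⟩ := (h V hV (hVW.trans inf_le_right)).2 (res S (hVW.trans inf_le_left) s)
    refine ⟨t, ?_⟩
    rw [← germAt_res S hyV (hVW.trans inf_le_right) t, ht, germAt_res]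

lemma germAt_top_injective [PreconnectedSpace Y] (S : Shv k Y)
    (h : ∀ y, ∃ U : Opens Y, y ∈ U ∧ ∀ z (hz : z ∈ U), Function.Injective (germAt S hz)) (y : Y) :
    Function.Injective (germAt S (Opens.mem_top y)) := by
  intro s t e
  let A : Set Y := {z | germAt S (Opens.mem_top z) s = germAt S (Opens.mem_top z) t}
  have germAt_eq_iff {U : Opens Y} {z : Y} (hz : z ∈ U) :
      germAt S hz (res S le_top s) = germAt S hz (res S le_top t) ↔ z ∈ A := by
    rw [germAt_res, germAt_res]
    rfl
  have isOpen_A : IsOpen A := isOpen_iff_forall_mem_open.mpr fun z hz ↦ by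
    obtain ⟨W, hzW, _, _, e⟩ := exists_res_eq_of_germAt_eq S _ _ hz
    exact ⟨W, fun a ha ↦ (germAt_eq_iff ha).mp (congrArg (germAt S ha) e), W.isOpen, hzW⟩
  have isOpen_compl_A : IsOpen Aᶜ := isOpen_iff_forall_mem_open.mpr fun z hz ↦ by
    obtain ⟨U, hzU, hU⟩ := h z
    refine ⟨U, fun a ha haA ↦ hz ((germAt_eq_iff hzU).mp ?_), U.isOpen, hzU⟩
    rw [hU a ha ((germAt_eq_iff ha).mpr haA)]
  have A_eq_univ : A = Set.univ := IsClopen.eq_univ ⟨⟨isOpen_compl_A⟩, isOpen_A⟩ ⟨y, e⟩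
  exact sec_ext_germAt S fun z _ ↦ (A_eq_univ ▸ Set.mem_univ z : z ∈ A)

lemma exists_sec_of_continuous_section (S : Shv k Y) {σ : Y → EtaleSpace S.1} (hσ : Continuous σ)
    (hσ_base : ∀ y, (σ y).base = y) :
    ∃ t : sec S ⊤, ∀ y, σ y = ⟨y, germAt S (Opens.mem_top y) t⟩ := by
  have eq_mk {U : Opens Y} {s : sec S U} {e : EtaleSpace S.1} {y : Y} (he : e.base ∈ U)
      (h : e.germ = germAt S he s) (hy : e.base = y) : ∃ hy : y ∈ U, e = ⟨y, germAt S hy s⟩ := by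
    obtain ⟨base, g⟩ := e
    obtain rfl : base = y := hy
    exact ⟨he, congrArg (EtaleSpace.mk base) h⟩
  have locally_germ (y : Y) : ∃ (W : Opens Y) (_ : y ∈ W) (s : sec S W), ∀ z (hz : z ∈ W),
      σ z = ⟨z, germAt S hz s⟩ := by
    obtain ⟨U, hyU, s, hs⟩ := EtaleSpace.exists_section_of_tendsto (hσ.tendsto y)
    obtain ⟨V, hV, hVo, hyV⟩ := mem_nhds_iff.mp hs
    rw [hσ_base] at hyU
    refine ⟨⟨V, hVo⟩ ⊓ U, ⟨hyV, hyU⟩, res S inf_le_right s, fun z hz ↦ ?_⟩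
    obtain ⟨hzU, hzs⟩ := hV hz.1
    obtain ⟨_, σz⟩ := eq_mk hzU hzs (hσ_base z)
    exact σz.trans (congrArg (EtaleSpace.mk z) (germAt_res S hz inf_le_right s).symm)
  choose W hW s hs using locally_germ
  obtain ⟨t, ht⟩ := exists_glue S W (fun _ ↦ le_top) (fun z _ ↦ ⟨z, hW z⟩) s fun i j ↦ by
    refine sec_ext_germAt S fun z hz ↦ ?_
    have := (hs i z hz.1).symm.trans (hs j z hz.2)
    rw [EtaleSpace.mk.injEq] at this
    rw [germAt_res, germAt_res]
    exact eq_of_heq this.2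
  exact ⟨t, fun y ↦ by rw [hs y y (hW y), ← ht, germAt_res]⟩

-- A germ is a point of the étale space, which is a covering of `Y` and hence has a section through
-- that point.
lemma germAt_top_bijective (hY : IsSimplyConnected Y) (S : Shv k Y)
    (h : ∀ y, ∃ U : Opens Y, y ∈ U ∧ ∀ z (hz : z ∈ U), Function.Bijective (germAt S hz)) (y : Y) :
    Function.Bijective (germAt S (Opens.mem_top y)) := by
  have := hY.connected
  refine ⟨germAt_top_injective S (fun y ↦ ?_) y, fun g ↦ ?_⟩
  · obtain ⟨U, hyU, hU⟩ := h y
    exact ⟨U, hyU, fun z hz ↦ (hU z hz).1⟩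
  · obtain ⟨σ, hσ, hσ_base, hσy⟩ :=
      hY.exists_section (EtaleSpace.isCoveringMap_base h) (⟨y, g⟩ : EtaleSpace S.1)
    obtain ⟨t, ht⟩ := exists_sec_of_continuous_section S hσ hσ_base
    have := (ht y).symm.trans hσy
    rw [EtaleSpace.mk.injEq] at this
    exact ⟨t, eq_of_heq this.2⟩

lemma essImage_of_isQuasicoherent [LocallyConnectedSpace Y] (hY : IsSimplyConnected Y)
    {S : Shv k Y} (hS : isQuasicoherent k Y S) : (constSheaf k Y).essImage S := by
  let B : {V : Opens Y // IsConnected (V : Set Y) ∧ isConstOn k V S} → Opens Y := Subtype.val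
  have hB : Opens.IsBasis (Set.range B) := by
    rw [Opens.isBasis_iff_nbhd]
    intro O y hy
    obtain ⟨U, hyU, hU⟩ := exists_isConstOn k hS y
    obtain ⟨⟨V, hV⟩, hyV, hVO⟩ := exists_le_of_isBasis (isBasis_isConnected Y)
      (show y ∈ O ⊓ U from ⟨hy, hyU⟩)
    exact ⟨V, ⟨⟨V, hV, hU V (hVO.trans inf_le_right) hV⟩, rfl⟩, hyV, hVO.trans inf_le_left⟩
  have germAt_bij (V) {y : Y} (hy : y ∈ B V) : Function.Bijective (germAt S hy) :=
    germAt_bijective S (fun _ hW h ↦ res_bijective_of_isConstOn V.2.2 V.2.1 hW h le_rfl) hy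
  refine essImage_of_basis hB (fun V ↦ V.2.1) fun V ↦ ?_
  obtain ⟨y, hy⟩ := V.2.1.nonempty
  rw [← Function.Bijective.of_comp_iff' (germAt_bij V hy)]
  convert germAt_top_bijective hY S (fun y ↦ ?_) y using 1
  · exact funext fun s ↦ germAt_res S hy le_top s
  · obtain ⟨V, hyV, -⟩ := exists_le_of_isBasis hB (Opens.mem_top y)
    exact ⟨B V, hyV, fun z hz ↦ germAt_bij V hz⟩

end LocallyConstantSheaves

section Pullback

variable {k : Type u} [Ring k] {X X' : TopCat.{u}} {φ : X' ⟶ X}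

lemma isConstOn_inverseImage (f : X' ⟶ X) {L : Shv k X} {U : Opens X} (hL : isConstOn k U L) :
    isConstOn k ((Opens.map f).obj U) ((inverseImage k f).obj L) := by
  let fU : (Opens.toTopCat X').obj ((Opens.map f).obj U) ⟶ (Opens.toTopCat X).obj U :=
    TopCat.ofHom ⟨fun x ↦ ⟨f x.1, x.2⟩, by fun_prop⟩
  have square : fU ≫ U.inclusion' = ((Opens.map f).obj U).inclusion' ≫ f := rfl
  let e : (inverseImage k fU).obj ((restrict k U).obj L) ≅
      (restrict k ((Opens.map f).obj U)).obj ((inverseImage k f).obj L) :=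
    (inverseImageComp k square).app L ≪≫ ((inverseImageComp k rfl).app L).symm
  exact ObjectProperty.prop_of_iso (constSheaf k _).essImage e (isConst_pull k fU hL)

lemma isQuasicoherent_inverseImage [LocallyConnectedSpace X] (f : X' ⟶ X) {L : Shv k X}
    (hL : isQuasicoherent k X L) : isQuasicoherent k X' ((inverseImage k f).obj L) :=
  isQuasicoherent_of_isConstOn k fun y ↦ by
    obtain ⟨U, hyU, hU⟩ := exists_isConstOn k hL (f y)
    obtain ⟨⟨V, hV⟩, hyV, hVU⟩ := exists_le_of_isBasis (isBasis_isConnected X) hyU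
    exact ⟨(Opens.map f).obj V, hyV, isConstOn_inverseImage f (hU V hVU hV)⟩

lemma essImage_inverseImage_of_isQuasicoherent [LocallyConnectedSpace X]
    (hφ : IsUniversalCovering φ) {L : Shv k X} (hL : isQuasicoherent k X L) :
    (constSheaf k X').essImage ((inverseImage k φ).obj L) :=
  have := locallyConnectedSpace_of_isLocalHomeomorph hφ.isCoveringMap.isLocalHomeomorph
  essImage_of_isQuasicoherent hφ.isSimplyConnected (isQuasicoherent_inverseImage φ hL)

lemma res_inverseImage_bijective [LocallyConnectedSpace X] (hφ : IsUniversalCovering φ)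
    {L : Shv k X} (hL : isQuasicoherent k X L) {V : Opens X'} (hV : IsConnected (V : Set X')) :
    Function.Bijective (res ((inverseImage k φ).obj L) (le_top : V ≤ ⊤)) :=
  have := hφ.isSimplyConnected.connected
  res_bijective_of_essImage (essImage_inverseImage_of_isQuasicoherent hφ hL)
    (connectedSpace_iff_univ.mp this) hV _

end Pullback

section DeckAction

variable {k : Type u} [Ring k] {X X' : TopCat.{u}} {φ : X' ⟶ X}

lemma le_deckMap_top (g : deckGroup φ) (W : Opens X') : W ≤ (Opens.map (deckMap g)).obj ⊤ :=
  fun _ _ ↦ Opens.mem_top _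

/-- The pullback of sections of `φ⁻¹F` along a deck transformation. -/
def deckPull (g : deckGroup φ) (F : Shv k X) {V W : Opens X'}
    (h : W ≤ (Opens.map (deckMap g)).obj V) :
    sec ((inverseImage k φ).obj F) V →ₗ[k] sec ((inverseImage k φ).obj F) W :=
  onSec ((deckIso k g).hom.app F) W ∘ₗ pull (deckMap g) ((inverseImage k φ).obj F) h

lemma res_deckPull (g : deckGroup φ) (F : Shv k X) {V W W' : Opens X'}
    (h : W ≤ (Opens.map (deckMap g)).obj V) (i : W' ≤ W) (s) :
    res _ i (deckPull g F h s) = deckPull g F (i.trans h) s :=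
  (onSec_res ((deckIso k g).hom.app F) i _).symm.trans (congrArg _ (res_pull _ _ _ _ _))

lemma deckPull_res (g : deckGroup φ) (F : Shv k X) {V V' W : Opens X'}
    (h : W ≤ (Opens.map (deckMap g)).obj V') (i : V' ≤ V) (s) :
    deckPull g F h (res _ i s) =
      deckPull g F (h.trans ((Opens.map (deckMap g)).map (homOfLE i)).le) s :=
  congrArg (onSec ((deckIso k g).hom.app F) W) (pull_res _ _ _ _ _)

lemma deckPull_pull (g : deckGroup φ) (F : Shv k X) {U : Opens X} {V W : Opens X'}
    (h : W ≤ (Opens.map (deckMap g)).obj V) (hV : V ≤ (Opens.map φ).obj U)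
    (hW : W ≤ (Opens.map φ).obj U) (s : sec F U) :
    deckPull g F h (pull φ F hV s) = pull φ F hW s :=
  inverseImageComp_pull (deckMap_comp g) F hV h hW s

lemma sectionsRep_ρ (F : Shv k X) (g : deckGroup φ) (s : sec ((inverseImage k φ).obj F) ⊤) :
    ((sectionsRep k φ).obj F).ρ g s = deckPull g⁻¹ F (le_deckMap_top g⁻¹ ⊤) s :=
  congrArg (onSec ((deckIso k g⁻¹).hom.app F) ⊤) (pull_top (deckMap g⁻¹) _ s).symm

/-- The linear map underlying a morphism between representations on sections. -/
def repHomSec {F F' : Shv k X} (h : (sectionsRep k φ).obj F ⟶ (sectionsRep k φ).obj F') :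
    sec ((inverseImage k φ).obj F) ⊤ →ₗ[k] sec ((inverseImage k φ).obj F') ⊤ :=
  h.hom.toLinearMap

lemma repHomSec_deckPull {F F' : Shv k X} (h : (sectionsRep k φ).obj F ⟶ (sectionsRep k φ).obj F')
    (g : deckGroup φ) (s) : repHomSec h (deckPull g F (le_deckMap_top g ⊤) s) =
      deckPull g F' (le_deckMap_top g ⊤) (repHomSec h s) := by
  have ρ_inv_F := sectionsRep_ρ F g⁻¹ s
  have ρ_inv_F' := sectionsRep_ρ F' g⁻¹ (repHomSec h s)
  rw [inv_inv] at ρ_inv_F ρ_inv_F'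
  rw [← ρ_inv_F, ← ρ_inv_F']
  exact Rep.hom_comm_apply h g⁻¹ s

end DeckAction

section Homs

variable {k : Type u} [Ring k] {X X' : TopCat.{u}} {φ : X' ⟶ X}

lemma isBasis_image_isSheet [LocallyConnectedSpace X] (hφ : IsLocalHomeomorph φ)
    (hsurj : Function.Surjective φ) : Opens.IsBasis
      (Set.range (fun V : {V : Opens X' // IsSheet φ V} ↦ hφ.isOpenMap.functor.obj V.1)) := by
  rw [Opens.isBasis_iff_nbhd]
  intro U x hx
  obtain ⟨y, rfl⟩ := hsurj x
  obtain ⟨V, hyV, hVU, hV⟩ := exists_isSheet hφ (O := (Opens.map φ).obj U) hx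
  exact ⟨_, ⟨⟨V, hV⟩, rfl⟩, ⟨y, hyV, rfl⟩, Set.image_subset_iff.mpr hVU⟩

lemma le_map_functor (hφ : IsOpenMap φ) (V : Opens X') :
    V ≤ (Opens.map φ).obj (hφ.functor.obj V) := fun x hx ↦ ⟨x, hx, rfl⟩

/-- The identification of the sections of `F` over the image of an open subset `V` on which `φ` is
injective with the sections of `φ⁻¹F` over `V`. -/
def sheetEquiv (hφ : IsOpenMap φ) (F : Shv k X) {V : Opens X'} (hV : Set.InjOn φ V) :
    sec F (hφ.functor.obj V) ≃ₗ[k] sec ((inverseImage k φ).obj F) V :=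
  LinearEquiv.ofBijective (pull φ F (le_map_functor hφ V)) (pull_bijective hφ F hV rfl _)

lemma pull_sheetEquiv_symm (hφ : IsOpenMap φ) (F : Shv k X) {V : Opens X'} (hV : Set.InjOn φ V)
    (s : sec ((inverseImage k φ).obj F) V) :
    pull φ F (le_map_functor hφ V) ((sheetEquiv hφ F hV).symm s) = s :=
  (sheetEquiv hφ F hV).apply_symm_apply s

variable [LocallyConnectedSpace X] (hφ : IsUniversalCovering φ)
  {L : Shv k X} (hL : isQuasicoherent k X L) {A : Shv k X}

include hφ hL in
lemma sectionsRep_map_injective [PreconnectedSpace X] {a b : L ⟶ A}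
    (h : (sectionsRep k φ).map a = (sectionsRep k φ).map b) : a = b := by
  have := hφ.isSimplyConnected.connected
  have hl := hφ.isCoveringMap.isLocalHomeomorph
  refine hom_ext_basis (isBasis_image_isSheet hl (isCoveringMap_surjective hφ.isCoveringMap))
    fun ⟨V, hV⟩ s ↦ (sheetEquiv hl.isOpenMap A hV.injOn).injective ?_
  obtain ⟨t, ht⟩ := (res_inverseImage_bijective hφ hL hV.isConnected).2
    (pull φ L (le_map_functor hl.isOpenMap V) s)
  have pull_onSec (c : L ⟶ A) : pull φ A (le_map_functor hl.isOpenMap V) (onSec c _ s) =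
      res _ le_top (onSec ((inverseImage k φ).map c) ⊤ t) := by
    rw [← onSec_pull, ← ht, onSec_res]
  refine (pull_onSec a).trans (Eq.trans ?_ (pull_onSec b).symm)
  exact congrArg (fun c ↦ res ((inverseImage k φ).obj A) (le_top : V ≤ ⊤) (repHomSec c t)) h

/-- The map that a morphism `ΓL ⟶ ΓA` of representations induces on sections over the image of a
sheet `V`: a section of `L` over the image extends uniquely from `V` to a global section of the
constant sheaf `φ⁻¹L`. -/
def sheetHom (h : (sectionsRep k φ).obj L ⟶ (sectionsRep k φ).obj A) {V : Opens X'}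
    (hV : IsSheet φ V) : sec L (hφ.isCoveringMap.isOpenMap.functor.obj V) →ₗ[k]
      sec A (hφ.isCoveringMap.isOpenMap.functor.obj V) :=
  (sheetEquiv hφ.isCoveringMap.isOpenMap A hV.injOn).symm.toLinearMap ∘ₗ res _ le_top ∘ₗ
    repHomSec h ∘ₗ
      (LinearEquiv.ofBijective _
        (res_inverseImage_bijective hφ hL hV.isConnected)).symm.toLinearMap ∘ₗ
          pull φ L (le_map_functor hφ.isCoveringMap.isOpenMap V)

lemma pull_sheetHom (h : (sectionsRep k φ).obj L ⟶ (sectionsRep k φ).obj A) {V : Opens X'}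
    (hV : IsSheet φ V) {s : sec L (hφ.isCoveringMap.isOpenMap.functor.obj V)}
    {t : sec ((inverseImage k φ).obj L) ⊤}
    (ht : res _ le_top t = pull φ L (le_map_functor hφ.isCoveringMap.isOpenMap V) s) :
    pull φ A (le_map_functor hφ.isCoveringMap.isOpenMap V) (sheetHom hφ hL h hV s) =
      res _ le_top (repHomSec h t) := by
  refine (pull_sheetEquiv_symm hφ.isCoveringMap.isOpenMap A hV.injOn _).trans ?_
  have extend_s : (LinearEquiv.ofBijective _
      (res_inverseImage_bijective hφ hL hV.isConnected)).symm
        (pull φ L (le_map_functor hφ.isCoveringMap.isOpenMap V) s) = t := by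
    rw [← ht]
    exact LinearEquiv.symm_apply_apply _ t
  exact congrArg (fun t ↦ res ((inverseImage k φ).obj A) (le_top : V ≤ ⊤) (repHomSec h t)) extend_s

-- Two sheets over the same open subset differ by a deck transformation, so equivariance is what
-- makes the maps on different sheets agree.
lemma sheetHom_res (h : (sectionsRep k φ).obj L ⟶ (sectionsRep k φ).obj A) {V V' : Opens X'}
    (hV : IsSheet φ V) (hV' : IsSheet φ V')
    (i : hφ.isCoveringMap.isOpenMap.functor.obj V' ≤ hφ.isCoveringMap.isOpenMap.functor.obj V)
    (s : sec L (hφ.isCoveringMap.isOpenMap.functor.obj V)) :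
    sheetHom hφ hL h hV' (res L i s) = res A i (sheetHom hφ hL h hV s) := by
  have ho := hφ.isCoveringMap.isOpenMap
  obtain ⟨g, hg⟩ := exists_deck_mapsTo hφ hV'.isConnected i hV.injOn
  have hgV : V' ≤ (Opens.map (deckMap g)).obj V := hg
  have hV'V : V' ≤ (Opens.map φ).obj (ho.functor.obj V) := fun x hx ↦ i ⟨x, hx, rfl⟩
  obtain ⟨t, ht⟩ := (res_inverseImage_bijective hφ hL hV.isConnected).2
    (pull φ L (le_map_functor ho V) s)
  have res_deckPull_t : res _ le_top (deckPull g L (le_deckMap_top g ⊤) t) =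
      pull φ L (le_map_functor ho V') (res L i s) := by
    rw [res_deckPull, ← deckPull_res g L hgV le_top t, ht, pull_res,
      deckPull_pull g L hgV (le_map_functor ho V)]
  refine (sheetEquiv ho A hV'.injOn).injective
    ((pull_sheetHom hφ hL h hV' res_deckPull_t).trans ?_)
  rw [repHomSec_deckPull, res_deckPull, ← deckPull_res g A hgV le_top,
    ← pull_sheetHom hφ hL h hV ht]
  exact (deckPull_pull g A hgV _ hV'V _).trans (pull_res φ A _ i _).symm

include hφ hL in
lemma sectionsRep_map_surjective [PreconnectedSpace X]
    (h : (sectionsRep k φ).obj L ⟶ (sectionsRep k φ).obj A) :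
    ∃ a : L ⟶ A, (sectionsRep k φ).map a = h := by
  have := hφ.isSimplyConnected.connected
  have hl := hφ.isCoveringMap.isLocalHomeomorph
  have hB := isBasis_image_isSheet hl (isCoveringMap_surjective hφ.isCoveringMap)
  let a : L ⟶ A := homOfBasis hB (fun V ↦ sheetHom hφ hL h V.2)
    fun V V' i s ↦ sheetHom_res hφ hL h V.2 V'.2 i s
  have onSec_a (t : sec ((inverseImage k φ).obj L) ⊤) :
      onSec ((inverseImage k φ).map a) ⊤ t = repHomSec h t := by
    refine sec_ext_basis _ (isBasis_isSheet hl) fun V hV ↦ ?_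
    obtain ⟨s, hs⟩ := (sheetEquiv hl.isOpenMap L V.2.injOn).surjective (res _ le_top t)
    replace hs : pull φ L (le_map_functor hl.isOpenMap V.1) s = res _ le_top t := hs
    rw [← onSec_res, ← hs, onSec_pull, ← pull_sheetHom hφ hL h V.2 hs.symm]
    exact congrArg _ (homOfBasis_onSec hB _ _ V s)
  exact ⟨a, Rep.hom_ext (by ext t; exact onSec_a t)⟩

end Homs

/-- An equivariant linear equivalence as an isomorphism of representations. -/
def repIso {k : Type u} [Ring k] {G : Type u} [Group G] {A B : Rep.{u} k G} (e : A ≃ₗ[k] B)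
    (h : ∀ g x, e (A.ρ g x) = B.ρ g (e x)) : A ≅ B :=
  Rep.mkIso (Representation.Equiv.mk e fun g ↦ LinearMap.ext (h g))

section LocalSystem

variable {k : Type u} [Ring k] {X X' : TopCat.{u}} {φ : X' ⟶ X} (M : Rep.{u} k (deckGroup φ))

lemma deck_mem {U : Opens X} (g : deckGroup φ) {y : X'} (hy : y ∈ (Opens.map φ).obj U) :
    g.1 y ∈ (Opens.map φ).obj U := by
  change φ (g.1 y) ∈ U
  rw [g.2 y]
  exact hy

/-- The sections over `U` of the local system associated to a representation `M`: the equivariant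
locally constant functions from `φ⁻¹(U)` to `M`. -/
def localSystemSections (U : Opens X) : Submodule k ((Opens.map φ).obj U → M) where
  carrier := {f | IsLocallyConstant f ∧
    ∀ (g : deckGroup φ) (y : (Opens.map φ).obj U), f ⟨g.1 y.1, deck_mem g y.2⟩ = M.ρ g (f y)}
  zero_mem' := ⟨IsLocallyConstant.const 0, fun _ _ ↦ (map_zero _).symm⟩
  add_mem' ha hb := ⟨ha.1.add hb.1, fun g y ↦ by
    rw [Pi.add_apply, Pi.add_apply, map_add, ha.2, hb.2]⟩
  smul_mem' c f hf := ⟨hf.1.comp (c • ·), fun g y ↦ by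
    rw [Pi.smul_apply, Pi.smul_apply, map_smul, hf.2]⟩

/-- The restriction of sections of the local system associated to a representation. -/
def localSystemRes {U V : Opens X} (h : V ≤ U) :
    localSystemSections M U →ₗ[k] localSystemSections M V where
  toFun f := ⟨fun y ↦ f.1 ⟨y.1, h y.2⟩,
    f.2.1.comp_continuous (f := fun y : (Opens.map φ).obj V ↦
      (⟨y.1, h y.2⟩ : (Opens.map φ).obj U)) (by fun_prop), fun g y ↦ f.2.2 g ⟨y.1, h y.2⟩⟩
  map_add' _ _ := rfl
  map_smul' _ _ := rfl

/-- The presheaf of sections of the local system associated to a representation. -/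
def localSystemPresheaf : TopCat.Presheaf (ModuleCat.{u} k) X where
  obj U := ModuleCat.of k (localSystemSections M U.unop)
  map i := ModuleCat.ofHom (localSystemRes M i.unop.le)
  map_id _ := rfl
  map_comp _ _ := rfl

lemma localSystemPresheaf_isSheaf : (localSystemPresheaf M).IsSheaf := by
  have : (forget (ModuleCat.{u} k)).ReflectsIsomorphisms := inferInstance
  refine (TopCat.Presheaf.isSheaf_iff_isSheafUniqueGluing _).mpr fun ι U sf hsf ↦ ?_
  let f (i : ι) : localSystemSections M (U i) := sf i
  have compatible (i j : ι) (y : X') (hi : φ y ∈ U i) (hj : φ y ∈ U j) :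
      (f i).1 ⟨y, hi⟩ = (f j).1 ⟨y, hj⟩ :=
    congrFun (congrArg Subtype.val (hsf i j)) ⟨y, hi, hj⟩
  have covers (y : (Opens.map φ).obj (iSup U)) : ∃ i, φ y.1 ∈ U i := Opens.mem_iSup.mp y.2
  choose n hn using covers
  let s : (Opens.map φ).obj (iSup U) → M := fun y ↦ (f (n y)).1 ⟨y.1, hn y⟩
  have s_eq (i : ι) (y : X') (hi : φ y ∈ U i) (h) : s ⟨y, h⟩ = (f i).1 ⟨y, hi⟩ :=
    compatible _ _ _ _ _
  have isLocallyConstant_s : IsLocallyConstant s := by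
    rw [IsLocallyConstant.iff_exists_open]
    intro y
    obtain ⟨_, hO', hyO, h⟩ := (IsLocallyConstant.iff_exists_open _).mp (f (n y)).2.1 ⟨y.1, hn y⟩
    obtain ⟨O, hO, rfl⟩ := isOpen_induced_iff.mp hO'
    exact ⟨Subtype.val ⁻¹' (O ∩ (Opens.map φ).obj (U (n y))),
      (hO.inter ((Opens.map φ).obj _).isOpen).preimage continuous_subtype_val, ⟨hyO, hn y⟩,
      fun z hz ↦ (s_eq (n y) z.1 hz.2 z.2).trans (h ⟨z.1, hz.2⟩ hz.1)⟩
  have equivariant_s (g : deckGroup φ) (y : (Opens.map φ).obj (iSup U)) :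
      s ⟨g.1 y.1, deck_mem g y.2⟩ = M.ρ g (s y) :=
    (s_eq (n y) _ (deck_mem g (hn y)) _).trans ((f (n y)).2.2 g ⟨y.1, hn y⟩)
  exact ⟨⟨s, isLocallyConstant_s, equivariant_s⟩,
    fun i ↦ Subtype.ext (funext fun y ↦ s_eq i y.1 y.2 _),
    fun t ht ↦ Subtype.ext (funext fun y ↦
      congrFun (congrArg Subtype.val (ht (n y))) ⟨y.1, hn y⟩)⟩

/-- The local system associated to a representation of the group of deck transformations. -/
def localSystem : Shv k X := ⟨localSystemPresheaf M, localSystemPresheaf_isSheaf M⟩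

/-- The evaluation at a point of `φ⁻¹(U)` of a section over `U` of the local system associated to a
representation. -/
def evalAt {U : Opens X} (y : X') (hy : φ y ∈ U) : sec (localSystem M) U →ₗ[k] M :=
  (LinearMap.proj (R := k) (φ := fun _ ↦ M) ⟨y, hy⟩) ∘ₗ (localSystemSections M U).subtype

lemma evalAt_deck {U : Opens X} (g : deckGroup φ) (y : X') (hy : φ y ∈ U)
    (s : sec (localSystem M) U) : evalAt M (g.1 y) (deck_mem g hy) s = M.ρ g (evalAt M y hy s) :=
  s.2.2 g ⟨y, hy⟩

lemma evalAt_ext {U : Opens X} {s t : sec (localSystem M) U}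
    (h : ∀ y (hy : φ y ∈ U), evalAt M y hy s = evalAt M y hy t) : s = t :=
  Subtype.ext (funext fun y ↦ h y.1 y.2)

lemma isLocallyConstant_evalAt {U : Opens X} (s : sec (localSystem M) U) :
    IsLocallyConstant (fun y : (Opens.map φ).obj U ↦ evalAt M y.1 y.2 s) := s.2.1

variable {M} in
lemma evalAt_eq_zero_of_map_eq (hφ : IsUniversalCovering φ) {U : Opens X}
    {s : sec (localSystem M) U} {y z : X'} {hy : φ y ∈ U} (hz : φ z ∈ U) (h : φ y = φ z)
    (hs : evalAt M y hy s = 0) : evalAt M z hz s = 0 := by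
  obtain ⟨g, rfl⟩ := exists_deck hφ h
  exact (evalAt_deck M g y hy s).trans (by rw [hs, map_zero])

-- The image in `U` of the zero locus of a section and its complement are open: vanishing only
-- depends on the image in `U`.
lemma evalAt_injective [PreconnectedSpace X] (hφ : IsUniversalCovering φ) {U : Opens X}
    (hU : IsConnected (U : Set X)) (y : X') (hy : φ y ∈ U) :
    Function.Injective (evalAt M y hy) := by
  have := hφ.isSimplyConnected.connected
  rw [injective_iff_map_eq_zero]
  intro s hs
  let values (A : Set M) : Set X :=
    φ '' (Subtype.val '' {z : (Opens.map φ).obj U | evalAt M z.1 z.2 s ∈ A})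
  have isOpen_values (A : Set M) : IsOpen (values A) :=
    hφ.isCoveringMap.isOpenMap _ (((Opens.map φ).obj U).isOpen.isOpenMap_subtype_val _
      (isLocallyConstant_evalAt M s A))
  have disjoint_values : Disjoint (values {0}) (values {0}ᶜ) := by
    rw [Set.disjoint_left]
    rintro _ ⟨_, ⟨⟨z, _⟩, hsz, rfl⟩, rfl⟩ ⟨_, ⟨⟨w, hw⟩, hsw, rfl⟩, hwz⟩
    exact hsw (evalAt_eq_zero_of_map_eq hφ hw hwz.symm hsz)
  have values_cover : (U : Set X) ⊆ values {0} ∪ values {0}ᶜ := by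
    intro x hx
    obtain ⟨z, rfl⟩ := isCoveringMap_surjective hφ.isCoveringMap x
    by_cases hsz : evalAt M z hx s = 0
    · exact Or.inl ⟨z, ⟨⟨z, hx⟩, hsz, rfl⟩, rfl⟩
    · exact Or.inr ⟨z, ⟨⟨z, hx⟩, hsz, rfl⟩, rfl⟩
  have subset_values : (U : Set X) ⊆ values {0} :=
    hU.isPreconnected.subset_left_of_subset_union (isOpen_values _) (isOpen_values _)
      disjoint_values values_cover ⟨φ y, hy, y, ⟨⟨y, hy⟩, hs, rfl⟩, rfl⟩
  refine evalAt_ext M fun w hw ↦ ?_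
  obtain ⟨_, ⟨z, hsz, rfl⟩, hzw⟩ := subset_values hw
  rw [map_zero]
  exact evalAt_eq_zero_of_map_eq hφ hw hzw hsz

lemma deck_eq_of_injOn (hφ : IsUniversalCovering φ) {V : Set X'} (hV : Set.InjOn φ V)
    {g h : deckGroup φ} {y z : X'} (hy : y ∈ V) (hz : z ∈ V) (e : g.1 y = h.1 z) : g = h := by
  have := hφ.isSimplyConnected.connected
  obtain rfl : y = z := hV hy hz (by rw [← g.2 y, e, h.2])
  exact deck_ext hφ.isCoveringMap e

-- The translates of `V` by deck transformations cover `φ⁻¹(U)` and are disjoint, so there is a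
-- unique equivariant function on `φ⁻¹(U)` that is constant on `V` with value `m`.
lemma evalAt_surjective (hφ : IsUniversalCovering φ) {U : Opens X} {V : Opens X'}
    (hV : Set.InjOn φ V) (hVU : φ '' V = U) {y : X'} (hyV : y ∈ V) (hy : φ y ∈ U) :
    Function.Surjective (evalAt M y hy) := by
  intro m
  have exists_translate (z : (Opens.map φ).obj U) :
      ∃ g : deckGroup φ, ∃ y' ∈ V, g.1 y' = z.1 := by
    obtain ⟨y', hy', e⟩ : φ z.1 ∈ φ '' V := hVU ▸ z.2
    obtain ⟨g, hg⟩ := exists_deck hφ e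
    exact ⟨g, y', hy', hg⟩
  choose c v hv hc using exists_translate
  have c_eq (g : deckGroup φ) {y' : X'} (hy' : y' ∈ V) (z) (e : g.1 y' = z.1) : c z = g :=
    deck_eq_of_injOn hφ hV (hv z) hy' ((hc z).trans e.symm)
  have isLocallyConstant_c : IsLocallyConstant fun z ↦ M.ρ (c z) m := by
    rw [IsLocallyConstant.iff_exists_open]
    refine fun z ↦ ⟨{w | (c z).1.symm w.1 ∈ V}, V.isOpen.preimage
      ((c z).1.symm.continuous.comp continuous_subtype_val), ?_, fun w hw ↦ ?_⟩
    · rw [Set.mem_ofPred_eq, ← hc z, Homeomorph.symm_apply_apply]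
      exact hv z
    · rw [c_eq (c z) hw w ((c z).1.apply_symm_apply _)]
  have c_deck (g : deckGroup φ) (z : (Opens.map φ).obj U) :
      c ⟨g.1 z.1, deck_mem g z.2⟩ = g * c z :=
    c_eq _ (hv z) _ (congrArg g.1 (hc z))
  refine ⟨⟨fun z ↦ M.ρ (c z) m, isLocallyConstant_c, fun g z ↦ ?_⟩, ?_⟩
  · exact (congrArg (M.ρ · m) (c_deck g z)).trans (by rw [map_mul]; rfl)
  · change M.ρ (c ⟨y, hy⟩) m = m
    rw [c_eq 1 hyV ⟨y, hy⟩ rfl, map_one]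
    rfl

lemma evalAt_bijective [PreconnectedSpace X] (hφ : IsUniversalCovering φ) {U : Opens X}
    (hU : IsConnected (U : Set X)) {V : Opens X'} (hV : Set.InjOn φ V) (hVU : φ '' V = U) {y : X'}
    (hyV : y ∈ V) (hy : φ y ∈ U) : Function.Bijective (evalAt M y hy) :=
  ⟨evalAt_injective M hφ hU y hy, evalAt_surjective M hφ hV hVU hyV hy⟩

lemma isQuasicoherent_localSystem [PreconnectedSpace X] [LocallyConnectedSpace X]
    (hφ : IsUniversalCovering φ) : isQuasicoherent k X (localSystem M) := by
  have := hφ.isSimplyConnected.connected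
  have ho := hφ.isCoveringMap.isOpenMap
  refine isQuasicoherent_of_isConstOn k fun x ↦ ?_
  obtain ⟨y, rfl⟩ := isCoveringMap_surjective hφ.isCoveringMap x
  obtain ⟨V, hyV, -, hV⟩ := exists_isSheet hφ.isCoveringMap.isLocalHomeomorph (Opens.mem_top y)
  have isConnected_image : IsConnected (ho.functor.obj V : Set X) :=
    hV.isConnected.image _ φ.hom.continuous.continuousOn
  refine ⟨ho.functor.obj V, ⟨y, hyV, rfl⟩, isConstOn_of_res_bijective fun U hU hUV ↦ ?_⟩
  obtain ⟨_, hx⟩ := hU.nonempty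
  obtain ⟨z, hz, rfl⟩ := hUV hx
  have image_inter : φ '' (V ⊓ (Opens.map φ).obj U : Opens X') = U :=
    (Set.image_inter_preimage _ _ _).trans (Set.inter_eq_self_of_subset_right hUV)
  have evalAt_U : Function.Bijective (evalAt M z hx) :=
    evalAt_bijective M hφ hU (hV.injOn.mono Set.inter_subset_left) image_inter ⟨hz, hx⟩ hx
  have evalAt_V : Function.Bijective (evalAt M z (hUV hx)) :=
    evalAt_bijective M hφ isConnected_image hV.injOn rfl hz (hUV hx)
  exact (Function.Bijective.of_comp_iff' evalAt_U _).mp evalAt_V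

section Fiber

variable [LocallyConnectedSpace X] (hφ : IsLocalHomeomorph φ)

/-- A sheet containing a given point. -/
def sheetAt (y : X') : Opens X' := (exists_isSheet hφ (Opens.mem_top y)).choose

lemma mem_sheetAt (y : X') : y ∈ sheetAt hφ y :=
  (exists_isSheet hφ (Opens.mem_top y)).choose_spec.1

lemma isSheet_sheetAt (y : X') : IsSheet φ (sheetAt hφ y) :=
  (exists_isSheet hφ (Opens.mem_top y)).choose_spec.2.2

/-- The section of the local system over the image of `sheetAt hφ y` that represents there a given
global section of the inverse image of the local system. -/
def descendAt (y : X') : sec ((inverseImage k φ).obj (localSystem M)) ⊤ →ₗ[k]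
    sec (localSystem M) (hφ.isOpenMap.functor.obj (sheetAt hφ y)) :=
  (sheetEquiv hφ.isOpenMap (localSystem M) (isSheet_sheetAt hφ y).injOn).symm.toLinearMap ∘ₗ
    res _ le_top

lemma pull_descendAt (y : X') (s : sec ((inverseImage k φ).obj (localSystem M)) ⊤) :
    pull φ (localSystem M) (le_map_functor hφ.isOpenMap _) (descendAt M hφ y s) =
      res _ le_top s :=
  pull_sheetEquiv_symm hφ.isOpenMap _ (isSheet_sheetAt hφ y).injOn _

/-- The value at a point of a global section of the inverse image of the local system. -/
def valueAt (y : X') : sec ((inverseImage k φ).obj (localSystem M)) ⊤ →ₗ[k] M :=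
  evalAt M (U := hφ.isOpenMap.functor.obj (sheetAt hφ y)) y ⟨y, mem_sheetAt hφ y, rfl⟩ ∘ₗ
    descendAt M hφ y

lemma valueAt_eq {U : Opens X} {V : Opens X'} (hVU : V ≤ (Opens.map φ).obj U) {y : X'}
    (hy : y ∈ V) {f : sec (localSystem M) U} {s : sec ((inverseImage k φ).obj (localSystem M)) ⊤}
    (hs : pull φ (localSystem M) hVU f = res _ le_top s) :
    valueAt M hφ y s = evalAt M y (hVU hy) f := by
  let V' := V ⊓ sheetAt hφ y
  let U' := hφ.isOpenMap.functor.obj V'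
  have hU : U' ≤ U := Set.image_subset_iff.mpr fun z hz ↦ hVU hz.1
  have hU' : U' ≤ hφ.isOpenMap.functor.obj (sheetAt hφ y) := Set.image_mono Set.inter_subset_right
  have res_eq : res _ hU f = res _ hU' (descendAt M hφ y s) := by
    apply (sheetEquiv hφ.isOpenMap (localSystem M) (V := V')
      ((isSheet_sheetAt hφ y).injOn.mono Set.inter_subset_right)).injective
    calc
      _ = res _ inf_le_left (pull φ _ hVU f) := (pull_res φ _ _ hU f).trans (res_pull ..).symm
      _ = res _ inf_le_right (pull φ _ (le_map_functor _ _) (descendAt M hφ y s)) := by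
        rw [hs, pull_descendAt, res_res, res_res]
      _ = _ := (res_pull ..).trans (pull_res φ _ _ hU' _).symm
  exact congrArg (evalAt M (U := U') y ⟨y, ⟨hy, mem_sheetAt hφ y⟩, rfl⟩) res_eq.symm

lemma valueAt_eq_of_preconnected [PreconnectedSpace X'] (y z : X')
    (s : sec ((inverseImage k φ).obj (localSystem M)) ⊤) :
    valueAt M hφ y s = valueAt M hφ z s := by
  suffices IsLocallyConstant (fun y ↦ valueAt M hφ y s) from
    this.apply_eq_of_preconnectedSpace y z
  rw [IsLocallyConstant.iff_exists_open]
  intro y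
  have valueAt_of_mem (z : X') (hz : z ∈ sheetAt hφ y) : valueAt M hφ z s =
      evalAt M z (le_map_functor hφ.isOpenMap _ hz) (descendAt M hφ y s) :=
    valueAt_eq M hφ _ hz (pull_descendAt M hφ y s)
  obtain ⟨_, hO', hyO, h⟩ := (IsLocallyConstant.iff_exists_open _).mp
    (isLocallyConstant_evalAt M (descendAt M hφ y s))
    ⟨y, le_map_functor hφ.isOpenMap _ (mem_sheetAt hφ y)⟩
  obtain ⟨O, hO, rfl⟩ := isOpen_induced_iff.mp hO'
  refine ⟨O ∩ sheetAt hφ y, hO.inter (sheetAt hφ y).isOpen, ⟨hyO, mem_sheetAt hφ y⟩, ?_⟩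
  rintro z ⟨hzO, hz⟩
  rw [valueAt_of_mem z hz, valueAt_of_mem y (mem_sheetAt hφ y)]
  exact h ⟨z, le_map_functor hφ.isOpenMap _ hz⟩ hzO

lemma valueAt_deckPull (g : deckGroup φ) (y : X')
    (s : sec ((inverseImage k φ).obj (localSystem M)) ⊤) :
    valueAt M hφ (g.1 y) (deckPull g⁻¹ (localSystem M) (le_deckMap_top g⁻¹ ⊤) s) =
      M.ρ g (valueAt M hφ y s) := by
  let V := sheetAt hφ y
  let W : Opens X' := (Opens.map (deckMap g⁻¹)).obj V
  have hW : W ≤ (Opens.map φ).obj (hφ.isOpenMap.functor.obj V) := fun z hz ↦ ⟨_, hz, (g⁻¹).2 z⟩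
  have hyW : g.1 y ∈ W :=
    (congrArg (· ∈ V) (g.1.symm_apply_apply y)).mpr (mem_sheetAt hφ y)
  have pull_W : pull φ (localSystem M) hW (descendAt M hφ y s) =
      res _ le_top (deckPull g⁻¹ (localSystem M) (le_deckMap_top g⁻¹ ⊤) s) := by
    rw [res_deckPull, ← deckPull_res g⁻¹ (localSystem M) (le_refl W) (le_top : V ≤ ⊤),
      ← pull_descendAt, deckPull_pull]
  exact (valueAt_eq M hφ hW hyW pull_W).trans (evalAt_deck M g y _ _)

end Fiber

variable [PreconnectedSpace X] [LocallyConnectedSpace X] (hφ : IsUniversalCovering φ)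

include hφ in
lemma valueAt_bijective (y : X') :
    Function.Bijective (valueAt M hφ.isCoveringMap.isLocalHomeomorph y) := by
  have hl := hφ.isCoveringMap.isLocalHomeomorph
  have hV := isSheet_sheetAt hl y
  have descendAt_bijective : Function.Bijective (descendAt M hl y) :=
    (sheetEquiv hl.isOpenMap (localSystem M) hV.injOn).symm.bijective.comp
      (res_inverseImage_bijective hφ (isQuasicoherent_localSystem M hφ) hV.isConnected)
  exact (evalAt_bijective M hφ (hV.isConnected.image _ φ.hom.continuous.continuousOn) hV.injOn rfl
    (mem_sheetAt hl y) _).comp descendAt_bijective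

include hφ in
lemma nonempty_sectionsRep_localSystem_iso :
    Nonempty ((sectionsRep k φ).obj (localSystem M) ≅ M) := by
  have := hφ.isSimplyConnected.connected
  have hl := hφ.isCoveringMap.isLocalHomeomorph
  let y : X' := Classical.arbitrary X'
  refine ⟨repIso (LinearEquiv.ofBijective _ (valueAt_bijective M hφ y)) fun g s ↦ ?_⟩
  calc valueAt M hl y (((sectionsRep k φ).obj (localSystem M)).ρ g s)
      = valueAt M hl (g.1 y) (((sectionsRep k φ).obj (localSystem M)).ρ g s) :=
        valueAt_eq_of_preconnected M hl _ _ _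
    _ = M.ρ g (valueAt M hl y s) :=
        (congrArg _ (sectionsRep_ρ (localSystem M) g s)).trans (valueAt_deckPull M hl g y s)

end LocalSystem

section Coreflection

variable {A C R : Type*} [Category* A] [Category* C] [Category* R] {ι : A ⥤ C} {Φ : C ⥤ R}
  [(ι ⋙ Φ).IsEquivalence]
  (h : ∀ (L : A) (F : C), Function.Bijective (fun a : ι.obj L ⟶ F ↦ Φ.map a))

include h

lemma isLeftAdjoint_of_map_bijective : ι.IsLeftAdjoint := by
  refine ι.isLeftAdjoint_of_rightAdjointObjIsDefined_eq_top (top_le_iff.mp fun F _ ↦ ?_)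
  let j : (ι ⋙ Φ).obj ((ι ⋙ Φ).objPreimage (Φ.obj F)) ≅ Φ.obj F := (ι ⋙ Φ).objObjPreimageIso _
  let homEquiv (L : A) : (L ⟶ (ι ⋙ Φ).objPreimage (Φ.obj F)) ≃ (ι.obj L ⟶ F) :=
    ((Functor.FullyFaithful.ofFullyFaithful (ι ⋙ Φ)).homEquiv.trans j.homToEquiv).trans
      (Equiv.ofBijective _ (h L F)).symm
  have map_homEquiv {L : A} (f : L ⟶ _) : Φ.map (homEquiv L f) = Φ.map (ι.map f) ≫ j.hom :=
    (Equiv.ofBijective _ (h L F)).apply_symm_apply _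
  have homEquiv_comp {L L' : A} (f : L ⟶ L') (g : L' ⟶ _) :
      homEquiv L (f ≫ g) = ι.map f ≫ homEquiv L' g :=
    (h L F).1 (by simp only [map_homEquiv, Functor.map_comp, Category.assoc])
  exact ⟨_, ⟨{ homEquiv := homEquiv _, homEquiv_comp := homEquiv_comp }⟩⟩

-- By Yoneda: composition with `Φ ε_F` on `Hom(Φ ι L, -)` is the chain of bijections
-- `Hom(Φ ι L, Φ ι G F) ≃ Hom(L, G F) ≃ Hom(ι L, F) ≃ Hom(Φ ι L, Φ F)`.
lemma isIso_map_counit {G : C ⥤ A} (adj : ι ⊣ G) (F : C) : IsIso (Φ.map (adj.counit.app F)) := by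
  have comp_bijective (L : A) : Function.Bijective
      (fun x : (ι ⋙ Φ).obj L ⟶ Φ.obj ((G ⋙ ι).obj F) ↦ x ≫ Φ.map (adj.counit.app F)) := by
    refine (Function.Bijective.of_comp_iff _ (Functor.FullyFaithful.ofFullyFaithful
      (ι ⋙ Φ)).homEquiv.bijective).mp ?_
    have comp_eq : (· ≫ Φ.map (adj.counit.app F)) ∘ (fun b : L ⟶ G.obj F ↦ (ι ⋙ Φ).map b) =
        (fun a : ι.obj L ⟶ F ↦ Φ.map a) ∘ (adj.homEquiv L F).symm :=
      funext fun b ↦ by simp [adj.homEquiv_counit]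
    exact comp_eq ▸ (h L F).comp (adj.homEquiv L F).symm.bijective
  refine isIso_of_yoneda_map_bijective _ fun T ↦ ?_
  let t := (ι ⋙ Φ).objObjPreimageIso T
  refine (Function.Bijective.of_comp_iff _ t.homFromEquiv.bijective).mp ?_
  convert t.homFromEquiv.bijective.comp (comp_bijective _) using 1
  exact funext fun x ↦ by simp

end Coreflection

section Equivalence

variable {k : Type u} [Ring k] {X X' : TopCat.{u}} {φ : X' ⟶ X} [PreconnectedSpace X]
  [LocallyConnectedSpace X] (hφ : IsUniversalCovering φ)

include hφ

lemma qcohRep_isEquivalence : (qcohRep k φ).IsEquivalence where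
  faithful := ⟨fun {L _} _ _ h ↦ ObjectProperty.hom_ext _ (sectionsRep_map_injective hφ L.2 h)⟩
  full := ⟨fun {L _} h ↦
    have ⟨a, ha⟩ := sectionsRep_map_surjective hφ L.2 h
    ⟨ObjectProperty.homMk a, ha⟩⟩
  essSurj := ⟨fun M ↦ ⟨⟨localSystem M, isQuasicoherent_localSystem M hφ⟩,
    nonempty_sectionsRep_localSystem_iso M hφ⟩⟩

lemma sectionsRep_map_bijective (L : Qcoh k X) (F : Shv k X) : Function.Bijective
    (fun a : (isQuasicoherent k X).ι.obj L ⟶ F ↦ (sectionsRep k φ).map a) :=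
  ⟨fun _ _ h ↦ sectionsRep_map_injective hφ L.2 h, fun h ↦ sectionsRep_map_surjective hφ L.2 h⟩

lemma isLeftAdjoint_ι : (isQuasicoherent k X).ι.IsLeftAdjoint :=
  have : ((isQuasicoherent k X).ι ⋙ sectionsRep k φ).IsEquivalence := qcohRep_isEquivalence hφ
  isLeftAdjoint_of_map_bijective (sectionsRep_map_bijective hφ)

lemma isIso_sectionsRep_counit {Qc : Shv k X ⥤ Qcoh k X} (adj : (isQuasicoherent k X).ι ⊣ Qc)
    (F : Shv k X) : IsIso ((sectionsRep k φ).map (adj.counit.app F)) :=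
  have : ((isQuasicoherent k X).ι ⋙ sectionsRep k φ).IsEquivalence := qcohRep_isEquivalence hφ
  isIso_map_counit (sectionsRep_map_bijective hφ) adj F

end Equivalence

section Exactness

variable {k : Type u} [Ring k] {X X' : TopCat.{u}} {φ : X' ⟶ X} [LocallyConnectedSpace X]
  (hφ : IsUniversalCovering φ)

instance : PreservesFiniteLimits (isQuasicoherent k X).ι where
  preservesFiniteLimits J _ _ := by
    have := qcoh_limits k (X := X) J
    infer_instance

instance : PreservesFiniteColimits (isQuasicoherent k X).ι where
  preservesFiniteColimits J _ _ := by
    have := qcoh_colimits k (X := X) J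
    infer_instance

/-- The functor `L ↦ Γ(X', φ⁻¹L)` from quasi-coherent sheaves on `X` to modules. -/
abbrev qcohSections (φ : X' ⟶ X) : Qcoh k X ⥤ ModuleCat.{u} k :=
  (isQuasicoherent k X).ι ⋙ inverseImage k φ ⋙ globalSections k X'

include hφ in
-- On quasi-coherent sheaves the exact functor `φ⁻¹` is the composite of `Γ(X', φ⁻¹-)` and the
-- constant sheaf functor, which preserves and reflects finite limits and colimits.
lemma qcohSections_preserves : PreservesFiniteLimits (qcohSections (k := k) φ) ∧
    PreservesFiniteColimits (qcohSections (k := k) φ) := by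
  have := hφ.isSimplyConnected.connected
  let S : Qcoh k X ⥤ Shv k X' := (isQuasicoherent k X).ι ⋙ inverseImage k φ
  have isIso_counit (L : Qcoh k X) : IsIso ((constSheafAdj k X').counit.app (S.obj L)) := by
    rw [(constSheafAdj k X').isIso_counit_app_iff_mem_essImage]
    exact essImage_inverseImage_of_isQuasicoherent hφ L.2
  let i : S ≅ qcohSections φ ⋙ constSheaf k X' :=
    (NatIso.ofComponents (fun L ↦ asIso ((constSheafAdj k X').counit.app (S.obj L)))
      (fun f ↦ (constSheafAdj k X').counit.naturality (S.map f))).symm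
  have : PreservesFiniteLimits (qcohSections φ ⋙ constSheaf k X') :=
    have : PreservesFiniteLimits S := comp_preservesFiniteLimits _ _
    preservesFiniteLimits_of_natIso i
  have : PreservesFiniteColimits (qcohSections φ ⋙ constSheaf k X') :=
    have : PreservesFiniteColimits S := comp_preservesFiniteColimits _ _
    preservesFiniteColimits_of_natIso i
  exact ⟨⟨fun J _ _ ↦ preservesLimitsOfShape_of_reflects_of_preserves _ (constSheaf k X')⟩,
    ⟨fun J _ _ ↦ preservesColimitsOfShape_of_reflects_of_preserves _ (constSheaf k X')⟩⟩

end Exactness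

open DerivedCategory.Plus

section HomologyOfComplexes

/-- The natural transformation on bounded below complexes induced by a natural transformation. -/
def complexMap {C D : Type*} [Category* C] [Category* D] [Preadditive C] [Preadditive D]
    {F G : C ⥤ D} [F.PreservesZeroMorphisms] [G.PreservesZeroMorphisms] (τ : F ⟶ G) :
    F.mapCochainComplexPlus ⟶ G.mapCochainComplexPlus where
  app K := ObjectProperty.homMk ((NatTrans.mapHomologicalComplex τ (ComplexShape.up ℤ)).app K.obj)
  naturality _ _ f := ObjectProperty.hom_ext _
    ((NatTrans.mapHomologicalComplex τ (ComplexShape.up ℤ)).naturality f.hom)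

variable {C D : Type*} [Category* C] [Category* D] [Abelian C] [Abelian D]
  (T : C ⥤ D) [T.Additive] [PreservesFiniteLimits T] [PreservesFiniteColimits T] (i : ℤ)

/-- The cohomology of complexes commutes with exact functors. -/
def homologyMapExact : T.mapHomologicalComplex (ComplexShape.up ℤ) ⋙
      HomologicalComplex.homologyFunctor D (ComplexShape.up ℤ) i ≅
    HomologicalComplex.homologyFunctor C (ComplexShape.up ℤ) i ⋙ T :=
  NatIso.ofComponents (fun K ↦ (K.sc i).mapHomologyIso T)
    (fun f ↦ ShortComplex.mapHomologyIso_hom_naturality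
      ((HomologicalComplex.shortComplexFunctor C (ComplexShape.up ℤ) i).map f) T)

variable {T} in
lemma homologyMapExact_commSq (σ : T ⟶ T) (K : CochainComplex C ℤ) :
    CommSq ((homologyMapExact T i).hom.app K)
      (HomologicalComplex.homologyMap
        ((NatTrans.mapHomologicalComplex σ (ComplexShape.up ℤ)).app K) i)
      (σ.app (K.homology i)) ((homologyMapExact T i).hom.app K) := by
  have eq_conj : HomologicalComplex.homologyMap
      ((NatTrans.mapHomologicalComplex σ (ComplexShape.up ℤ)).app K) i =
        ((homologyMapExact T i).app K).hom ≫ σ.app (K.homology i) ≫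
          ((homologyMapExact T i).app K).inv :=
    ShortComplex.homologyMap_mapNatTrans (K.sc i) σ
  exact ⟨((Iso.eq_comp_inv _).mp (eq_conj.trans (Category.assoc _ _ _).symm)).symm⟩

variable [HasDerivedCategory C] [HasDerivedCategory D]

variable (C) in
/-- The localization functor from bounded below complexes to the derived category. -/
abbrev complexQ : CochainComplex.Plus C ⥤ DerivedCategory.Plus C :=
  HomotopyCategory.Plus.quotient C ⋙ Qh

variable (C) in
/-- The cohomology in the derived category is the cohomology of complexes. -/
def homologyComplexQ : complexQ C ⋙ homologyFunctor C i ≅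
    CochainComplex.Plus.ι C ⋙ HomologicalComplex.homologyFunctor C (ComplexShape.up ℤ) i :=
  Functor.isoWhiskerLeft (CochainComplex.Plus.ι C)
    (Functor.isoWhiskerRight (DerivedCategory.quotientCompQhIso C)
      (DerivedCategory.homologyFunctor C i) ≪≫ DerivedCategory.homologyFunctorFactors C i)

/-- The cohomology in the derived category commutes with exact functors. -/
def homologyExact : T.mapCochainComplexPlus ⋙ complexQ D ⋙ homologyFunctor D i ≅
      (complexQ C ⋙ homologyFunctor C i) ⋙ T :=
  Functor.isoWhiskerLeft T.mapCochainComplexPlus (homologyComplexQ D i) ≪≫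
    Functor.isoWhiskerLeft (CochainComplex.Plus.ι C) (homologyMapExact T i) ≪≫
      Functor.isoWhiskerRight (homologyComplexQ C i).symm T

variable {T} in
lemma homologyExact_commSq (σ : T ⟶ T) (K : CochainComplex.Plus C) :
    CommSq ((homologyExact T i).hom.app K)
      ((homologyFunctor D i).map ((complexQ D).map ((complexMap σ).app K)))
      (σ.app ((homologyFunctor C i).obj ((complexQ C).obj K)))
      ((homologyExact T i).hom.app K) :=
  have homologyComplexQ_commSq : CommSq ((homologyComplexQ D i).hom.app _) _ _
      ((homologyComplexQ D i).hom.app _) :=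
    ⟨((homologyComplexQ D i).hom.naturality ((complexMap σ).app K)).symm⟩
  have σ_commSq : CommSq (T.map ((homologyComplexQ C i).inv.app K)) _ _ _ :=
    ⟨σ.naturality ((homologyComplexQ C i).inv.app K)⟩
  homologyComplexQ_commSq.horiz_comp ((homologyMapExact_commSq i σ K.obj).horiz_comp σ_commSq)

end HomologyOfComplexes

section Injectives

variable (C : Type*) [Category* C] [Abelian C] [HasDerivedCategory C]

/-- The functor from bounded below complexes of injective objects to the derived category. -/
abbrev injectiveComplexQ : CochainComplex.Plus (InjectiveObject C) ⥤ DerivedCategory.Plus C :=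
  (InjectiveObject.ι C).mapCochainComplexPlus ⋙ complexQ C

instance : (injectiveComplexQ C).Full where
  map_surjective {K L} f := by
    obtain ⟨n, _⟩ := L.2
    let L' := (InjectiveObject.ι C).mapCochainComplexPlus.obj L
    have (n : ℤ) : Injective (L'.obj.X n) := (L.obj.X n).property
    have : L'.obj.IsStrictlyGE n := inferInstanceAs (CochainComplex.IsStrictlyGE
      (((InjectiveObject.ι C).mapHomologicalComplex _).obj L.obj) n)
    obtain ⟨g, rfl⟩ := (Qh_map_bijective_of_isKInjective _
      ((HomotopyCategory.Plus.quotient C).obj L')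
      (CochainComplex.isKInjective_of_injective L'.obj n)).2 f
    obtain ⟨g, rfl⟩ := (InjectiveObject.ι C).mapHomotopyCategoryPlus.map_surjective
      (X := (HomotopyCategory.Plus.quotient _).obj K)
      (Y := (HomotopyCategory.Plus.quotient _).obj L) g
    obtain ⟨g, rfl⟩ := (HomotopyCategory.Plus.quotient (InjectiveObject C)).map_surjective g
    exact ⟨g, rfl⟩

instance [EnoughInjectives C] : (injectiveComplexQ C).EssSurj :=
  inferInstanceAs (HomotopyCategory.Plus.quotient (InjectiveObject C) ⋙
    (InjectiveObject.ι C).mapHomotopyCategoryPlus ⋙ Qh).EssSurj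

end Injectives

section Whiskering

variable {J D M : Type*} [Category* J] [Category* D] [Category* M] (L : J ⥤ D) [L.EssSurj]

instance : ((Functor.whiskeringLeft J D M).obj L).Faithful where
  map_injective {F G α β} h := by
    ext X
    rw [← cancel_epi (F.map (L.objObjPreimageIso X).hom), α.naturality, β.naturality]
    exact congrArg (· ≫ _) (NatTrans.congr_app h _)

instance [L.Full] : ((Functor.whiskeringLeft J D M).obj L).Full where
  map_surjective {F G} θ := by
    have naturality {j j' : J} (f : L.obj j ⟶ L.obj j') :
        F.map f ≫ θ.app j' = θ.app j ≫ G.map f := by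
      obtain ⟨f, rfl⟩ := L.map_surjective f
      exact θ.naturality f
    let e (X : D) := L.objObjPreimageIso X
    refine ⟨⟨fun X ↦ F.map (e X).inv ≫ θ.app _ ≫ G.map (e X).hom, fun X Y f ↦ ?_⟩, ?_⟩
    · have := naturality ((e X).hom ≫ f ≫ (e Y).inv)
      simp only [Functor.map_comp, Category.assoc] at this
      rw [← cancel_epi (F.map (e X).hom), reassoc_of% this]
      simp [← Functor.map_comp, ← Functor.map_comp_assoc]
    · ext j
      simp [← naturality (e (L.obj j)).hom, ← Functor.map_comp_assoc]

end Whiskering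

section DerivedUnit

variable {C D : Type*} [Category* C] [Category* D] [Abelian C] [Abelian D]
  [HasDerivedCategory C] [HasDerivedCategory D] [EnoughInjectives C] (F : C ⥤ D) [F.Additive]

/-- The canonical morphism `F(K) ⟶ RF(K)` for bounded below complexes `K`. -/
def derivedUnit : F.mapCochainComplexPlus ⋙ complexQ D ⟶ complexQ C ⋙ F.rightDerivedFunctorPlus :=
  Functor.whiskerLeft (HomotopyCategory.Plus.quotient C) F.rightDerivedFunctorPlusUnit

lemma isIso_derivedUnit_app {K : CochainComplex.Plus C} (hK : ∀ n, Injective (K.obj.X n)) :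
    IsIso ((derivedUnit F).app K) :=
  have (n : ℤ) : Injective (K.obj.X n) := hK n
  inferInstanceAs (IsIso (F.rightDerivedFunctorPlusUnit.app
    ((HomotopyCategory.Plus.quotient C).obj K)))

/-- A functor is its own right derived functor on complexes of injective objects. -/
def derivedUnitIso {J : Type*} [Category* J] (N : J ⥤ CochainComplex.Plus C)
    (hN : ∀ j n, Injective ((N.obj j).obj.X n)) :
    N ⋙ F.mapCochainComplexPlus ⋙ complexQ D ≅ N ⋙ complexQ C ⋙ F.rightDerivedFunctorPlus :=
  have (j : J) : IsIso ((Functor.whiskerLeft N (derivedUnit F)).app j) :=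
    isIso_derivedUnit_app F (hN j)
  have := NatIso.isIso_of_isIso_app (Functor.whiskerLeft N (derivedUnit F))
  asIso (Functor.whiskerLeft N (derivedUnit F))

end DerivedUnit

section Operator

variable {C D E : Type*} [Category* C] [Category* D] [Category* E] [Abelian C] [Abelian D]
  [Abelian E] [HasDerivedCategory D] [HasDerivedCategory E] [EnoughInjectives D] (Γ : D ⥤ E)
  [Γ.Additive] (R : C ⥤ D) [R.Additive] {A : D ⥤ D} [A.Additive] [PreservesFiniteLimits A]
  [PreservesFiniteColimits A] (u : Γ ⟶ A ⋙ Γ) (b : R ⋙ A ⟶ R)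

lemma derivedUnit_commSq (K : CochainComplex.Plus C) :
    CommSq ((derivedUnit Γ).app (R.mapCochainComplexPlus.obj K))
      ((complexQ E).map ((complexMap (sectionsOp Γ R A u b)).app K))
      ((derivedOp Γ R A u b).app ((HomotopyCategory.Plus.quotient C).obj K))
      ((derivedUnit Γ).app (R.mapCochainComplexPlus.obj K)) :=
  let q := (HomotopyCategory.Plus.quotient C).obj K
  have pull_commSq : CommSq (Γ.rightDerivedFunctorPlusUnit.app _) _
      ((derivedPull Γ A u).app (R.mapHomotopyCategoryPlus.obj q)) _ :=
    ⟨derivedPull_fac_app Γ (u := u) _⟩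
  have map_commSq : CommSq (Γ.rightDerivedFunctorPlusUnit.app _) _ _ _ :=
    ⟨(Γ.rightDerivedFunctorPlusUnit.naturality ((mapPlusFrom b).app q)).symm⟩
  have map_eq : Qh.map ((mapPlusTo u).app (R.mapHomotopyCategoryPlus.obj q)) ≫
      Qh.map (Γ.mapHomotopyCategoryPlus.map ((mapPlusFrom b).app q)) =
        (complexQ E).map ((complexMap (sectionsOp Γ R A u b)).app K) :=
    (Qh.map_comp _ _).symm
  ⟨(pull_commSq.vert_comp map_commSq).w.trans (congrArg (· ≫ _) map_eq)⟩

variable [HasDerivedCategory C] [PreservesFiniteLimits R] [PreservesFiniteColimits R]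

/-- The endomorphism of the functor `K ↦ RΓ(R(K))` on the derived category that extends the
composite `RΓ(R(K)) ⟶ RΓ(A(R(K))) ⟶ RΓ(R(K))` induced by `u` and `b`. -/
def exactDerivedOp : exactDerived R ⋙ Γ.rightDerivedFunctorPlus ⟶
    exactDerived R ⋙ Γ.rightDerivedFunctorPlus :=
  Localization.liftNatTrans Qh (HomotopyCategory.Plus.quasiIso C)
    (R.mapHomotopyCategoryPlus ⋙ Qh ⋙ Γ.rightDerivedFunctorPlus)
    (R.mapHomotopyCategoryPlus ⋙ Qh ⋙ Γ.rightDerivedFunctorPlus) _ _ (derivedOp Γ R A u b)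

lemma exactDerivedOp_commSq (K : HomotopyCategory.Plus C) :
    CommSq (Γ.rightDerivedFunctorPlus.map ((exactDerivedFac R).inv.app K))
      ((derivedOp Γ R A u b).app K) ((exactDerivedOp Γ R u b).app (Qh.obj K))
      (Γ.rightDerivedFunctorPlus.map ((exactDerivedFac R).inv.app K)) :=
  let e := Γ.rightDerivedFunctorPlus.mapIso ((exactDerivedFac R).app K)
  have app_eq : (exactDerivedOp Γ R u b).app (Qh.obj K) =
      e.hom ≫ (derivedOp Γ R A u b).app K ≫ e.inv :=
    Localization.liftNatTrans_app Qh (HomotopyCategory.Plus.quasiIso C) _ _ _ _ _ K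
  ⟨(Iso.inv_comp_eq e).mpr app_eq⟩

end Operator

section Comparison

variable {C D E Q : Type*} [Category* C] [Category* D] [Category* E] [Category* Q]
  [Abelian C] [Abelian D] [Abelian E] [Abelian Q]
  {S : C ⥤ Q} [S.Additive] {T : Q ⥤ E} [T.Additive] {R : C ⥤ D} [R.Additive]
  {Γ : D ⥤ E} [Γ.Additive] (ε : S ⋙ T ≅ R ⋙ Γ)

/-- The isomorphism on complexes induced by an isomorphism between composites of functors. -/
def complexCompIso : S.mapCochainComplexPlus ⋙ T.mapCochainComplexPlus ≅
    R.mapCochainComplexPlus ⋙ Γ.mapCochainComplexPlus :=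
  NatIso.ofComponents (fun K ↦ ObjectProperty.isoMk _
    ((NatIso.mapHomologicalComplex ε (ComplexShape.up ℤ)).app K.obj))
    (fun f ↦ ObjectProperty.hom_ext _
      ((NatTrans.mapHomologicalComplex ε.hom (ComplexShape.up ℤ)).naturality f.hom))

variable {ε} in
lemma complexCompIso_commSq {σ : T ⟶ T} {τ : R ⋙ Γ ⟶ R ⋙ Γ}
    (h : Functor.whiskerLeft S σ ≫ ε.hom = ε.hom ≫ τ) (K : CochainComplex.Plus C) :
    CommSq ((complexCompIso ε).hom.app K) ((complexMap σ).app (S.mapCochainComplexPlus.obj K))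
      ((complexMap τ).app K) ((complexCompIso ε).hom.app K) := by
  refine ⟨ObjectProperty.hom_ext _ ?_⟩
  ext n
  exact (NatTrans.congr_app h (K.obj.X n)).symm

variable [PreservesFiniteLimits T] [PreservesFiniteColimits T] [PreservesFiniteLimits R]
  [PreservesFiniteColimits R] [HasDerivedCategory C] [HasDerivedCategory D]
  [HasDerivedCategory E] [HasDerivedCategory Q] [EnoughInjectives C] [EnoughInjectives D]
  (hR : ∀ I : C, Injective I → Injective (R.obj I)) (i : ℤ)

/-- `T(Hⁱ(RS(K))) ≅ Hⁱ(RΓ(R(K)))` for bounded below complexes `K` of injective objects, as the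
chain `T(Hⁱ(RS(K))) ≅ T(Hⁱ(S(K))) ≅ Hⁱ(T(S(K))) ≅ Hⁱ(Γ(R(K))) ≅ Hⁱ(RΓ(R(K)))`. -/
def injectiveComparison :
    injectiveComplexQ C ⋙ (S.rightDerivedFunctorPlus ⋙ homologyFunctor Q i) ⋙ T ≅
      injectiveComplexQ C ⋙ (exactDerived R ⋙ Γ.rightDerivedFunctorPlus) ⋙ homologyFunctor E i :=
  let N := (InjectiveObject.ι C).mapCochainComplexPlus
  Functor.isoWhiskerRight (derivedUnitIso S N fun K n ↦ (K.obj.X n).property).symm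
    (homologyFunctor Q i ⋙ T) ≪≫
  Functor.isoWhiskerLeft (N ⋙ S.mapCochainComplexPlus) (homologyExact T i).symm ≪≫
  Functor.isoWhiskerRight (Functor.isoWhiskerLeft N (complexCompIso ε))
    (complexQ E ⋙ homologyFunctor E i) ≪≫
  Functor.isoWhiskerRight (derivedUnitIso Γ (N ⋙ R.mapCochainComplexPlus)
    fun K n ↦ hR _ (K.obj.X n).property) (homologyFunctor E i) ≪≫
  Functor.isoWhiskerRight (Functor.isoWhiskerLeft (N ⋙ HomotopyCategory.Plus.quotient C)
    (exactDerivedFac R)).symm (Γ.rightDerivedFunctorPlus ⋙ homologyFunctor E i)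

variable {A : D ⥤ D} [A.Additive] [PreservesFiniteLimits A] [PreservesFiniteColimits A]
  {σ : T ⟶ T} {u : Γ ⟶ A ⋙ Γ} {b : R ⋙ A ⟶ R}

variable {ε} in
lemma injectiveComparison_commSq
    (h : Functor.whiskerLeft S σ ≫ ε.hom = ε.hom ≫ sectionsOp Γ R A u b)
    (K : CochainComplex.Plus (InjectiveObject C)) :
    CommSq ((injectiveComparison ε hR i).hom.app K) (σ.app _)
      ((homologyFunctor E i).map ((exactDerivedOp Γ R u b).app _))
      ((injectiveComparison ε hR i).hom.app K) :=
  let N := (InjectiveObject.ι C).mapCochainComplexPlus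
  have unit_commSq : CommSq (T.map ((homologyFunctor Q i).map
      ((derivedUnitIso S N fun K n ↦ (K.obj.X n).property).inv.app K))) _ _ _ :=
    ⟨σ.naturality _⟩
  have homology_commSq := homologyExact_commSq i σ (S.mapCochainComplexPlus.obj (N.obj K))
  have homology_inv_commSq : CommSq ((homologyExact T i).inv.app _) _ _ _ :=
    homology_commSq.horiz_inv (f := (homologyExact T i).app _) (i := (homologyExact T i).app _)
  have comp_commSq := (complexCompIso_commSq h (N.obj K)).map (complexQ E ⋙ homologyFunctor E i)
  have derivedUnit_commSq := (derivedUnit_commSq Γ R u b (N.obj K)).map (homologyFunctor E i)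
  have exactDerivedOp_commSq := (exactDerivedOp_commSq Γ R u b
    ((HomotopyCategory.Plus.quotient C).obj (N.obj K))).map (homologyFunctor E i)
  unit_commSq.horiz_comp (homology_inv_commSq.horiz_comp (comp_commSq.horiz_comp
    (derivedUnit_commSq.horiz_comp exactDerivedOp_commSq)))

/-- The isomorphism `T(Hⁱ(RS(K))) ≅ Hⁱ(RΓ(R(K)))` for `K` in the bounded below derived category. -/
def derivedComparison : (S.rightDerivedFunctorPlus ⋙ homologyFunctor Q i) ⋙ T ≅
    (exactDerived R ⋙ Γ.rightDerivedFunctorPlus) ⋙ homologyFunctor E i :=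
  ((Functor.whiskeringLeft _ _ _).obj (injectiveComplexQ C)).preimageIso
    (injectiveComparison ε hR i)

variable {ε} in
lemma whiskerLeft_comp_derivedComparison_hom
    (h : Functor.whiskerLeft S σ ≫ ε.hom = ε.hom ≫ sectionsOp Γ R A u b) :
    Functor.whiskerLeft (S.rightDerivedFunctorPlus ⋙ homologyFunctor Q i) σ ≫
        (derivedComparison ε hR i).hom =
      (derivedComparison ε hR i).hom ≫
        Functor.whiskerRight (exactDerivedOp Γ R u b) (homologyFunctor E i) := by
  have map_derivedComparison : Functor.whiskerLeft (injectiveComplexQ C)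
      (derivedComparison ε hR i).hom = (injectiveComparison ε hR i).hom :=
    ((Functor.whiskeringLeft _ _ _).obj (injectiveComplexQ C)).map_preimage _
  apply ((Functor.whiskeringLeft _ _ _).obj (injectiveComplexQ C)).map_injective
  ext K
  have comm := (injectiveComparison_commSq hR i h K).w.symm
  rw [← map_derivedComparison] at comm
  exact comm

end Comparison

section HigherQc

variable {k : Type u} [Ring k]

/-- The isomorphism of functors to representations induced by an equivariant isomorphism. -/
def toRepIso {G : Type u} [Group G] {B C : Type*} [Category* B] [Category* C] {L : C ⥤ B}
    {Φ : B ⥤ ModuleCat.{u} k} {Φ' : C ⥤ ModuleCat.{u} k} {ρ : G →* End Φ} {ρ' : G →* End Φ'}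
    (α : L ⋙ Φ ≅ Φ') (h : ∀ g, Functor.whiskerLeft L (ρ g) ≫ α.hom = α.hom ≫ ρ' g) :
    L ⋙ toRep k Φ ρ ≅ toRep k Φ' ρ' :=
  NatIso.ofComponents (fun F ↦ repIso (α.app F).toLinearEquiv fun g x ↦
      ConcreteCategory.congr_hom (NatTrans.congr_app (h g) F) x)
    fun f ↦ Rep.hom_ext (by ext x; exact ConcreteCategory.congr_hom (α.hom.naturality f) x)

variable {X X' : TopCat.{u}} {φ : X' ⟶ X} {Qc : Shv k X ⥤ Qcoh k X}
  (adj : (isQuasicoherent k X).ι ⊣ Qc)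

/-- The isomorphism `Γ(X', φ⁻¹Qc(F)) ≅ Γ(X', φ⁻¹F)` induced by the counit. -/
def sectionsCounitIso (h : ∀ F, IsIso ((sectionsRep k φ).map (adj.counit.app F))) :
    Qc ⋙ qcohSections φ ≅ inverseImage k φ ⋙ globalSections k X' :=
  have (F : Shv k X) : IsIso ((inverseImage k φ ⋙ globalSections k X').map (adj.counit.app F)) :=
    have := h F
    inferInstanceAs (IsIso ((forget₂ (Rep.{u} k (deckGroup φ)) (ModuleCat.{u} k)).map
      ((sectionsRep k φ).map (adj.counit.app F))))
  NatIso.ofComponents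
    (fun F ↦ asIso ((inverseImage k φ ⋙ globalSections k X').map (adj.counit.app F)))
    fun f ↦ (Functor.whiskerRight adj.counit (inverseImage k φ ⋙ globalSections k X')).naturality f

lemma whiskerLeft_comp_sectionsCounitIso_hom
    (h : ∀ F, IsIso ((sectionsRep k φ).map (adj.counit.app F))) (g : deckGroup φ) :
    Functor.whiskerLeft Qc (Functor.whiskerLeft (isQuasicoherent k X).ι (deckSections k φ g)) ≫
      (sectionsCounitIso adj h).hom = (sectionsCounitIso adj h).hom ≫ deckSections k φ g :=
  NatTrans.ext (funext fun F ↦ ((deckSections k φ g).naturality (adj.counit.app F)).symm)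

variable [PreconnectedSpace X] [LocallyConnectedSpace X] [HasDerivedCategory (Shv k X)]
  [HasDerivedCategory (Shv k X')] [HasDerivedCategory (ModuleCat.{u} k)]
  [HasDerivedCategory (Qcoh k X)]

lemma nonempty_higherQc_iso (hφ : IsUniversalCovering φ) (i : ℤ) :
    Nonempty (higherQc adj i ⋙ qcohRep k φ ≅ cohomologyRep k φ i) := by
  have : Qc.Additive := adj.right_adjoint_additive
  obtain ⟨_, _⟩ := qcohSections_preserves (k := k) hφ
  have : (qcohSections (k := k) φ).Additive := Functor.additive_of_preserves_binary_products _
  have isIso_counit := isIso_sectionsRep_counit hφ adj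
  have injective_pullback (I : Shv k X) (_ : Injective I) :
      Injective ((inverseImage k φ).obj I) :=
    injective_inverseImage hφ.isCoveringMap.isLocalHomeomorph I
  exact ⟨toRepIso (L := higherQc adj i ⋙ (isQuasicoherent k X).ι) (ρ := deckSectionsHom k φ)
    (ρ' := deckCohomologyHom k φ i)
    (derivedComparison (sectionsCounitIso adj isIso_counit) injective_pullback i)
    fun g ↦ whiskerLeft_comp_derivedComparison_hom injective_pullback i
      (whiskerLeft_comp_sectionsCounitIso_hom adj isIso_counit g⁻¹)⟩

end HigherQc

end LocSys

end

theorem mainTheorem7_general (k : Type u) [Ring k] (X X' : TopCat.{u}) [PreconnectedSpace X]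
    [LocallyConnectedSpace X] (φ : X' ⟶ X) (hφ : LocSys.IsUniversalCovering φ)
    [HasDerivedCategory (LocSys.Shv k X)] [HasDerivedCategory (LocSys.Shv k X')]
    [HasDerivedCategory (ModuleCat.{u} k)] [HasDerivedCategory (LocSys.Qcoh k X)] :
    (LocSys.qcohRep k φ).IsEquivalence ∧
    (LocSys.isQuasicoherent k X).ι.IsLeftAdjoint ∧
    (∀ (Qc : LocSys.Shv k X ⥤ LocSys.Qcoh k X) (adj : (LocSys.isQuasicoherent k X).ι ⊣ Qc) (i : ℤ),
      Nonempty (LocSys.higherQc adj i ⋙ LocSys.qcohRep k φ ≅ LocSys.cohomologyRep k φ i)) ∧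
    (∀ (Y Y' : TopCat.{u}) (ψ : Y' ⟶ Y), IsLocalHomeomorph ψ →
      ∀ I : LocSys.Shv k Y, Injective I → Injective ((LocSys.inverseImage k ψ).obj I)) :=
  ⟨LocSys.qcohRep_isEquivalence hφ, LocSys.isLeftAdjoint_ι hφ,
    fun _ adj i ↦ LocSys.nonempty_higherQc_iso adj hφ i,
    fun _ _ _ hψ I _ ↦ LocSys.injective_inverseImage hψ I⟩

theorem mainTheorem7 (k : Type u) [Ring k] (X X' : TopCat.{u}) [ConnectedSpace X]
    [LocSys.LocallySimplyConnected X] (φ : X' ⟶ X) (hφ : LocSys.IsUniversalCovering φ)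
    [HasDerivedCategory (LocSys.Shv k X)] [HasDerivedCategory (LocSys.Shv k X')]
    [HasDerivedCategory (ModuleCat.{u} k)] [HasDerivedCategory (LocSys.Qcoh k X)] :
    (LocSys.qcohRep k φ).IsEquivalence ∧
    (LocSys.isQuasicoherent k X).ι.IsLeftAdjoint ∧
    (∀ (Qc : LocSys.Shv k X ⥤ LocSys.Qcoh k X) (adj : (LocSys.isQuasicoherent k X).ι ⊣ Qc) (i : ℤ),
      Nonempty (LocSys.higherQc adj i ⋙ LocSys.qcohRep k φ ≅ LocSys.cohomologyRep k φ i)) ∧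
    (∀ (Y Y' : TopCat.{u}) (ψ : Y' ⟶ Y), IsCoveringMap ψ →
      ∀ I : LocSys.Shv k Y, Injective I → Injective ((LocSys.inverseImage k ψ).obj I)) :=
  have ⟨equivalence, adjoint, comparison, injective⟩ := mainTheorem7_general k X X' φ hφ
  ⟨equivalence, adjoint, comparison, fun Y Y' ψ hψ ↦ injective Y Y' ψ hψ.isLocalHomeomorph⟩
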